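/- **Model.** Let $\Delta_l=2^{-l}$, let $T,N\ge 1$ be integers, $y_0,\dots,y_T\in\mathsf Y$ fixed data, $\Theta$ a metric space with its Borel $\sigma$-algebra (for example a Borel subset of $\mathbb R^d$ with the $L_1$-distance), $d\theta$ a $\sigma$-finite measure on $\Theta$ and $\pi$ a prior probability density with respect to $d\theta$. On a probability space carrying a Brownian motion $W$, let, for each $\theta\in\Theta$, $V=V^{\theta}$ solve on $[0,T]$ the stochastic Volterra equation $$V_t=V_0+\int_0^tK(t-s)\{b_\theta(V_s)\,ds+\sigma_\theta(V_s)\,dW_s\},$$ with $V_0$ fixed and known. Here $b,\sigma$ are jointly measurable with $|b_\theta(v)|+|\sigma_\theta(v)|\le C(1+|v|)$ for all $\theta,v$, and for some $H\in[0,1/2)$ and $c<\infty$, $|K(t)|\le ct^H$ for $0<t\le T$ and $|K(t)-K(s)|\le c\,s^{H-1}(t-s)$ for $0<s\le t\le T$ (for example $K(t)=ct^H$). For increments $\overline w_{k\Delta_l}$ ($1\le k\le T\Delta_l^{-1}$) the Euler scheme of level $l$ is $v_0=V_0$, $$v_{(k+1)\Delta_l}=V_0+\sum_{j=0}^kK([k+1-j]\Delta_l)\{b_\theta(v_{j\Delta_l})\Delta_l+\sigma_\theta(v_{j\Delta_l})\overline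 w_{(j+1)\Delta_l}\},$$ and for $t=1,\dots,T$ the likelihood factors are $$\kappa_{t,l}=\overline g\Big(y_t;y_{t-1},\Delta_l\sum_{k=0}^{\Delta_l^{-1}-1}\overline f(v_{t-1+k\Delta_l}),\sum_{k=0}^{\Delta_l^{-1}-1}\overline h(v_{t-1+k\Delta_l})\overline w_{t-1+(k+1)\Delta_l}\Big).$$ The posterior $\pi^l$ is the probability law of $(\theta,\overline w)$ proportional to $\prod_t\kappa_{t,l}$ times the product of the prior and the law of independent $\mathcal N(0,\Delta_l)$ increments; $V_{1:T}$ under $\pi^l$ is the Euler path $v_1,\dots,v_T$. **Algorithm.** For $l\ge1$ let $\kappa_{t,l-1}$ be evaluated at the coarse increments obtained by adding consecutive pairs of fine increments (synchronous coupling). The delta particle filter with parameter $\theta$ propagates $N$ particles (sequences of fine increments) over the unit intervals with independent $\mathcal N(0,\Delta_l)$ increments, gives them the weights $\max\{\kappa_{t,l},\kappa_{t,l-1}\}$, resamples them multinomially after each time $t<T$, selects one particle at time $T$ according to the weights, and returns it with the estimate $\hat p=\prod_{t}\frac1N\sum_i(\text{weight of particle }i\text{ at time }t)$. The kernel $K_l$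 acts on the space $\mathsf W_l$ of $\theta$ together with all random variables of one run of the filter: from a state with parameter $\theta$ and estimate $\hat p$ it draws $\theta'$ from a proposal density $q_l(\cdot|\theta)$ with respect to $d\theta$, runs the filter with $\theta'$, and accepts the new state with probability $\min\{1,\hat p'\pi(\theta')q_l(\theta|\theta')/(\hat p\,\pi(\theta)q_l(\theta'|\theta))\}$ (read as $1$ if the denominator is $0$); otherwise it stays. Write $$H_{1,l}=\prod_{t=1}^T\frac{\kappa_{t,l}}{\max\{\kappa_{t,l},\kappa_{t,l-1}\}},\qquad H_{2,l}=\prod_{t=1}^T\frac{\kappa_{t,l-1}}{\max\{\kappa_{t,l},\kappa_{t,l-1}\}}.$$ From the states $0,\dots,M$ of a chain with kernel $K_l$, with parameters $\theta_k$, skeletons $v^l_{k,1:T}$, $v^{l-1}_{k,1:T}$ of the selected fine and coarse paths, and weights $H_{1,l}(k),H_{2,l}(k)$ evaluated at state $k$, form the estimator $$\widehat D_l^{M}(\varphi)=\frac{\frac1{M+1}\sum_{k=0}^M\varphi(\theta_k,v^l_{k,1:T})H_{1,l}(k)}{\frac1{M+1}\sum_{k=0}^MH_{1,l}(k)}-\frac{\frac1{M+1}\sum_{k=0}^M\varphi(\theta_k,v^{l-1}_{k,1:T})H_{2,l}(k)}{\frac1{M+1}\sum_{k=0}^MH_{2,l}(k)}.$$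 **Assumptions.** Let $0<\beta\le H+\tfrac12$. (A1) $\overline f,\overline h:\mathbb R\to\mathbb R$ are bounded and Lipschitz; for all $y,y'\in\mathsf Y$, $\overline g(y;y',\cdot,\cdot)$ is Lipschitz on $\mathbb R^2$ and takes its values between two constants $0<\underline C<\overline C<\infty$ that may depend on $y,y'$. (A2) For every $r\in[1,2]$ there is $C<\infty$ with $\sup_{\theta}\mathbb E[|V^l_t-V_t|^r]^{1/r}\le C\Delta_l^\beta$ for all $l\ge0$ and $t\in\{\Delta_l,2\Delta_l,\dots,T\}$, where $V^l$ is the Euler scheme driven by the increments of $W$. (A3) There is $\xi\in(0,1)$ and, for each $l\ge1$, a probability measure $\nu_l$ on $\mathsf W_l$ with $K_l(w,\cdot)\ge\xi\nu_l$ for all $w\in\mathsf W_l$; and $K_l$ is reversible with respect to its invariant probability measure $\eta_l$. **Claim.** For every bounded measurable $\varphi:\Theta\times\mathbb R^T\to\mathbb R$ that is Lipschitz for the sum of the distance of $\Theta$ and the $L_1$-distance of $\mathbb R^T$ there is $C<\infty$ such that for all integers $l,M_l\ge1$ and every Markov chain with kernel $K_l$ and initial law $\eta_l$, $$\mathbb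 E\Big[\big(\widehat D_l^{M_l}(\varphi)-\{\mathbb E_{\pi^l}[\varphi(\theta,V_{1:T})]-\mathbb E_{\pi^{l-1}}[\varphi(\theta,V_{1:T})]\}\big)^2\Big]\le\frac{C\Delta_l^{2\beta}}{M_l}.$$ -/

import Mathlib

open MeasureTheory ProbabilityTheory Filter Topology
open scoped NNReal ENNReal

noncomputable section

namespace SVE

/-- The step size `Δ_l = 2^{-l}`. -/
def stepSize (l : ℕ) : ℝ≥0 := (2⁻¹ : ℝ≥0) ^ l

/-! ### Itô integrals and Volterra equations -/

section Ito

variable {Ω : Type*} [MeasurableSpace Ω]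

/-- `W` is a standard Brownian motion with respect to the filtration `ℱ`: it is a Brownian motion,
it is adapted, and its increments after time `s` are independent of `ℱ s`. -/
structure IsBrownianFor (ℱ : Filtration ℝ≥0 (inferInstance : MeasurableSpace Ω)) (P : Measure Ω)
    (W : ℝ≥0 → Ω → ℝ) : Prop where
  isBrownian : IsBrownianReal W P
  adapted : StronglyAdapted ℱ W
  indep : ∀ s t : ℝ≥0, s ≤ t →
    Indep (MeasurableSpace.comap (fun ω => W t ω - W s ω) inferInstance) (ℱ s) P

/-- A simple integrand `∑_{i < n} ξ_i 1_{(t_i, t_{i+1}]}`, with `ξ_i` bounded and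
`ℱ_{t_i}`-measurable. -/
structure SimpleIntegrand (ℱ : Filtration ℝ≥0 (inferInstance : MeasurableSpace Ω)) where
  n : ℕ
  time : ℕ → ℝ≥0
  mono : Monotone time
  val : ℕ → Ω → ℝ
  meas : ∀ i, StronglyMeasurable[ℱ (time i)] (val i)
  bdd : ∀ i, ∃ C : ℝ, ∀ ω, |val i ω| ≤ C

/-- The process `∑_{i < n} ξ_i 1_{(t_i, t_{i+1}]}(s)`. -/
def SimpleIntegrand.process {ℱ : Filtration ℝ≥0 (inferInstance : MeasurableSpace Ω)}
    (S : SimpleIntegrand ℱ) (s : ℝ) (ω : Ω) : ℝ :=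
  ∑ i ∈ Finset.range S.n,
    (Set.Ioc (S.time i : ℝ) (S.time (i + 1) : ℝ)).indicator (fun _ => S.val i ω) s

/-- The elementary stochastic integral `∑_{i < n} ξ_i (W_{t ∧ t_{i+1}} - W_{t ∧ t_i})`. -/
def SimpleIntegrand.integral {ℱ : Filtration ℝ≥0 (inferInstance : MeasurableSpace Ω)}
    (S : SimpleIntegrand ℱ) (W : ℝ≥0 → Ω → ℝ) (t : ℝ≥0) (ω : Ω) : ℝ :=
  ∑ i ∈ Finset.range S.n,
    S.val i ω * (W (min t (S.time (i + 1))) ω - W (min t (S.time i)) ω)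

/-- `I` is (a version of) the Itô integral `∫_0^t G_s dW_s`: there are simple integrands `S_n` with
`∫_0^t (S_n(s) - G_s)² ds → 0` in probability whose elementary integrals over `[0,t]` converge to
`I` in probability. -/
def IsItoIntegral (ℱ : Filtration ℝ≥0 (inferInstance : MeasurableSpace Ω)) (P : Measure Ω)
    (W : ℝ≥0 → Ω → ℝ) (t : ℝ≥0) (G : ℝ → Ω → ℝ) (I : Ω → ℝ) : Prop :=
  ∃ S : ℕ → SimpleIntegrand ℱ,
    (∀ ε : ℝ≥0∞, 0 < ε → Tendsto
      (fun n => P {ω | ε ≤ ∫⁻ s in Set.Ioc 0 (t : ℝ),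
        ENNReal.ofReal (((S n).process s ω - G s ω) ^ 2)}) atTop (𝓝 0)) ∧
    TendstoInMeasure P (fun n => (S n).integral W t) atTop I

/-- `V` solves, on `[0,T]`, the stochastic Volterra equation
`V_t = v₀ + ∫_0^t K(t-s) b(V_s) ds + ∫_0^t K(t-s) σ(V_s) dW_s`. -/
structure IsVolterraSolution (ℱ : Filtration ℝ≥0 (inferInstance : MeasurableSpace Ω))
    (P : Measure Ω) (W : ℝ≥0 → Ω → ℝ) (T : ℝ≥0) (K b σ : ℝ → ℝ) (v₀ : ℝ)
    (V : ℝ≥0 → Ω → ℝ) : Prop where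
  adapted : StronglyAdapted ℱ V
  continuous : ∀ᵐ ω ∂P, ContinuousOn (fun t => V t ω) (Set.Iic T)
  integrable : ∀ t ≤ T, ∀ᵐ ω ∂P,
    IntegrableOn (fun s : ℝ => K (t - s) * b (V s.toNNReal ω)) (Set.Ioc 0 (t : ℝ))
  equation : ∀ t ≤ T, ∃ I : Ω → ℝ,
    IsItoIntegral ℱ P W t (fun s ω => K (t - s) * σ (V s.toNNReal ω)) I ∧
    ∀ᵐ ω ∂P, V t ω = v₀ + (∫ s in Set.Ioc 0 (t : ℝ), K (t - s) * b (V s.toNNReal ω)) + I ω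

end Ito

/-! ### The model and the data of the algorithm -/

/-- The data of the partially observed Volterra model and of the coupled MCMC algorithm:
* `T` observations `y 1, …, y T` at unit times, with `y 0` given;
* the observation density `g (y_t; y_{t-1}, x₁, x₂)` and the functionals `f`, `h`;
* the Volterra kernel `K`, coefficients `b θ`, `σ θ` and the known starting point `v₀`;
* the prior density `prior` with respect to the σ-finite measure `dom` on `Θ`;
* the number `N` of particles, and the proposals at level `l`: `q l θ θ'` is the density at `θ'`,
  with respect to `dom`, of the proposal made from `θ`.

For instance `b (κ,λ,ν) v = κ - λ v`, `σ (κ,λ,ν) v = ν √|v|` and `K t = c t^H`. -/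
structure Model (Θ Y : Type*) [MeasurableSpace Θ] where
  T : ℕ
  y : ℕ → Y
  g : Y → Y → ℝ → ℝ → ℝ
  f : ℝ → ℝ
  h : ℝ → ℝ
  K : ℝ → ℝ
  b : Θ → ℝ → ℝ
  σ : Θ → ℝ → ℝ
  v₀ : ℝ
  dom : Measure Θ
  prior : Θ → ℝ
  N : ℕ
  q : ℕ → Θ → Θ → ℝ
  [sigmaFinite_dom : SigmaFinite dom]

attribute [instance] Model.sigmaFinite_dom

namespace Model

variable {Θ Y : Type*} [MeasurableSpace Θ] (M : Model Θ Y)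

/-- A probability density with respect to `dom`. -/
def IsDensity (p : Θ → ℝ) : Prop :=
  Measurable p ∧ (∀ θ, 0 ≤ p θ) ∧ ∫⁻ θ, ENNReal.ofReal (p θ) ∂M.dom = 1

/-- Standing conditions: there are observations and particles; the prior and the proposals are
probability densities; the coefficients are measurable and of linear growth, uniformly in the
parameter; the Volterra kernel is of power type with index `H` (as is `K t = c t ^ H`). -/
structure Standing (H : ℝ) : Prop where
  T_pos : 1 ≤ M.T
  N_pos : 1 ≤ M.N
  prior_density : M.IsDensity M.prior
  q_measurable : ∀ l, Measurable (Function.uncurry (M.q l))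
  q_density : ∀ l θ, M.IsDensity (M.q l θ)
  b_measurable : Measurable (Function.uncurry M.b)
  σ_measurable : Measurable (Function.uncurry M.σ)
  linear_growth : ∃ C : ℝ, ∀ θ v, |M.b θ v| + |M.σ θ v| ≤ C * (1 + |v|)
  kernel_bound : ∃ c : ℝ, ∀ t : ℝ, 0 < t → t ≤ M.T → |M.K t| ≤ c * t ^ H
  kernel_modulus : ∃ c : ℝ, ∀ s t : ℝ, 0 < s → s ≤ t → t ≤ M.T →
    |M.K t - M.K s| ≤ c * s ^ (H - 1) * (t - s)

/-! ### Euler discretization and likelihoods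

The increments of the driving noise at level `l` are given as a sequence `w : ℕ → ℝ`, where `w j`
is the increment over `[j Δ_l, (j+1) Δ_l]`; only the terms with `j < T 2^l` matter. -/

/-- The Euler scheme at level `l`; `euler l θ w k` approximates `V` at time `k Δ_l`. -/
def euler (l : ℕ) (θ : Θ) (w : ℕ → ℝ) : ℕ → ℝ
  | 0 => M.v₀
  | k + 1 => M.v₀ + ∑ j : Fin (k + 1),
      M.K (((k : ℝ) + 1 - (j : ℕ)) * stepSize l) *
        (M.b θ (euler l θ w j) * stepSize l + M.σ θ (euler l θ w j) * w j)
termination_by k => k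
decreasing_by all_goals exact j.isLt

/-- The factor of the discretized likelihood of level `l` for the observation `y (t + 1)`,
`t = 0, …, T - 1`. -/
def lik (l : ℕ) (θ : Θ) (w : ℕ → ℝ) (t : ℕ) : ℝ :=
  M.g (M.y (t + 1)) (M.y t)
    (stepSize l * ∑ k ∈ Finset.range (2 ^ l), M.f (M.euler l θ w (t * 2 ^ l + k)))
    (∑ k ∈ Finset.range (2 ^ l), M.h (M.euler l θ w (t * 2 ^ l + k)) * w (t * 2 ^ l + k))

/-- The Euler approximations of `V_1, …, V_T`. -/
def skeleton (l : ℕ) (θ : Θ) (w : ℕ → ℝ) : Fin M.T → ℝ :=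
  fun t => M.euler l θ w ((t + 1) * 2 ^ l)

/-- The coarse increments that are synchronously coupled to the fine increments `w`. -/
def coarsen (w : ℕ → ℝ) (j : ℕ) : ℝ := w (2 * j) + w (2 * j + 1)

/-! ### The posterior at level `l` -/

/-- Extension of a finite vector of increments to a sequence. -/
def extend {n : ℕ} (w : Fin n → ℝ) (j : ℕ) : ℝ := if hj : j < n then w ⟨j, hj⟩ else 0

/-- The unnormalized posterior of the parameter and the noise increments at level `l`. -/
def unnormalizedPosterior (l : ℕ) : Measure (Θ × (Fin (M.T * 2 ^ l) → ℝ)) :=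
  ((M.dom.withDensity fun θ => ENNReal.ofReal (M.prior θ)).prod
    (Measure.pi fun _ => gaussianReal 0 (stepSize l))).withDensity
    fun p => ENNReal.ofReal (∏ t ∈ Finset.range M.T, M.lik l p.1 (extend p.2) t)

/-- The posterior `π^l`. -/
def posterior (l : ℕ) : Measure (Θ × (Fin (M.T * 2 ^ l) → ℝ)) :=
  (M.unnormalizedPosterior l Set.univ)⁻¹ • M.unnormalizedPosterior l

/-- The posterior expectation `E_{π^l}[φ(θ, V_{1:T})]`. -/
def posteriorExp (l : ℕ) (φ : Θ × (Fin M.T → ℝ) → ℝ) : ℝ :=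
  ∫ p, φ (p.1, M.skeleton l p.1 (extend p.2)) ∂M.posterior l

/-! ### The delta particle filter

All random variables that are generated by one run of the delta particle filter at level `l`:
* the innovations `u t i k`, the `k`-th fine noise increment simulated for particle `i` in the
  `t`-th unit time interval, `t = 0, …, T - 1`;
* the ancestors `a t i`, the index of the particle of which particle `i` is a copy after the
  resampling that follows the `t`-th interval, `t = 0, …, T - 2`;
* the index selected in the grand selection. -/

/-- Innovations. -/
abbrev Innovations (l : ℕ) : Type := Fin M.T → Fin M.N → Fin (2 ^ l) → ℝ

/-- Ancestors. -/
abbrev Ancestors : Type := Fin (M.T - 1) → Fin M.N → Fin M.N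

/-- The state space of the coupled MCMC chain: the parameter and the random variables of one run of
the delta particle filter. -/
abbrev State (Θ : Type*) {Y : Type*} [MeasurableSpace Θ] (M : Model Θ Y) (l : ℕ) : Type _ :=
  Θ × M.Innovations l × M.Ancestors × Fin M.N

variable {M} in
/-- Innovations with indices in `ℕ` (zero out of range). -/
def innov {l : ℕ} (u : M.Innovations l) (t : ℕ) (i : Fin M.N) (k : ℕ) : ℝ :=
  if hh : t < M.T ∧ k < 2 ^ l then u ⟨t, hh.1⟩ i ⟨k, hh.2⟩ else 0

variable {M} in
/-- Ancestors with time index in `ℕ`. -/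
def parent (a : M.Ancestors) (t : ℕ) (i : Fin M.N) : Fin M.N :=
  if ht : t < M.T - 1 then a ⟨t, ht⟩ i else i

variable {M} in
/-- `particle u a t i` is the sequence of fine noise increments up to time `t + 1` of the `i`-th
particle after the `t`-th mutation step (before the resampling step that follows it). -/
def particle {l : ℕ} (u : M.Innovations l) (a : M.Ancestors) : ℕ → Fin M.N → ℕ → ℝ
  | 0, i => innov u 0 i
  | t + 1, i => fun j =>
      if j < (t + 1) * 2 ^ l then particle u a t (parent a t i) j
      else innov u (t + 1) i (j - (t + 1) * 2 ^ l)

/-- The maximum of the likelihood factors of levels `l` and `l - 1` along synchronously coupled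
increments. -/
def maxLik (l : ℕ) (θ : Θ) (w : ℕ → ℝ) (t : ℕ) : ℝ :=
  max (M.lik l θ w t) (M.lik (l - 1) θ (coarsen w) t)

/-- The weight of particle `i` at time `t`. -/
def weight (l : ℕ) (θ : Θ) (u : M.Innovations l) (a : M.Ancestors) (t : ℕ) (i : Fin M.N) : ℝ :=
  M.maxLik l θ (particle u a t i) t

/-- The normalized weight of particle `i` at time `t`. -/
def normWeight (l : ℕ) (θ : Θ) (u : M.Innovations l) (a : M.Ancestors) (t : ℕ) (i : Fin M.N) : ℝ :=
  M.weight l θ u a t i / ∑ j, M.weight l θ u a t j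

/-- The normalizing constant estimate returned by the delta particle filter. -/
def normConst (l : ℕ) (θ : Θ) (u : M.Innovations l) (a : M.Ancestors) : ℝ :=
  ∏ t ∈ Finset.range M.T, ((M.N : ℝ)⁻¹ * ∑ i, M.weight l θ u a t i)

/-- The conditional probability, given the innovations, of the ancestors `a` and the finally selected
index `k`: all `N` ancestors are drawn independently according to the normalized weights at each
resampling time, and the final index is drawn according to the last normalized weights. -/
def selectionProb (l : ℕ) (θ : Θ) (u : M.Innovations l) (a : M.Ancestors) (k : Fin M.N) : ℝ :=
  (∏ t : Fin (M.T - 1), ∏ i, M.normWeight l θ u a t (a t i)) *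
    M.normWeight l θ u a (M.T - 1) k

/-! ### The coupled MCMC kernel -/

/-- The reference measure on the state space: the dominating measure on `Θ`, independent
`N(0, Δ_l)` innovations, and counting measure on ancestors and selected index. -/
def refMeasure (l : ℕ) : Measure (M.State Θ l) :=
  M.dom.prod ((Measure.pi fun _ => Measure.pi fun _ => Measure.pi fun _ =>
    gaussianReal 0 (stepSize l)).prod (Measure.count.prod Measure.count))

instance (l : ℕ) : SFinite (M.refMeasure l) := by
  unfold refMeasure; infer_instance

/-- Density, with respect to the reference measure, of the proposed state `x'` made from `x`:
`θ'` is drawn from the proposal and the delta particle filter is run with parameter `θ'`. -/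
def proposalDensity (l : ℕ) (x x' : M.State Θ l) : ℝ :=
  M.q l x.1 x'.1 * M.selectionProb l x'.1 x'.2.1 x'.2.2.1 x'.2.2.2

/-- The acceptance probability; with the usual convention it is `1` if the denominator vanishes. -/
def acceptProb (l : ℕ) (x x' : M.State Θ l) : ℝ :=
  let num := M.normConst l x'.1 x'.2.1 x'.2.2.1 * M.prior x'.1 * M.q l x'.1 x.1
  let den := M.normConst l x.1 x.2.1 x.2.2.1 * M.prior x.1 * M.q l x.1 x'.1
  if den = 0 then 1 else min 1 (num / den)

/-- Density of the accepted moves. -/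
def moveDensity (l : ℕ) (x x' : M.State Θ l) : ℝ≥0∞ :=
  ENNReal.ofReal (M.proposalDensity l x x' * M.acceptProb l x x')

/-- The Markov kernel `K_l` of one iteration of the coupled MCMC algorithm: the proposed state is
accepted with the acceptance probability, and otherwise the chain stays where it is. -/
def mcmcKernel (l : ℕ) : Kernel (M.State Θ l) (M.State Θ l) :=
  Kernel.withDensity (Kernel.const _ (M.refMeasure l)) (M.moveDensity l) +
    Kernel.withDensity Kernel.id
      (fun x _ => 1 - ∫⁻ x', M.moveDensity l x x' ∂M.refMeasure l)

/-- `X` is a Markov chain with initial law `η` and transition kernel `κ`. -/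
structure IsMarkovChain {S Ω : Type*} [MeasurableSpace S] [MeasurableSpace Ω] (κ : Kernel S S)
    (η : Measure S) (P : Measure Ω) (X : ℕ → Ω → S) : Prop where
  init : HasLaw (X 0) η P
  step : ∀ n, HasCondDistrib (X (n + 1)) (fun ω (i : Fin (n + 1)) => X i ω)
    (κ.comap (fun x : Fin (n + 1) → S => x (Fin.last n)) (measurable_pi_apply _)) P

/-! ### The estimator -/

variable {M} in
/-- The fine noise increments of the path carried by a state. -/
def path {l : ℕ} (x : M.State Θ l) : ℕ → ℝ := particle x.2.1 x.2.2.1 (M.T - 1) x.2.2.2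

/-- The importance weight `H_{1,l}`, as a function of the state. -/
def H₁ (l : ℕ) (x : M.State Θ l) : ℝ :=
  ∏ t ∈ Finset.range M.T, M.lik l x.1 (path x) t / M.maxLik l x.1 (path x) t

/-- The importance weight `H_{2,l}`, as a function of the state. -/
def H₂ (l : ℕ) (x : M.State Θ l) : ℝ :=
  ∏ t ∈ Finset.range M.T, M.lik (l - 1) x.1 (coarsen (path x)) t / M.maxLik l x.1 (path x) t

/-- The estimator of `E_{π^l}[φ(θ, V_{1:T})] - E_{π^{l-1}}[φ(θ, V_{1:T})]` computed from the states
`x 0, …, x m` of the chain at level `l`. -/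
def estimator (l : ℕ) (φ : Θ × (Fin M.T → ℝ) → ℝ) (m : ℕ) (x : ℕ → M.State Θ l) : ℝ :=
  (((m : ℝ) + 1)⁻¹ * ∑ k ∈ Finset.range (m + 1),
      φ ((x k).1, M.skeleton l (x k).1 (path (x k))) * M.H₁ l (x k)) /
    (((m : ℝ) + 1)⁻¹ * ∑ k ∈ Finset.range (m + 1), M.H₁ l (x k)) -
  (((m : ℝ) + 1)⁻¹ * ∑ k ∈ Finset.range (m + 1),
      φ ((x k).1, M.skeleton (l - 1) (x k).1 (coarsen (path (x k)))) * M.H₂ l (x k)) /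
    (((m : ℝ) + 1)⁻¹ * ∑ k ∈ Finset.range (m + 1), M.H₂ l (x k))

/-! ### Assumptions -/

/-- Regularity of the likelihood. -/
structure LikelihoodRegular : Prop where
  f_lip : ∃ C : ℝ≥0, LipschitzWith C M.f
  f_bdd : ∃ C : ℝ, ∀ v, |M.f v| ≤ C
  h_lip : ∃ C : ℝ≥0, LipschitzWith C M.h
  h_bdd : ∃ C : ℝ, ∀ v, |M.h v| ≤ C
  g_lip : ∀ y y' : Y, ∃ C : ℝ, ∀ x₁ x₂ x₁' x₂' : ℝ,
    |M.g y y' x₁ x₂ - M.g y y' x₁' x₂'| ≤ C * (|x₁ - x₁'| + |x₂ - x₂'|)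
  g_bdd : ∀ y y' : Y, ∃ c C : ℝ, 0 < c ∧ c < C ∧
    ∀ x₁ x₂ : ℝ, c ≤ M.g y y' x₁ x₂ ∧ M.g y y' x₁ x₂ ≤ C

/-- Strong error of order `Δ_l^β`, uniformly in the parameter, in `L^r` for every `r ∈ [1,2]`, of
the Euler scheme that is driven by the increments of the Brownian motion `W` which drives the
Volterra processes `V θ`. -/
def StrongError {Ω : Type*} [MeasurableSpace Ω] (P : Measure Ω) (W : ℝ≥0 → Ω → ℝ)
    (V : Θ → ℝ≥0 → Ω → ℝ) (β : ℝ) : Prop :=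
  ∀ r : ℝ, 1 ≤ r → r ≤ 2 → ∃ C : ℝ, ∀ l k : ℕ, 1 ≤ k → k ≤ M.T * 2 ^ l → ∀ θ : Θ,
    eLpNorm (fun ω =>
        M.euler l θ (fun j => W ((j + 1) * stepSize l) ω - W (j * stepSize l) ω) k -
          V θ (k * stepSize l) ω) (ENNReal.ofReal r) P
      ≤ ENNReal.ofReal (C * (stepSize l : ℝ) ^ β)

/-- Minorization of the coupled MCMC kernels, uniformly in the level, and reversibility with respect
to the invariant probability measures `η l`. -/
structure KernelRegular (η : ∀ l, Measure (M.State Θ l)) : Prop where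
  minorization : ∃ ξ : ℝ, 0 < ξ ∧ ξ < 1 ∧ ∀ l : ℕ, 1 ≤ l →
    ∃ ν : Measure (M.State Θ l), IsProbabilityMeasure ν ∧
      ∀ x, ENNReal.ofReal ξ • ν ≤ M.mcmcKernel l x
  isProbability : ∀ l : ℕ, 1 ≤ l → IsProbabilityMeasure (η l)
  reversible : ∀ l : ℕ, 1 ≤ l → (M.mcmcKernel l).IsReversible (η l)

end Model

end SVE

end

/-! The estimator is a difference A/B - C/D of self-normalised averages along a stationary chain.
Here A averages φ·H₁ and B averages H₁ on the fine path, while C averages φ·H₂ and D averages H₂ on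
the coarse path. Three facts give the rate Δ_l^{2β}/M_l.

Stationary law. The target density is prior × `normConst` × `selectionProb`. It satisfies detailed
balance (`targetDensity_mul_moveDensity`), and a minorized kernel has only one invariant probability
measure (`invariant_unique`), so the given η_l is this target. Unbiasedness of the particle filter
(`lintegral_normConst_mul_selectionProb`) then shows that under η_l the pair (θ, path) has density
proportional to the product of the maxima of the likelihood factors, with respect to prior times
noise. Multiplying by H₁ or H₂ replaces the maxima by the factors of one level, so the ratios of
stationary means are the two posterior expectations (`posteriorExp_eq_ratio`).

Closeness of levels. At common grid points, both Euler schemes are within order Δ^β of the Volterra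
process in mean square. At odd fine points the time regularity of the Euler scheme, of squared order
Δ^{2H+1}, is used as well. The likelihood factors inherit the rate: the first functional by
Cauchy–Schwarz, the stochastic sum by the discrete Itô isometry. All of this is collected in
`levelGap`. Since the density of the stationary law is bounded above, the bound passes from prior
times noise to η_l (`integral_sq_path_le`).

Averaging. Under the minorization the kernel contracts the squared L² norm of centred functions by 1
- ξ, so an ergodic average of a centred F has variance at most a constant times ∫F²/M
(`integral_sq_average_le`). With p, s the limits of the two ratios, A/B - C/D - (p - s) is an exact
sum of three terms (`sq_ratio_error_le`). One contains a centred average of a function of order Δ^β,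
one a bounded factor times such an average, and one an average with variance of order 1/M times a
deterministic factor of order Δ^β. Second moments therefore suffice, and the product Δ^{2β}/M
appears directly (`ratio_difference`). -/

namespace SVE

/-! ### Bounded measurable functions -/

/-- Bounded measurable real functions. -/
structure BddMeasurable {S : Type*} [MeasurableSpace S] (f : S → ℝ) : Prop where
  measurable : Measurable f
  bdd : ∃ B : ℝ, ∀ x, |f x| ≤ B

namespace BddMeasurable

variable {S : Type*} [MeasurableSpace S] {f g : S → ℝ}

lemma integrable (hf : BddMeasurable f) (μ : Measure S) [IsFiniteMeasure μ] : Integrable f μ := by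
  obtain ⟨B, hB⟩ := hf.bdd
  exact Integrable.of_bound hf.measurable.aestronglyMeasurable B (ae_of_all _ hB)

lemma const (c : ℝ) : BddMeasurable fun _ : S => c := ⟨measurable_const, |c|, fun _ => le_rfl⟩

lemma mul (hf : BddMeasurable f) (hg : BddMeasurable g) : BddMeasurable fun x => f x * g x := by
  obtain ⟨B, hB⟩ := hf.bdd
  obtain ⟨B', hB'⟩ := hg.bdd
  refine ⟨hf.measurable.mul hg.measurable, B * B', fun x => ?_⟩
  rw [abs_mul]
  exact mul_le_mul (hB x) (hB' x) (abs_nonneg _) ((abs_nonneg _).trans (hB x))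

lemma add (hf : BddMeasurable f) (hg : BddMeasurable g) : BddMeasurable fun x => f x + g x := by
  obtain ⟨B, hB⟩ := hf.bdd
  obtain ⟨B', hB'⟩ := hg.bdd
  exact ⟨hf.measurable.add hg.measurable, B + B', fun x =>
    (abs_add_le _ _).trans (add_le_add (hB x) (hB' x))⟩

lemma sub (hf : BddMeasurable f) (hg : BddMeasurable g) : BddMeasurable fun x => f x - g x := by
  obtain ⟨B, hB⟩ := hf.bdd
  obtain ⟨B', hB'⟩ := hg.bdd
  exact ⟨hf.measurable.sub hg.measurable, B + B', fun x =>
    (abs_sub _ _).trans (add_le_add (hB x) (hB' x))⟩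

lemma sq (hf : BddMeasurable f) : BddMeasurable fun x => f x ^ 2 := by
  simpa [pow_two] using hf.mul hf

lemma const_mul (c : ℝ) (hf : BddMeasurable f) : BddMeasurable fun x => c * f x :=
  (const c).mul hf

lemma comp {R : Type*} [MeasurableSpace R] (hf : BddMeasurable f) {g : R → S}
    (hg : Measurable g) : BddMeasurable fun x => f (g x) :=
  ⟨hf.measurable.comp hg, hf.bdd.imp fun _ h x => h (g x)⟩

end BddMeasurable

/-- Cauchy–Schwarz against the constant 1, obtained from nonnegativity of the second moment about
the mean. The total mass is kept because the lemma is applied to residual measures of mass 1 - ξ. -/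
lemma sq_integral_le {S : Type*} [MeasurableSpace S] (μ : Measure S) [IsFiniteMeasure μ]
    {f : S → ℝ} (hf : BddMeasurable f) :
    (∫ x, f x ∂μ) ^ 2 ≤ μ.real Set.univ * ∫ x, f x ^ 2 ∂μ := by
  rcases eq_or_lt_of_le (measureReal_nonneg : 0 ≤ μ.real Set.univ) with h | h
  · have : μ = 0 := by
      rw [← Measure.measure_univ_eq_zero]
      exact (measureReal_eq_zero_iff).1 h.symm
    simp [this]
  · set m := μ.real Set.univ
    have h0 : 0 ≤ ∫ x, (f x - (∫ x, f x ∂μ) / m) ^ 2 ∂μ := integral_nonneg fun _ => sq_nonneg _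
    have e : ∀ t : ℝ, ∫ x, (f x - t) ^ 2 ∂μ = ∫ x, f x ^ 2 ∂μ - 2 * t * ∫ x, f x ∂μ + t ^ 2 * m := by
      intro t
      have : ∀ x, (f x - t) ^ 2 = f x ^ 2 - 2 * t * f x + t ^ 2 := fun x => by ring
      simp_rw [this]
      rw [integral_add ((hf.sq.sub (hf.const_mul _)).integrable _) (integrable_const _),
        integral_sub (hf.sq.integrable _) ((hf.const_mul _).integrable _), integral_const_mul]
      simp [m, mul_comm]
    rw [e] at h0
    have : m * (∫ x, f x ^ 2 ∂μ - 2 * ((∫ x, f x ∂μ) / m) * ∫ x, f x ∂μ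
        + ((∫ x, f x ∂μ) / m) ^ 2 * m) = m * ∫ x, f x ^ 2 ∂μ - (∫ x, f x ∂μ) ^ 2 := by
      field_simp
      ring
    nlinarith [mul_nonneg h.le h0]

/-! ### Markov kernels with a minorization -/

section Doeblin

variable {S : Type*} [MeasurableSpace S]

/-- The action of a kernel on functions. -/
noncomputable def kernelOp (κ : Kernel S S) (f : S → ℝ) (x : S) : ℝ := ∫ y, f y ∂κ x

variable {κ : Kernel S S} [IsMarkovKernel κ] {η ν : Measure S}

lemma BddMeasurable.kernelOp {f : S → ℝ} (hf : BddMeasurable f) :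
    BddMeasurable (SVE.kernelOp κ f) := by
  obtain ⟨B, hB⟩ := hf.bdd
  refine ⟨hf.measurable.stronglyMeasurable.integral_kernel.measurable, B, fun x => ?_⟩
  have := norm_integral_le_of_norm_le_const (μ := κ x) (f := f) (C := B)
    (ae_of_all _ hB)
  simpa [SVE.kernelOp] using this

lemma BddMeasurable.kernelOp_iterate {f : S → ℝ} (hf : BddMeasurable f) (n : ℕ) :
    BddMeasurable ((SVE.kernelOp κ)^[n] f) := by
  induction n with
  | zero => exact hf
  | succ n ih => rw [Function.iterate_succ_apply']; exact ih.kernelOp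

lemma integral_kernelOp [IsProbabilityMeasure η] (hη : κ.Invariant η) {f : S → ℝ}
    (hf : BddMeasurable f) : ∫ x, kernelOp κ f x ∂η = ∫ x, f x ∂η := by
  have h : Integrable (fun p : S × S => f p.2) (η ⊗ₘ κ) :=
    (hf.comp measurable_snd).integrable _
  have := Measure.integral_compProd h
  rw [show (∫ x, kernelOp κ f x ∂η) = ∫ a, ∫ b, f b ∂κ a ∂η from rfl, ← this,
    ← integral_map (φ := Prod.snd) measurable_snd.aemeasurable
      hf.measurable.aestronglyMeasurable]
  change ∫ y, f y ∂(η ⊗ₘ κ).snd = _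
  rw [Measure.snd_compProd, hη.def]

lemma integral_kernelOp_iterate [IsProbabilityMeasure η] (hη : κ.Invariant η) {f : S → ℝ}
    (hf : BddMeasurable f) (n : ℕ) : ∫ x, (kernelOp κ)^[n] f x ∂η = ∫ x, f x ∂η := by
  induction n with
  | zero => rfl
  | succ n ih =>
    rw [Function.iterate_succ_apply', integral_kernelOp hη (hf.kernelOp_iterate n), ih]

/-- Under a minorization the kernel contracts the `L²` norm of centred functions. -/
lemma integral_sq_kernelOp_le [IsProbabilityMeasure η] [IsProbabilityMeasure ν] {ξ : ℝ}
    (hξ₀ : 0 < ξ) (hξ₁ : ξ < 1) (hν : ∀ x, ENNReal.ofReal ξ • ν ≤ κ x) (hη : κ.Invariant η)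
    {f : S → ℝ} (hf : BddMeasurable f) (h0 : ∫ x, f x ∂η = 0) :
    ∫ x, kernelOp κ f x ^ 2 ∂η ≤ (1 - ξ) * ∫ x, f x ^ 2 ∂η := by
  -- The part of `kernelOp κ f x` due to the minorizing measure. It does not depend on x, which is
  -- what makes it removable below.
  set c : ℝ := ξ * ∫ x, f x ∂ν
  have hfin : IsFiniteMeasure (ENNReal.ofReal ξ • ν) := ν.smul_finite ENNReal.ofReal_ne_top
  have key : ∀ x, (kernelOp κ f x - c) ^ 2 ≤ (1 - ξ) * kernelOp κ (fun y => f y ^ 2) x := by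
    intro x
    set ρ := κ x - ENNReal.ofReal ξ • ν
    -- Doeblin splitting: what remains of κ x after removing ξν has mass 1 - ξ, and Cauchy–Schwarz
    -- on it produces the contraction factor.
    have hρ : ρ + ENNReal.ofReal ξ • ν = κ x := Measure.sub_add_cancel_of_le (hν x)
    have hle : ρ ≤ κ x := Measure.sub_le
    have hfρ : IsFiniteMeasure ρ := isFiniteMeasure_of_le _ hle
    have hi : ∀ {g : S → ℝ}, BddMeasurable g →
        ∫ y, g y ∂κ x = ∫ y, g y ∂ρ + ξ * ∫ y, g y ∂ν := by
      intro g hg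
      rw [← hρ, integral_add_measure (hg.integrable _) (hg.integrable _), integral_smul_measure,
        ENNReal.toReal_ofReal hξ₀.le, smul_eq_mul]
    have hm : ρ.real Set.univ = 1 - ξ := by
      have := hi (BddMeasurable.const 1)
      simp at this
      linarith
    have h1 := sq_integral_le ρ hf
    rw [hm] at h1
    have h2 : kernelOp κ f x - c = ∫ y, f y ∂ρ := by
      simp only [kernelOp, hi hf, c]; ring
    rw [h2]
    refine h1.trans (mul_le_mul_of_nonneg_left ?_ (by linarith))
    exact integral_mono_measure hle (ae_of_all _ fun _ => sq_nonneg _) (hf.sq.integrable _)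
  have hK := hf.kernelOp (κ := κ)
  -- Since f is centred and η invariant, the cross term vanishes; c² appears with a plus sign and
  -- can be dropped.
  have e1 : ∫ x, (kernelOp κ f x - c) ^ 2 ∂η = ∫ x, kernelOp κ f x ^ 2 ∂η + c ^ 2 := by
    have : ∀ x, (kernelOp κ f x - c) ^ 2 = kernelOp κ f x ^ 2 - 2 * c * kernelOp κ f x + c ^ 2 :=
      fun x => by ring
    simp_rw [this]
    rw [integral_add ((hK.sq.sub (hK.const_mul _)).integrable _) (integrable_const _),
      integral_sub (hK.sq.integrable _) ((hK.const_mul _).integrable _), integral_const_mul,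
      integral_kernelOp hη hf, h0]
    simp
  have e2 : ∫ x, (kernelOp κ f x - c) ^ 2 ∂η ≤ (1 - ξ) * ∫ x, f x ^ 2 ∂η := by
    rw [← integral_kernelOp hη hf.sq, ← integral_const_mul]
    exact integral_mono ((hK.sub (.const c)).sq.integrable _)
      ((hf.sq.kernelOp.const_mul _).integrable _) key
  nlinarith [sq_nonneg c]

lemma integral_sq_kernelOp_iterate_le [IsProbabilityMeasure η] [IsProbabilityMeasure ν] {ξ : ℝ}
    (hξ₀ : 0 < ξ) (hξ₁ : ξ < 1) (hν : ∀ x, ENNReal.ofReal ξ • ν ≤ κ x) (hη : κ.Invariant η)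
    {f : S → ℝ} (hf : BddMeasurable f) (h0 : ∫ x, f x ∂η = 0) (n : ℕ) :
    ∫ x, (kernelOp κ)^[n] f x ^ 2 ∂η ≤ (1 - ξ) ^ n * ∫ x, f x ^ 2 ∂η := by
  induction n with
  | zero => simp
  | succ n ih =>
    rw [Function.iterate_succ_apply', pow_succ']
    have := integral_sq_kernelOp_le hξ₀ hξ₁ hν hη (hf.kernelOp_iterate n)
      ((integral_kernelOp_iterate hη hf n).trans h0)
    nlinarith

/-- A kernel with a minorization has at most one invariant probability measure. -/
lemma invariant_unique [IsProbabilityMeasure η] [IsProbabilityMeasure ν] {ξ : ℝ}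
    (hξ₀ : 0 < ξ) (hξ₁ : ξ < 1) (hν : ∀ x, ENNReal.ofReal ξ • ν ≤ κ x) (hη : κ.Invariant η)
    {η' : Measure S} [IsProbabilityMeasure η'] (hη' : κ.Invariant η') : η = η' := by
  -- The two invariant measures may be mutually singular. Their mixture μ is invariant too, and
  -- squares integrated against η are at most twice those against μ, so L² contraction under μ
  -- controls means under η.
  set c : ℝ≥0∞ := 2⁻¹
  set μ : Measure S := c • η + c • η'
  have hμp : IsProbabilityMeasure μ := ⟨by simp [μ, c, ENNReal.inv_two_add_inv_two]⟩
  have hμ : κ.Invariant μ := by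
    unfold Kernel.Invariant
    rw [show μ.bind κ = c • η.bind κ + c • η'.bind κ by
      simp only [μ, Measure.comp_add, Measure.comp_smul], hη.def, hη'.def]
  have hint : ∀ {g : S → ℝ}, BddMeasurable g →
      ∫ y, g y ∂μ = 2⁻¹ * ∫ y, g y ∂η + 2⁻¹ * ∫ y, g y ∂η' := by
    intro g hg
    have hc : ∀ m : Measure S, IsProbabilityMeasure m → IsFiniteMeasure (c • m) :=
      fun m _ => m.smul_finite (by simp [c])
    have := hc η inferInstance
    have := hc η' inferInstance
    rw [integral_add_measure (hg.integrable _) (hg.integrable _), integral_smul_measure,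
      integral_smul_measure]
    simp [c]
  have key : ∀ g : S → ℝ, BddMeasurable g → ∫ y, g y ∂μ = 0 → ∫ y, g y ∂η = 0 := by
    intro g hg h0
    have hb : ∀ n : ℕ, (∫ y, g y ∂η) ^ 2 ≤ (1 - ξ) ^ n * (2 * ∫ y, g y ^ 2 ∂μ) := by
      intro n
      have h1 := integral_sq_kernelOp_iterate_le hξ₀ hξ₁ hν hμ hg h0 n
      rw [hint (hg.kernelOp_iterate n).sq] at h1
      have h2 := sq_integral_le η (hg.kernelOp_iterate (κ := κ) n)
      rw [integral_kernelOp_iterate hη hg, probReal_univ, one_mul] at h2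
      have h3 : 0 ≤ ∫ y, (kernelOp κ)^[n] g y ^ 2 ∂η' := integral_nonneg fun _ => sq_nonneg _
      linarith
    have hlim : Tendsto (fun n : ℕ => (1 - ξ) ^ n * (2 * ∫ y, g y ^ 2 ∂μ)) atTop (𝓝 (0 * _)) :=
      (tendsto_pow_atTop_nhds_zero_of_lt_one (by linarith) (by linarith)).mul_const _
    rw [zero_mul] at hlim
    have := ge_of_tendsto' hlim hb
    exact pow_eq_zero_iff (two_ne_zero) |>.1 (le_antisymm this (sq_nonneg _))
  ext A hA
  have hf : BddMeasurable (A.indicator (fun _ => (1 : ℝ))) := by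
    refine ⟨measurable_const.indicator hA, 1, fun x => ?_⟩
    by_cases hx : x ∈ A <;> simp [hx]
  have hg := hf.sub (BddMeasurable.const (∫ y, A.indicator (fun _ => (1 : ℝ)) y ∂μ))
  -- Applied to an indicator centred under μ: η and μ agree on every A, hence so do η and η'.
  have h1 := key _ hg (by
    rw [integral_sub (hf.integrable _) (integrable_const _)]; simp)
  rw [integral_sub (hf.integrable _) (integrable_const _), hint hf] at h1
  simp only [integral_indicator_const _ hA, smul_eq_mul, mul_one, integral_const, probReal_univ,
    one_mul] at h1
  rw [← measureReal_eq_measureReal_iff]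
  linarith

/-! ### Stationary chains -/

section Chain

variable {Ω : Type*} [MeasurableSpace Ω] {P : Measure Ω} [IsProbabilityMeasure P] {X : ℕ → Ω → S}

lemma Model.IsMarkovChain.hasLaw [IsProbabilityMeasure η] (hX : Model.IsMarkovChain κ η P X)
    (hη : κ.Invariant η) (n : ℕ) : HasLaw (X n) η P := by
  induction n with
  | zero => exact hX.init
  | succ n ih =>
    have h : HasCondDistrib (X (n + 1)) (X n) κ P := (hX.step n).comp_right
    refine ⟨h.aemeasurable_snd, ?_⟩
    have h1 := ih.prodMk_of_hasCondDistrib h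
    have h2 : (P.map (fun ω => (X n ω, X (n + 1) ω))).snd = η := by
      rw [h1.map_eq, Measure.snd_compProd, hη.def]
    rwa [Measure.snd_map_prodMk₀ ih.aemeasurable] at h2

/-- The transition law is given conditionally on the whole past, so F(X_k) with k ≤ n is a known
factor and only g is averaged by the kernel. -/
lemma Model.IsMarkovChain.integral_mul_succ (hX : Model.IsMarkovChain κ η P X)
    {F g : S → ℝ} (hF : BddMeasurable F) (hg : BddMeasurable g) {k n : ℕ} (hk : k ≤ n) :
    ∫ ω, F (X k ω) * g (X (n + 1) ω) ∂P = ∫ ω, F (X k ω) * kernelOp κ g (X n ω) ∂P := by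
  have h := hX.step n
  set Y : Ω → Fin (n + 1) → S := fun ω i => X i ω
  have hY : AEMeasurable Y P := h.aemeasurable_fst
  have hΦ : BddMeasurable fun p : (Fin (n + 1) → S) × S =>
      F (p.1 ⟨k, Nat.lt_succ_of_le hk⟩) * g p.2 :=
    (hF.comp ((measurable_pi_apply _).comp measurable_fst)).mul (hg.comp measurable_snd)
  have hp : IsProbabilityMeasure (P.map Y) := Measure.isProbabilityMeasure_map hY
  have hΨ : BddMeasurable fun p : Fin (n + 1) → S =>
      F (p ⟨k, Nat.lt_succ_of_le hk⟩) * kernelOp κ g (p (Fin.last n)) :=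
    (hF.comp (measurable_pi_apply _)).mul (hg.kernelOp.comp (measurable_pi_apply _))
  have e1 := HasLaw.integral_comp h hΦ.measurable.aestronglyMeasurable
  rw [Measure.integral_compProd (hΦ.integrable _)] at e1
  calc _ = _ := e1
    _ = ∫ p, F (p ⟨k, Nat.lt_succ_of_le hk⟩) * kernelOp κ g (p (Fin.last n)) ∂P.map Y := by
      simp only [Kernel.comap_apply, integral_const_mul, kernelOp]
    _ = _ := integral_map hY hΨ.measurable.aestronglyMeasurable

lemma Model.IsMarkovChain.integral_mul_add [IsProbabilityMeasure η]
    (hX : Model.IsMarkovChain κ η P X) (hη : κ.Invariant η)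
    {F g : S → ℝ} (hF : BddMeasurable F) (hg : BddMeasurable g) (k n : ℕ) :
    ∫ ω, F (X k ω) * g (X (k + n) ω) ∂P = ∫ x, F x * (kernelOp κ)^[n] g x ∂η := by
  induction n generalizing g with
  | zero =>
    exact (hX.hasLaw hη k).integral_comp (f := fun x => F x * g x)
      (hF.mul hg).measurable.aestronglyMeasurable
  | succ n ih =>
    rw [← add_assoc, hX.integral_mul_succ hF hg (Nat.le_add_right k n), ih hg.kernelOp]
    rfl

lemma BddMeasurable.integrable_comp {f : S → ℝ} (hf : BddMeasurable f) {Z : Ω → S}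
    (hZ : AEMeasurable Z P) : Integrable (fun ω => f (Z ω)) P := by
  obtain ⟨B, hB⟩ := hf.bdd
  exact Integrable.of_bound (hf.measurable.comp_aemeasurable hZ).aestronglyMeasurable B
    (ae_of_all _ fun ω => hB _)

/-- Young's inequality |fg| ≤ (r/2) f² + g²/(2r), with the weight that balances the two assumed
second-moment bounds. -/
lemma abs_integral_mul_le {μ : Measure S} [IsFiniteMeasure μ] {f g : S → ℝ}
    (hf : BddMeasurable f) (hg : BddMeasurable g) {r v : ℝ} (hr : 0 < r)
    (h1 : ∫ x, f x ^ 2 ∂μ ≤ v) (h2 : ∫ x, g x ^ 2 ∂μ ≤ r ^ 2 * v) :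
    |∫ x, f x * g x ∂μ| ≤ r * v := by
  have h3 : ∫ x, |f x * g x| ∂μ ≤ ∫ x, (r / 2 * f x ^ 2 + (2 * r)⁻¹ * g x ^ 2) ∂μ := by
    refine integral_mono ((hf.mul hg).integrable _).abs
      (((hf.sq.const_mul _).add (hg.sq.const_mul _)).integrable _) fun x => ?_
    have e : r / 2 * f x ^ 2 + (2 * r)⁻¹ * g x ^ 2 - |f x * g x|
        = (2 * r)⁻¹ * (r * |f x| - |g x|) ^ 2 := by
      rw [abs_mul, sub_sq, mul_pow, sq_abs, sq_abs]
      field_simp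
      ring
    have : 0 ≤ (2 * r)⁻¹ * (r * |f x| - |g x|) ^ 2 := by positivity
    linarith
  rw [integral_add ((hf.sq.const_mul _).integrable _) ((hg.sq.const_mul _).integrable _),
    integral_const_mul, integral_const_mul] at h3
  refine (abs_integral_le_integral_abs).trans (h3.trans ?_)
  have h4 : r / 2 * ∫ x, f x ^ 2 ∂μ ≤ r / 2 * v := by gcongr
  have h5 : (2 * r)⁻¹ * ∫ x, g x ^ 2 ∂μ ≤ (2 * r)⁻¹ * (r ^ 2 * v) := by gcongr
  have : (2 * r)⁻¹ * (r ^ 2 * v) = r / 2 * v := by field_simp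
  linarith

/-- The constant in the variance bound for ergodic averages. -/
noncomputable def mixingConst (ξ : ℝ) : ℝ := 1 + 2 * (1 - √(1 - ξ))⁻¹

lemma mixingConst_nonneg {ξ : ℝ} (hξ₀ : 0 < ξ) : 0 ≤ mixingConst ξ := by
  have : √(1 - ξ) < 1 := by rw [Real.sqrt_lt' one_pos]; linarith
  have : 0 < (1 - √(1 - ξ))⁻¹ := inv_pos.2 (by linarith)
  unfold mixingConst
  linarith

/-- The variance of ergodic averages of a stationary chain whose kernel has a minorization. -/
lemma Model.IsMarkovChain.integral_sq_sum_le [IsProbabilityMeasure η] [IsProbabilityMeasure ν]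
    {ξ : ℝ} (hξ₀ : 0 < ξ) (hξ₁ : ξ < 1) (hν : ∀ x, ENNReal.ofReal ξ • ν ≤ κ x)
    (hX : Model.IsMarkovChain κ η P X) (hη : κ.Invariant η)
    {F : S → ℝ} (hF : BddMeasurable F) (h0 : ∫ x, F x ∂η = 0) (n : ℕ) :
    ∫ ω, (∑ k ∈ Finset.range n, F (X k ω)) ^ 2 ∂P ≤ n * (mixingConst ξ * ∫ x, F x ^ 2 ∂η) := by
  set v := ∫ x, F x ^ 2 ∂η
  have hv : 0 ≤ v := integral_nonneg fun _ => sq_nonneg _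
  -- Decay of correlations per step: the squared L² norm contracts by 1 - ξ, the norm by its square
  -- root.
  set r := √(1 - ξ)
  have hr0 : 0 < r := Real.sqrt_pos.2 (by linarith)
  have hr1 : r < 1 := by rw [Real.sqrt_lt' one_pos]; linarith
  have hXm : ∀ k, AEMeasurable (X k) P := fun k => (hX.hasLaw hη k).aemeasurable
  have hcov : ∀ k n, |∫ ω, F (X k ω) * F (X (k + n) ω) ∂P| ≤ r ^ n * v := by
    intro k n
    rw [hX.integral_mul_add hη hF hF]
    refine abs_integral_mul_le hF (hF.kernelOp_iterate n) (pow_pos hr0 n) le_rfl ?_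
    rw [← pow_mul, mul_comm n 2, pow_mul, Real.sq_sqrt (by linarith)]
    exact integral_sq_kernelOp_iterate_le hξ₀ hξ₁ hν hη hF h0 n
  have hprod : ∀ k j, Integrable (fun ω => F (X k ω) * F (X j ω)) P := by
    intro k j
    obtain ⟨B, hB⟩ := hF.bdd
    exact (hF.integrable_comp (hXm j)).bdd_mul
      (hF.measurable.comp_aemeasurable (hXm k)).aestronglyMeasurable (ae_of_all _ fun ω => hB _)
  have hsq : ∀ n, Integrable (fun ω => (∑ k ∈ Finset.range n, F (X k ω)) ^ 2) P := by
    intro n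
    simp_rw [pow_two, Finset.sum_mul_sum]
    exact integrable_finsetSum _ fun k _ => integrable_finsetSum _ fun j _ => hprod k j
  induction n with
  | zero => simp
  | succ n ih =>
    have e : ∀ ω, (∑ k ∈ Finset.range (n + 1), F (X k ω)) ^ 2 =
        (∑ k ∈ Finset.range n, F (X k ω)) ^ 2
          + (2 * (∑ k ∈ Finset.range n, F (X k ω) * F (X n ω)) + F (X n ω) * F (X n ω)) := by
      intro ω
      rw [Finset.sum_range_succ, ← Finset.sum_mul]; ring
    have hs := integrable_finsetSum (Finset.range n) fun k _ => hprod k n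
    have hi : Integrable (fun ω => 2 * (∑ k ∈ Finset.range n, F (X k ω) * F (X n ω))
        + F (X n ω) * F (X n ω)) P := (hs.const_mul 2).add (hprod n n)
    simp_rw [e]
    rw [integral_add (hsq n) hi,
      integral_add (hs.const_mul 2) (hprod n n), integral_const_mul,
      integral_finsetSum _ fun k _ => hprod k n]
    have h1 : ∫ ω, F (X n ω) * F (X n ω) ∂P ≤ v := by
      simpa using (le_abs_self _).trans (hcov n 0)
    have h2 : ∑ k ∈ Finset.range n, ∫ ω, F (X k ω) * F (X n ω) ∂P ≤ (1 - r)⁻¹ * v := by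
      -- The exponent n - k is lowered by one so that reversing the sum gives a geometric series
      -- starting at r⁰.
      calc _ ≤ ∑ k ∈ Finset.range n, r ^ (n - 1 - k) * v := by
            refine Finset.sum_le_sum fun k hk => ?_
            have hk' := Finset.mem_range.1 hk
            have := (le_abs_self _).trans (hcov k (n - k))
            rw [show k + (n - k) = n by omega] at this
            refine this.trans (mul_le_mul_of_nonneg_right ?_ hv)
            exact pow_le_pow_of_le_one hr0.le hr1.le (by omega)
        _ = (∑ k ∈ Finset.range n, r ^ k) * v := by
            rw [Finset.sum_mul, Finset.sum_range_reflect (fun k => r ^ k * v)]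
        _ ≤ _ := by
            refine mul_le_mul_of_nonneg_right ?_ hv
            rw [← tsum_geometric_of_lt_one hr0.le hr1]
            exact (summable_geometric_of_lt_one hr0.le hr1).sum_le_tsum _
              fun k _ => pow_nonneg hr0.le k
    -- Each new state adds its own second moment, at most v, and twice its covariances with the
    -- past, at most a geometric series. This is the origin of `mixingConst`.
    have h3 : (mixingConst ξ) * v = v + 2 * ((1 - r)⁻¹ * v) := by
      simp only [mixingConst, r]; ring
    push_cast
    nlinarith

lemma Model.IsMarkovChain.integral_sq_average_le [IsProbabilityMeasure η]
    [IsProbabilityMeasure ν] {ξ : ℝ} (hξ₀ : 0 < ξ) (hξ₁ : ξ < 1)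
    (hν : ∀ x, ENNReal.ofReal ξ • ν ≤ κ x)
    (hX : Model.IsMarkovChain κ η P X) (hη : κ.Invariant η)
    {F : S → ℝ} (hF : BddMeasurable F) (h0 : ∫ x, F x ∂η = 0) (m : ℕ) :
    ∫ ω, (((m : ℝ) + 1)⁻¹ * ∑ k ∈ Finset.range (m + 1), F (X k ω)) ^ 2 ∂P
      ≤ ((m : ℝ) + 1)⁻¹ * (mixingConst ξ * ∫ x, F x ^ 2 ∂η) := by
  simp_rw [mul_pow]
  rw [integral_const_mul]
  have h := hX.integral_sq_sum_le hξ₀ hξ₁ hν hη hF h0 (m + 1)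
  have hm : (0 : ℝ) < (m : ℝ) + 1 := by positivity
  push_cast at h
  calc _ ≤ (((m : ℝ) + 1)⁻¹) ^ 2 * (((m : ℝ) + 1) * (mixingConst ξ * ∫ x, F x ^ 2 ∂η)) := by gcongr
    _ = _ := by field_simp

/-! ### Differences of self-normalised averages -/

/-- The constant in the mean square error of differences of self-normalised averages. -/
noncomputable def ratioConst (ξ c₀ k : ℝ) : ℝ :=
  3 * mixingConst ξ * (3 * (1 + (k / c₀) ^ 2 + 2 * (1 + (k / c₀) ^ 2) / c₀ ^ 2) / c₀ ^ 2
    + 2 * (k + k / c₀) ^ 2 / c₀ ^ 4)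

lemma abs_average_le {k : ℝ} (m : ℕ) {x : ℕ → ℝ} (hx : ∀ i, |x i| ≤ k) :
    |((m : ℝ) + 1)⁻¹ * ∑ i ∈ Finset.range (m + 1), x i| ≤ k := by
  have hm : (0 : ℝ) < (m : ℝ) + 1 := by positivity
  rw [abs_mul, abs_of_pos (inv_pos.2 hm), inv_mul_le_iff₀ hm]
  refine (Finset.abs_sum_le_sum_abs _ _).trans ((Finset.sum_le_sum fun i _ => hx i).trans ?_)
  simp

lemma le_average {k : ℝ} (m : ℕ) {x : ℕ → ℝ} (hx : ∀ i, k ≤ x i) :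
    k ≤ ((m : ℝ) + 1)⁻¹ * ∑ i ∈ Finset.range (m + 1), x i := by
  have hm : (0 : ℝ) < (m : ℝ) + 1 := by positivity
  rw [le_inv_mul_iff₀ hm]
  calc ((m : ℝ) + 1) * k = ∑ i ∈ Finset.range (m + 1), k := by simp
    _ ≤ _ := Finset.sum_le_sum fun i _ => hx i

/-- The fluctuation V = C - sD need not be small when the levels are close. In the exact identity
behind the bound it occurs only multiplied by G or by d - b, which are; in the first product |V| is
bounded by `fb`, in the second the deterministic (d - b)² is bounded by e. No fourth moment is
needed. -/
lemma sq_ratio_error_le {c₀ fb e b d p s A B C D : ℝ} (hc₀ : 0 < c₀)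
    (hB : c₀ ≤ B) (hD : c₀ ≤ D) (hF : |C - s * D| ≤ fb) (he : (d - b) ^ 2 ≤ e) :
    (A / B - C / D - (p - s)) ^ 2 ≤
      3 * ((A - p * B - (C - s * D)) ^ 2 / c₀ ^ 2 + fb ^ 2 * (D - B - (d - b)) ^ 2 / c₀ ^ 4
        + e * (C - s * D) ^ 2 / c₀ ^ 4) := by
  have hB0 : 0 < B := hc₀.trans_le hB
  have hD0 : 0 < D := hc₀.trans_le hD
  set U := A - p * B - (C - s * D)
  set V := C - s * D
  set G := D - B - (d - b)
  have e1 : A / B - C / D - (p - s) = U / B + V * G / (B * D) + V * (d - b) / (B * D) := by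
    simp only [U, V, G]; field_simp; ring
  have h3 : ∀ x y z : ℝ, (x + y + z) ^ 2 ≤ 3 * (x ^ 2 + y ^ 2 + z ^ 2) := fun x y z => by
    nlinarith [sq_nonneg (x - y), sq_nonneg (x - z), sq_nonneg (y - z)]
  have hBD : c₀ ^ 4 ≤ (B * D) ^ 2 := by
    have : c₀ * c₀ ≤ B * D := mul_le_mul hB hD hc₀.le hB0.le
    calc c₀ ^ 4 = (c₀ * c₀) ^ 2 := by ring
      _ ≤ _ := by gcongr
  have hV : V ^ 2 ≤ fb ^ 2 := sq_le_sq' (by linarith [(abs_le.1 hF).1]) (abs_le.1 hF).2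
  rw [e1]
  refine (h3 _ _ _).trans ?_
  rw [div_pow, div_pow, div_pow, mul_pow V, mul_pow V]
  have he0 : 0 ≤ e := (sq_nonneg _).trans he
  have t1 : U ^ 2 / B ^ 2 ≤ U ^ 2 / c₀ ^ 2 := by gcongr
  have t2 : V ^ 2 * G ^ 2 / (B * D) ^ 2 ≤ fb ^ 2 * G ^ 2 / c₀ ^ 4 := by gcongr
  have t3 : V ^ 2 * (d - b) ^ 2 / (B * D) ^ 2 ≤ e * V ^ 2 / c₀ ^ 4 := by
    rw [mul_comm (V ^ 2)]; gcongr
  linarith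

/-- Mean square error of the difference of two self-normalised averages along a stationary chain,
in terms of the mean square distance of the averaged functions. -/
lemma Model.IsMarkovChain.ratio_difference [IsProbabilityMeasure η] [IsProbabilityMeasure ν]
    {ξ : ℝ} (hξ₀ : 0 < ξ) (hξ₁ : ξ < 1) (hν : ∀ x, ENNReal.ofReal ξ • ν ≤ κ x)
    (hX : Model.IsMarkovChain κ η P X) (hη : κ.Invariant η)
    {A B C D : S → ℝ} (hA : BddMeasurable A) (hB : BddMeasurable B) (hC : BddMeasurable C)
    (hD : BddMeasurable D) {c₀ k e : ℝ} (hc₀ : 0 < c₀)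
    (hAk : ∀ x, |A x| ≤ k) (hCk : ∀ x, |C x| ≤ k) (hB₀ : ∀ x, c₀ ≤ B x)
    (hD₀ : ∀ x, c₀ ≤ D x) (hD₁ : ∀ x, D x ≤ 1)
    (hAC : ∫ x, (A x - C x) ^ 2 ∂η ≤ e) (hBD : ∫ x, (D x - B x) ^ 2 ∂η ≤ e) (m : ℕ)
    {err : Ω → ℝ} (herr : err = fun ω =>
      (((m : ℝ) + 1)⁻¹ * ∑ k ∈ Finset.range (m + 1), A (X k ω)) /
        (((m : ℝ) + 1)⁻¹ * ∑ k ∈ Finset.range (m + 1), B (X k ω)) -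
      (((m : ℝ) + 1)⁻¹ * ∑ k ∈ Finset.range (m + 1), C (X k ω)) /
        (((m : ℝ) + 1)⁻¹ * ∑ k ∈ Finset.range (m + 1), D (X k ω)) -
      ((∫ x, A x ∂η) / (∫ x, B x ∂η) - (∫ x, C x ∂η) / (∫ x, D x ∂η))) :
    Integrable (fun ω => err ω ^ 2) P ∧
      ∫ ω, err ω ^ 2 ∂P ≤ ((m : ℝ) + 1)⁻¹ * (ratioConst ξ c₀ k * e) := by
  set a := ∫ x, A x ∂η
  set b := ∫ x, B x ∂η
  set c := ∫ x, C x ∂η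
  set d := ∫ x, D x ∂η
  set p := a / b
  set s := c / d
  have hXm : ∀ k, AEMeasurable (X k) P := fun k => (hX.hasLaw hη k).aemeasurable
  obtain ⟨x₀⟩ : Nonempty S := (inferInstance : NeZero η).ne |> fun h => by
    by_contra hS
    rw [not_nonempty_iff] at hS
    exact h (Measure.eq_zero_of_isEmpty η)
  have hk : 0 ≤ k := (abs_nonneg _).trans (hAk x₀)
  have hlow : ∀ {f : S → ℝ}, BddMeasurable f → (∀ x, c₀ ≤ f x) → c₀ ≤ ∫ x, f x ∂η := by
    intro f hf h
    have := integral_mono (μ := η) (integrable_const c₀) (hf.integrable _) h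
    simpa using this
  have hupp : ∀ {f : S → ℝ}, (∀ x, |f x| ≤ k) → |∫ x, f x ∂η| ≤ k := by
    intro f h
    simpa using norm_integral_le_of_norm_le_const (μ := η) (f := f) (C := k) (ae_of_all _ h)
  have hb : c₀ ≤ b := hlow hB hB₀
  have hd : c₀ ≤ d := hlow hD hD₀
  have hb0 : 0 < b := hc₀.trans_le hb
  have hd0 : 0 < d := hc₀.trans_le hd
  have hp : |p| ≤ k / c₀ := by
    rw [abs_div, abs_of_pos hb0]; exact div_le_div₀ hk (hupp hAk) hc₀ hb
  have hs : |s| ≤ k / c₀ := by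
    rw [abs_div, abs_of_pos hd0]; exact div_le_div₀ hk (hupp hCk) hc₀ hd
  have hac : (a - c) ^ 2 ≤ e := by
    have := sq_integral_le η (hA.sub hC)
    rw [integral_sub (hA.integrable _) (hC.integrable _), probReal_univ, one_mul] at this
    exact this.trans hAC
  have hdb : (d - b) ^ 2 ≤ e := by
    have := sq_integral_le η (hD.sub hB)
    rw [integral_sub (hD.integrable _) (hB.integrable _), probReal_univ, one_mul] at this
    exact this.trans hBD
  have he : 0 ≤ e := (sq_nonneg _).trans hac
  have hmix := mixingConst_nonneg hξ₀
  set q := k / c₀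
  have hq : 0 ≤ q := div_nonneg hk hc₀.le
  have hp2 : p ^ 2 ≤ q ^ 2 := sq_le_sq' (by linarith [(abs_le.1 hp).1]) (abs_le.1 hp).2
  have hs2 : s ^ 2 ≤ q ^ 2 := sq_le_sq' (by linarith [(abs_le.1 hs).1]) (abs_le.1 hs).2
  -- The gap between the limits is itself of squared order e, by rewriting p - s through a - c and d
  -- - b over the common denominator b.
  have hps : (p - s) ^ 2 ≤ 2 * (1 + q ^ 2) / c₀ ^ 2 * e := by
    have e1 : p - s = (a - c) / b + s * (d - b) / b := by simp only [p, s]; field_simp; ring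
    have h2 : (p - s) ^ 2 ≤ 2 * (((a - c) / b) ^ 2 + (s * (d - b) / b) ^ 2) := by
      rw [e1]; nlinarith [sq_nonneg ((a - c) / b - s * (d - b) / b)]
    rw [div_pow, div_pow, mul_pow] at h2
    have t1 : (a - c) ^ 2 / b ^ 2 ≤ e / c₀ ^ 2 := by gcongr
    have t2 : s ^ 2 * (d - b) ^ 2 / b ^ 2 ≤ q ^ 2 * e / c₀ ^ 2 := by gcongr
    calc _ ≤ 2 * (e / c₀ ^ 2 + q ^ 2 * e / c₀ ^ 2) := by linarith
      _ = _ := by ring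
  -- the centred functions
  set F₂ : S → ℝ := fun x => C x - s * D x
  set U : S → ℝ := fun x => A x - p * B x - (C x - s * D x)
  set G : S → ℝ := fun x => D x - B x - (d - b)
  have hF₂ : BddMeasurable F₂ := hC.sub (hD.const_mul s)
  have hU : BddMeasurable U := (hA.sub (hB.const_mul p)).sub hF₂
  have hG : BddMeasurable G := (hD.sub hB).sub (.const _)
  have hF₂0 : ∫ x, F₂ x ∂η = 0 := by
    simp only [F₂]
    rw [integral_sub (hC.integrable _) ((hD.const_mul s).integrable _), integral_const_mul]
    change c - c / d * d = 0
    field_simp; ring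
  have hU0 : ∫ x, U x ∂η = 0 := by
    change ∫ x, (A x - p * B x - F₂ x) ∂η = 0
    rw [integral_sub ((hA.sub (hB.const_mul p)).integrable _) (hF₂.integrable _), hF₂0,
      integral_sub (hA.integrable _) ((hB.const_mul p).integrable _), integral_const_mul]
    change a - a / b * b - 0 = 0
    field_simp; ring
  have hG0 : ∫ x, G x ∂η = 0 := by
    simp only [G]
    rw [integral_sub ((hD.sub hB).integrable _) (integrable_const _),
      integral_sub (hD.integrable _) (hB.integrable _)]
    simp [d, b]
  set fb := k + q
  have hF₂b : ∀ x, |F₂ x| ≤ fb := by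
    intro x
    have h1 : |s * D x| ≤ q * 1 := by
      rw [abs_mul]
      refine mul_le_mul hs ?_ (abs_nonneg _) hq
      rw [abs_of_pos (hc₀.trans_le (hD₀ x))]; exact hD₁ x
    exact (abs_sub _ _).trans (by simpa [fb] using add_le_add (hCk x) h1)
  have hfb : 0 ≤ fb := add_nonneg hk hq
  -- second moments
  have vF₂ : ∫ x, F₂ x ^ 2 ∂η ≤ fb ^ 2 := by
    have := integral_mono (μ := η) (hF₂.sq.integrable _) (integrable_const (fb ^ 2)) fun x =>
      sq_le_sq' (by linarith [(abs_le.1 (hF₂b x)).1]) (abs_le.1 (hF₂b x)).2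
    simpa using this
  -- A variance is at most the second moment.
  have vG : ∫ x, G x ^ 2 ∂η ≤ e := by
    have e1 : ∀ x, G x ^ 2 = (D x - B x) ^ 2 - 2 * (d - b) * (D x - B x) + (d - b) ^ 2 := by
      intro x; simp only [G]; ring
    simp_rw [e1]
    rw [integral_add (((hD.sub hB).sq.sub ((hD.sub hB).const_mul _)).integrable _)
      (integrable_const _), integral_sub ((hD.sub hB).sq.integrable _)
      (((hD.sub hB).const_mul _).integrable _), integral_const_mul,
      integral_sub (hD.integrable _) (hB.integrable _)]
    simp only [integral_const, probReal_univ, smul_eq_mul, one_mul]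
    change _ - 2 * (d - b) * (d - b) + _ ≤ _
    nlinarith [sq_nonneg (d - b)]
  have vU : ∫ x, U x ^ 2 ∂η ≤ 3 * (1 + q ^ 2 + 2 * (1 + q ^ 2) / c₀ ^ 2) * e := by
    have e1 : ∀ x, U x ^ 2 ≤
        3 * (A x - C x) ^ 2 + 3 * q ^ 2 * (D x - B x) ^ 2 + 3 * (p - s) ^ 2 := by
      intro x
      -- U is the difference of the two centred numerators; written this way, each summand has
      -- second moment of order e.
      have e2 : U x = (A x - C x) + p * (D x - B x) + -(p - s) * D x := by
        simp only [U]; ring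
      have h3 : ∀ x y z : ℝ, (x + y + z) ^ 2 ≤ 3 * (x ^ 2 + y ^ 2 + z ^ 2) := fun x y z => by
        nlinarith [sq_nonneg (x - y), sq_nonneg (x - z), sq_nonneg (y - z)]
      have h4 := h3 (A x - C x) (p * (D x - B x)) (-(p - s) * D x)
      rw [← e2, mul_pow, mul_pow, neg_sq] at h4
      have h5 : p ^ 2 * (D x - B x) ^ 2 ≤ q ^ 2 * (D x - B x) ^ 2 := by gcongr
      have h6 : (p - s) ^ 2 * D x ^ 2 ≤ (p - s) ^ 2 * 1 := by
        gcongr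
        exact pow_le_one₀ (hc₀.le.trans (hD₀ x)) (hD₁ x)
      linarith
    have i1 := (hA.sub hC).sq.const_mul 3
    have i2 := (hD.sub hB).sq.const_mul (3 * q ^ 2)
    have h1 := integral_mono (μ := η) (hU.sq.integrable _)
      (((i1.add i2).add (.const (3 * (p - s) ^ 2))).integrable _) e1
    rw [integral_add ((i1.add i2).integrable _) (integrable_const _),
      integral_add (i1.integrable _) (i2.integrable _), integral_const_mul, integral_const_mul] at h1
    simp only [integral_const, probReal_univ, smul_eq_mul, one_mul] at h1
    have h2 : 3 * q ^ 2 * ∫ x, (D x - B x) ^ 2 ∂η ≤ 3 * q ^ 2 * e := by gcongr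
    calc _ ≤ 3 * e + 3 * q ^ 2 * e + 3 * (2 * (1 + q ^ 2) / c₀ ^ 2 * e) := by linarith
      _ = _ := by ring
  -- averages
  set avg : (S → ℝ) → Ω → ℝ := fun f ω =>
    ((m : ℝ) + 1)⁻¹ * ∑ k ∈ Finset.range (m + 1), f (X k ω)
  have hm : (0 : ℝ) < (m : ℝ) + 1 := by positivity
  have avgm : ∀ {f : S → ℝ}, BddMeasurable f → AEMeasurable (avg f) P := fun hf =>
    (Finset.aemeasurable_fun_sum _ fun k _ =>
      hf.measurable.comp_aemeasurable (hXm k)).const_mul _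
  have avgi : ∀ {f : S → ℝ}, BddMeasurable f → Integrable (fun ω => avg f ω ^ 2) P := by
    intro f hf
    obtain ⟨M, hM⟩ := hf.bdd
    refine Integrable.of_bound ((avgm hf).pow_const 2).aestronglyMeasurable (M ^ 2)
      (ae_of_all _ fun ω => ?_)
    have := abs_average_le m fun i => hM (X i ω)
    rw [Real.norm_eq_abs, abs_pow]
    exact pow_le_pow_left₀ (abs_nonneg _) this 2
  have lin₂ : ∀ ω, avg F₂ ω = avg C ω - s * avg D ω := by
    intro ω; simp only [avg, F₂, Finset.sum_sub_distrib, ← Finset.mul_sum]; ring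
  have linU : ∀ ω, avg U ω = avg A ω - p * avg B ω - (avg C ω - s * avg D ω) := by
    intro ω; simp only [avg, U, Finset.sum_sub_distrib, ← Finset.mul_sum]; ring
  have linG : ∀ ω, avg G ω = avg D ω - avg B ω - (d - b) := by
    intro ω
    simp only [avg, G, Finset.sum_sub_distrib, Finset.sum_const, Finset.card_range, nsmul_eq_mul]
    push_cast
    field_simp
  have bound : ∀ ω, err ω ^ 2 ≤ 3 * (avg U ω ^ 2 / c₀ ^ 2 + fb ^ 2 * avg G ω ^ 2 / c₀ ^ 4
      + e * avg F₂ ω ^ 2 / c₀ ^ 4) := by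
    intro ω
    rw [herr, linU, linG, lin₂]
    refine sq_ratio_error_le hc₀ (le_average m fun i => hB₀ _) (le_average m fun i => hD₀ _) ?_ hdb
    change |avg C ω - s * avg D ω| ≤ fb
    rw [← lin₂]
    exact abs_average_le m fun i => hF₂b _
  have ib : Integrable (fun ω => 3 * (avg U ω ^ 2 / c₀ ^ 2 + fb ^ 2 * avg G ω ^ 2 / c₀ ^ 4
      + e * avg F₂ ω ^ 2 / c₀ ^ 4)) P :=
    ((((avgi hU).div_const _).add (((avgi hG).const_mul _).div_const _)).add
      (((avgi hF₂).const_mul _).div_const _)).const_mul 3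
  have hem : AEMeasurable err P := by
    rw [herr]
    exact (((avgm hA).div (avgm hB)).sub ((avgm hC).div (avgm hD))).sub_const _
  have ie : Integrable (fun ω => err ω ^ 2) P := by
    refine ib.mono' (hem.pow_const 2).aestronglyMeasurable (ae_of_all _ fun ω => ?_)
    rw [Real.norm_eq_abs, abs_of_nonneg (sq_nonneg _)]
    exact bound ω
  refine ⟨ie, (integral_mono ie ib bound).trans ?_⟩
  have i1 : Integrable (fun ω => avg U ω ^ 2 / c₀ ^ 2) P := (avgi hU).div_const _
  have i2 : Integrable (fun ω => fb ^ 2 * avg G ω ^ 2 / c₀ ^ 4) P :=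
    ((avgi hG).const_mul _).div_const _
  have i3 : Integrable (fun ω => e * avg F₂ ω ^ 2 / c₀ ^ 4) P :=
    ((avgi hF₂).const_mul _).div_const _
  have i12 : Integrable (fun ω => avg U ω ^ 2 / c₀ ^ 2 + fb ^ 2 * avg G ω ^ 2 / c₀ ^ 4) P :=
    i1.add i2
  rw [integral_const_mul, integral_add i12 i3, integral_add i1 i2, integral_div, integral_div,
    integral_div, integral_const_mul, integral_const_mul]
  have aU := hX.integral_sq_average_le hξ₀ hξ₁ hν hη hU hU0 m
  have aG := hX.integral_sq_average_le hξ₀ hξ₁ hν hη hG hG0 m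
  have aF := hX.integral_sq_average_le hξ₀ hξ₁ hν hη hF₂ hF₂0 m
  -- In the first two terms the factor e comes from the variances of U and G; in the third from the
  -- deterministic factor, the variance of F₂ being only bounded.
  calc _ ≤ 3 * ((((m : ℝ) + 1)⁻¹ * (mixingConst ξ *
          (3 * (1 + q ^ 2 + 2 * (1 + q ^ 2) / c₀ ^ 2) * e))) / c₀ ^ 2
        + fb ^ 2 * (((m : ℝ) + 1)⁻¹ * (mixingConst ξ * e)) / c₀ ^ 4
        + e * (((m : ℝ) + 1)⁻¹ * (mixingConst ξ * fb ^ 2)) / c₀ ^ 4) := by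
        gcongr
        · exact aU.trans (by gcongr)
        · exact aG.trans (by gcongr)
        · exact aF.trans (by gcongr)
    _ = _ := by
      simp only [ratioConst]
      ring

end Chain

end Doeblin

/-! ### Product measures -/

section Product

variable {ι : Type*} [DecidableEq ι] {X : ι → Type*} [∀ i, MeasurableSpace (X i)]

lemma measurable_update_prod (i : ι) :
    Measurable fun p : (∀ j, X j) × X i => Function.update p.1 i p.2 := by
  refine measurable_pi_iff.2 fun j => ?_
  by_cases h : j = i
  · subst h; simpa using measurable_snd
  · simpa [Function.update_of_ne h, Function.comp_def] using
      (measurable_pi_apply j).comp measurable_fst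

variable (μ : ∀ i, Measure (X i)) [∀ i, IsProbabilityMeasure (μ i)]

/-- Resampling one coordinate leaves a product measure invariant. -/
lemma map_update_infinitePi (i : ι) :
    ((Measure.infinitePi μ).prod (μ i)).map (fun p => Function.update p.1 i p.2) =
      Measure.infinitePi μ := by
  refine Measure.eq_infinitePi μ fun s t ht => ?_
  rw [Measure.map_apply (measurable_update_prod i) (.pi s.countable_toSet fun j _ => ht j)]
  by_cases hi : i ∈ s
  · have e : (fun p : (∀ j, X j) × X i => Function.update p.1 i p.2) ⁻¹' (Set.pi s t) =
        (Set.pi (s.erase i : Finset ι) t) ×ˢ t i := by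
      ext ⟨x, y⟩
      simp only [Set.mem_preimage, Set.mem_pi, Finset.mem_coe, Set.mem_prod, Finset.mem_erase]
      constructor
      · intro h
        refine ⟨fun j hj => ?_, by simpa using h i hi⟩
        simpa [Function.update_of_ne hj.1] using h j hj.2
      · rintro ⟨h, hy⟩ j hj
        by_cases hji : j = i
        · subst hji; simpa using hy
        · simpa [Function.update_of_ne hji] using h j ⟨hji, hj⟩
    rw [e, Measure.prod_prod, Measure.infinitePi_pi _ (fun j _ => ht j),
      Finset.prod_erase_mul _ _ hi]
  · have e : (fun p : (∀ j, X j) × X i => Function.update p.1 i p.2) ⁻¹' (Set.pi s t) =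
        (Set.pi s t) ×ˢ Set.univ := by
      ext ⟨x, y⟩
      simp only [Set.mem_preimage, Set.mem_pi, Finset.mem_coe, Set.mem_prod, Set.mem_univ, and_true]
      refine forall₂_congr fun j hj => ?_
      rw [Function.update_of_ne (by rintro rfl; exact hi hj)]
    rw [e, Measure.prod_prod, Measure.infinitePi_pi _ (fun j _ => ht j), measure_univ, mul_one]

/-- Fubini in one coordinate without splitting the index set: that coordinate is overwritten by a
fresh copy. It integrates out one increment or, in the finite version, the innovations of all
particles in one unit interval. -/
lemma lintegral_infinitePi_update (i : ι) {f : (∀ j, X j) → ℝ≥0∞} (hf : Measurable f) :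
    ∫⁻ w, f w ∂Measure.infinitePi μ =
      ∫⁻ w, ∫⁻ y, f (Function.update w i y) ∂μ i ∂Measure.infinitePi μ := by
  conv_lhs => rw [← map_update_infinitePi μ i]
  rw [lintegral_map hf (measurable_update_prod i),
    lintegral_prod (fun p : (∀ j, X j) × X i => f (Function.update p.1 i p.2))
      (hf.comp (measurable_update_prod i)).aemeasurable]

lemma lintegral_pi_update [Fintype ι] (i : ι) {f : (∀ j, X j) → ℝ≥0∞} (hf : Measurable f) :
    ∫⁻ w, f w ∂Measure.pi μ = ∫⁻ w, ∫⁻ y, f (Function.update w i y) ∂μ i ∂Measure.pi μ := by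
  simpa only [Measure.infinitePi_eq_pi] using lintegral_infinitePi_update μ i hf

end Product

/-! ### The law of the increments -/

lemma stepSize_pos (l : ℕ) : 0 < stepSize l := by unfold stepSize; positivity

lemma stepSize_le_one (l : ℕ) : stepSize l ≤ 1 :=
  pow_le_one₀ (by positivity) (by rw [inv_le_one₀ (by norm_num)]; norm_num)

lemma stepSize_eq (l : ℕ) : stepSize l = 2 * stepSize (l + 1) := by
  rw [stepSize, stepSize, pow_succ, mul_comm, mul_assoc, inv_mul_cancel₀ two_ne_zero, mul_one]

lemma two_pow_mul_stepSize (l : ℕ) : (2 : ℝ) ^ l * stepSize l = 1 := by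
  simp [stepSize]

/-- The law of independent `N(0, Δ_l)` increments. -/
noncomputable def noise (l : ℕ) : Measure (ℕ → ℝ) :=
  Measure.infinitePi fun _ => gaussianReal 0 (stepSize l)

instance (l : ℕ) : IsProbabilityMeasure (noise l) := by unfold noise; infer_instance

/-- A sequence set to zero from the index `n` on. -/
def trunc (n : ℕ) (w : ℕ → ℝ) (j : ℕ) : ℝ := if j < n then w j else 0

/-- The sequence whose first `n` terms are those of `w`, followed by `v`. -/
def append (n : ℕ) (w v : ℕ → ℝ) (j : ℕ) : ℝ := if j < n then w j else v (j - n)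

lemma measurable_trunc (n : ℕ) : Measurable (trunc n) := by
  refine measurable_pi_iff.2 fun j => ?_
  by_cases h : j < n
  · simpa [trunc, h] using measurable_pi_apply j
  · simp [trunc, h]

lemma measurable_append (n : ℕ) :
    Measurable fun p : (ℕ → ℝ) × (ℕ → ℝ) => append n p.1 p.2 := by
  refine measurable_pi_iff.2 fun j => ?_
  by_cases h : j < n
  · simpa [append, h, Function.comp_def] using (measurable_pi_apply j).comp measurable_fst
  · simpa [append, h, Function.comp_def] using (measurable_pi_apply (j - n)).comp measurable_snd

lemma measurable_extend {n : ℕ} : Measurable (Model.extend (n := n)) := by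
  refine measurable_pi_iff.2 fun j => ?_
  by_cases h : j < n
  · simpa [Model.extend, h] using measurable_pi_apply (⟨j, h⟩ : Fin n)
  · simp [Model.extend, h]

lemma map_shift_noise (l n m : ℕ) :
    (noise l).map (fun w (k : Fin m) => w (n + k)) =
      Measure.pi fun _ => gaussianReal 0 (stepSize l) := by
  have := Measure.map_infinitePi_infinitePi_of_inj (P := fun _ : ℕ => gaussianReal 0 (stepSize l))
    (f := fun k : Fin m => n + k) fun a b h => by simpa [Fin.ext_iff] using h
  rw [← Measure.infinitePi_eq_pi]
  exact this

lemma measurable_shift (n m : ℕ) : Measurable fun (w : ℕ → ℝ) (k : Fin m) => w (n + k) :=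
  measurable_pi_iff.2 fun _ => measurable_pi_apply _

/-- Finite noise vectors are replaced by infinite sequences cut off at m, so that all levels and
times share one type of path. -/
lemma lintegral_pi_extend (l m : ℕ) {Φ : (ℕ → ℝ) → ℝ≥0∞} (hΦ : Measurable Φ) :
    ∫⁻ v, Φ (Model.extend v) ∂(Measure.pi fun _ : Fin m => gaussianReal 0 (stepSize l)) =
      ∫⁻ w, Φ (trunc m w) ∂noise l := by
  rw [← map_shift_noise l 0 m, lintegral_map (f := fun v => Φ (Model.extend v)) (hΦ.comp measurable_extend)
    (measurable_shift 0 m)]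
  refine lintegral_congr fun w => congrArg Φ ?_
  funext j
  by_cases h : j < m <;> simp [Model.extend, trunc, h]

/-- Disjoint blocks of increments are independent, so a fresh block attached to a truncated sequence
has the law of a longer truncated sequence. This is one mutation step of a particle. -/
lemma lintegral_append (l n m : ℕ) {Φ : (ℕ → ℝ) → ℝ≥0∞} (hΦ : Measurable Φ) :
    ∫⁻ w, ∫⁻ v, Φ (append n (trunc n w) (Model.extend v))
        ∂(Measure.pi fun _ : Fin m => gaussianReal 0 (stepSize l)) ∂noise l =
      ∫⁻ w, Φ (trunc (n + m) w) ∂noise l := by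
  have hind : iIndepFun (fun (i : ℕ) (w : ℕ → ℝ) => w i) (noise l) :=
    iIndepFun_infinitePi (X := fun _ x => x) fun _ => measurable_id
  have h1 : IndepFun (trunc n) (fun (w : ℕ → ℝ) (k : Fin m) => w (n + k)) (noise l) := by
    have h2 := hind.indepFun_finset (Finset.range n) (Finset.Ico n (n + m))
      (Finset.disjoint_left.2 fun a ha hb => by
        simp only [Finset.mem_range, Finset.mem_Ico] at ha hb; omega)
      fun i => measurable_pi_apply i
    refine h2.comp (φ := fun x j => if h : j < n then x ⟨j, Finset.mem_range.2 h⟩ else 0)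
      (ψ := fun x (k : Fin m) => x ⟨n + k, by simp⟩) ?_ ?_ |>.congr ?_ ?_
    · refine measurable_pi_iff.2 fun j => ?_
      by_cases h : j < n
      · simpa [h] using measurable_pi_apply _
      · simp [h]
    · exact measurable_pi_iff.2 fun _ => measurable_pi_apply _
    · refine ae_of_all _ fun w => funext fun j => ?_
      by_cases h : j < n <;> simp [trunc, h]
    · exact ae_of_all _ fun w => rfl
  have h3 := (indepFun_iff_map_prod_eq_prod_map_map (measurable_trunc n).aemeasurable
    (measurable_shift n m).aemeasurable).1 h1
  have hm : Measurable fun p : (ℕ → ℝ) × (Fin m → ℝ) =>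
      Φ (append n p.1 (Model.extend p.2)) :=
    hΦ.comp ((measurable_append n).comp
      (measurable_fst.prodMk (measurable_extend.comp measurable_snd)))
  rw [map_shift_noise] at h3
  calc _ = ∫⁻ w, ∫⁻ v, Φ (append n w (Model.extend v))
        ∂(Measure.pi fun _ : Fin m => gaussianReal 0 (stepSize l)) ∂(noise l).map (trunc n) := by
        rw [lintegral_map hm.lintegral_prod_right' (measurable_trunc n)]
    _ = ∫⁻ p, Φ (append n p.1 (Model.extend p.2))
          ∂((noise l).map (trunc n)).prod
            (Measure.pi fun _ : Fin m => gaussianReal 0 (stepSize l)) := by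
        have : IsProbabilityMeasure ((noise l).map (trunc n)) :=
          Measure.isProbabilityMeasure_map (measurable_trunc n).aemeasurable
        rw [lintegral_prod _ hm.aemeasurable]
    _ = _ := by
      rw [← h3, lintegral_map hm ((measurable_trunc n).prodMk (measurable_shift n m))]
      refine lintegral_congr fun w => congrArg Φ ?_
      funext j
      by_cases h : j < n
      · simp [append, trunc, h, h.trans_le (Nat.le_add_right n m)]
      · by_cases h' : j < n + m
        · have : j - n < m := by omega
          simp [append, trunc, h, h', Model.extend, this, Nat.add_sub_cancel' (not_lt.1 h)]
        · have : ¬ j - n < m := by omega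
          simp [append, trunc, h, h', Model.extend, this]

/-- The increments of a Brownian motion over the grid of level `l`. -/
noncomputable def increments {Ω : Type*} (W : ℝ≥0 → Ω → ℝ) (l : ℕ) (ω : Ω) (j : ℕ) : ℝ :=
  W ((j + 1) * stepSize l) ω - W (j * stepSize l) ω

lemma coarsen_increments {Ω : Type*} (W : ℝ≥0 → Ω → ℝ) (l : ℕ) (ω : Ω) :
    Model.coarsen (increments W (l + 1) ω) = increments W l ω := by
  funext j
  simp only [Model.coarsen, increments, stepSize_eq l]
  push_cast
  rw [show ((j : ℝ≥0) + 1) * (2 * stepSize (l + 1)) = (2 * j + 1 + 1) * stepSize (l + 1) by ring,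
    show (j : ℝ≥0) * (2 * stepSize (l + 1)) = 2 * j * stepSize (l + 1) by ring]
  ring

section Brownian

variable {Ω : Type*} [MeasurableSpace Ω] {P : Measure Ω} {W : ℝ≥0 → Ω → ℝ}

lemma aemeasurable_increments (hW : IsPreBrownianReal W P) (l : ℕ) :
    AEMeasurable (increments W l) P :=
  aemeasurable_pi_lambda _ fun _ => (hW.aemeasurable _).sub (hW.aemeasurable _)

lemma map_increments (hW : IsPreBrownianReal W P) (l : ℕ) :
    P.map (increments W l) = noise l := by
  have hmono : Monotone fun j : ℕ => (j : ℝ≥0) * stepSize l := fun a b h => by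
    simp only; gcongr
  have hind := hW.hasIndepIncrements.nat hmono
  have h := hind.map_fun_eq_infinitePi_map₀' fun i =>
    ((hW.aemeasurable _).sub (hW.aemeasurable _) :)
  have e : (fun ω (i : ℕ) => W (((i + 1 : ℕ) : ℝ≥0) * stepSize l) ω - W (i * stepSize l) ω) =
      increments W l := by
    funext ω i; simp [increments]
  change P.map (fun ω (i : ℕ) => W (((i + 1 : ℕ) : ℝ≥0) * stepSize l) ω - W (i * stepSize l) ω) = _ at h
  rw [e] at h
  rw [h, noise]
  congr 1
  funext i
  have h2 := (hW.hasLaw_sub (((i + 1 : ℕ) : ℝ≥0) * stepSize l) (i * stepSize l)).map_eq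
  refine Eq.trans h2 ?_
  congr 1
  rw [← NNReal.coe_inj, coe_nndist]
  change |((((i + 1 : ℕ) : ℝ≥0) * stepSize l : ℝ≥0) : ℝ) - (((i : ℝ≥0) * stepSize l : ℝ≥0) : ℝ)| = _
  push_cast
  rw [add_mul, add_sub_cancel_left, one_mul, abs_of_nonneg (by positivity)]

lemma measurable_coarsen : Measurable Model.coarsen :=
  measurable_pi_iff.2 fun _ => (measurable_pi_apply _).add (measurable_pi_apply _)

/-- Both laws are those of the increments of the same W on nested grids, so no Gaussian convolution
has to be computed. -/
lemma map_coarsen_noise (hW : IsPreBrownianReal W P) (l : ℕ) :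
    (noise (l + 1)).map Model.coarsen = noise l := by
  rw [← map_increments hW (l + 1), AEMeasurable.map_map_of_aemeasurable
    measurable_coarsen.aemeasurable (aemeasurable_increments hW _), ← map_increments hW l]
  congr 1
  funext ω
  exact coarsen_increments W l ω

end Brownian

/-! ### Discrete stochastic integrals -/

lemma lintegral_sq_add_mul_gaussianReal (a b : ℝ) (v : ℝ≥0) :
    ∫⁻ y, ENNReal.ofReal ((a + b * y) ^ 2) ∂gaussianReal 0 v =
      ENNReal.ofReal (a ^ 2) + v * ENNReal.ofReal (b ^ 2) := by
  have h2 : MemLp (id : ℝ → ℝ) 2 (gaussianReal 0 v) := memLp_id_gaussianReal 2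
  have i1 : Integrable (fun y : ℝ => y) (gaussianReal 0 v) := h2.integrable (by norm_num)
  have i2 : Integrable (fun y : ℝ => y ^ 2) (gaussianReal 0 v) := h2.integrable_sq
  have e : ∀ y : ℝ, (a + b * y) ^ 2 = a ^ 2 + 2 * a * b * y + b ^ 2 * y ^ 2 := fun y => by ring
  have m1 : ∫ y, y ∂gaussianReal 0 v = 0 := integral_id_gaussianReal
  have m2 : ∫ y, y ^ 2 ∂gaussianReal 0 v = v := by
    have := variance_of_integral_eq_zero (X := fun y : ℝ => y) (μ := gaussianReal 0 v)
      aemeasurable_id m1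
    rw [← this]
    exact variance_fun_id_gaussianReal
  have i3 : Integrable (fun y : ℝ => a ^ 2 + 2 * a * b * y) (gaussianReal 0 v) :=
    (integrable_const _).add (i1.const_mul _)
  have i4 : Integrable (fun y : ℝ => a ^ 2 + 2 * a * b * y + b ^ 2 * y ^ 2) (gaussianReal 0 v) :=
    i3.add (i2.const_mul _)
  simp_rw [e]
  rw [← ofReal_integral_eq_lintegral_ofReal i4 (ae_of_all _ fun y => by
    change 0 ≤ a ^ 2 + 2 * a * b * y + b ^ 2 * y ^ 2; rw [← e]; positivity), integral_add i3 (i2.const_mul _),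
    integral_add (integrable_const _) (i1.const_mul _), integral_const_mul, integral_const_mul,
    m1, m2]
  simp only [integral_const, probReal_univ, smul_eq_mul, one_mul, mul_zero, add_zero]
  rw [ENNReal.ofReal_add (sq_nonneg _) (by positivity), mul_comm (b ^ 2),
    ENNReal.ofReal_mul v.coe_nonneg, ENNReal.ofReal_coe_nnreal]

/-- The Itô isometry for predictable integrands in discrete time. -/
lemma lintegral_sq_sum_mul_noise (l : ℕ) {Z : ℕ → (ℕ → ℝ) → ℝ} (hZ : ∀ j, Measurable (Z j))
    (hdep : ∀ j, DependsOn (Z j) (Set.Iio j)) (n : ℕ) :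
    ∫⁻ w, ENNReal.ofReal ((∑ j ∈ Finset.range n, Z j w * w j) ^ 2) ∂noise l =
      stepSize l * ∑ j ∈ Finset.range n, ∫⁻ w, ENNReal.ofReal (Z j w ^ 2) ∂noise l := by
  have hS : ∀ n, Measurable fun w : ℕ → ℝ => ∑ j ∈ Finset.range n, Z j w * w j := fun n =>
    Finset.measurable_fun_sum _ fun j _ => (hZ j).mul (measurable_pi_apply j)
  induction n with
  | zero => simp
  | succ n ih =>
    have hm : Measurable fun w : ℕ → ℝ =>
        ENNReal.ofReal ((∑ j ∈ Finset.range (n + 1), Z j w * w j) ^ 2) :=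
      ((hS (n + 1)).pow_const 2).ennreal_ofReal
    have hup : ∀ (w : ℕ → ℝ) (y : ℝ) (j : ℕ), j ≤ n → Z j (Function.update w n y) = Z j w :=
      fun w y j hj => hdep j fun i hi =>
        Function.update_of_ne (ne_of_lt (lt_of_lt_of_le (Set.mem_Iio.1 hi) hj)) _ _
    -- Coordinate n is replaced by a fresh Gaussian. The earlier terms and Z n do not see it, so the
    -- inner integral is the one-variable formula with a the old sum and b = Z n.
    rw [noise, lintegral_infinitePi_update _ n hm, ← noise, Finset.sum_range_succ, mul_add, ← ih,
      ← lintegral_const_mul _ ((hZ n).pow_const 2).ennreal_ofReal,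
      ← lintegral_add_left ((hS n).pow_const 2).ennreal_ofReal]
    refine lintegral_congr fun w => ?_
    rw [← lintegral_sq_add_mul_gaussianReal]
    refine lintegral_congr fun y => ?_
    congr 2
    rw [Finset.sum_range_succ, hup w y n le_rfl, Function.update_self]
    congr 1
    refine Finset.sum_congr rfl fun j hj => ?_
    have hj' := Finset.mem_range.1 hj
    rw [hup w y j hj'.le, Function.update_of_ne hj'.ne]

/-! ### Mean squares under the law of the noise -/

/-- The mean square of a functional of the noise increments. -/
noncomputable def msq (l : ℕ) (f : (ℕ → ℝ) → ℝ) : ℝ≥0∞ :=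
  ∫⁻ w, ENNReal.ofReal (f w ^ 2) ∂noise l

lemma msq_mono {l : ℕ} {f g : (ℕ → ℝ) → ℝ} (h : ∀ w, |f w| ≤ |g w|) : msq l f ≤ msq l g :=
  lintegral_mono fun w => ENNReal.ofReal_le_ofReal (sq_le_sq.2 (h w))

lemma msq_const_mul (l : ℕ) (c : ℝ) (f : (ℕ → ℝ) → ℝ) :
    msq l (fun w => c * f w) = ENNReal.ofReal (c ^ 2) * msq l f := by
  unfold msq
  rw [← lintegral_const_mul' _ _ ENNReal.ofReal_ne_top]
  refine lintegral_congr fun w => ?_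
  rw [mul_pow, ENNReal.ofReal_mul (sq_nonneg _)]

lemma msq_add_le (l : ℕ) {f g : (ℕ → ℝ) → ℝ} (hf : Measurable f) :
    msq l (fun w => f w + g w) ≤ 2 * (msq l f + msq l g) := by
  unfold msq
  rw [← lintegral_add_left (hf.pow_const 2).ennreal_ofReal,
    ← lintegral_const_mul' _ _ ENNReal.ofNat_ne_top]
  refine lintegral_mono fun w => ?_
  rw [← ENNReal.ofReal_add (sq_nonneg _) (sq_nonneg _), ← ENNReal.ofReal_ofNat 2,
    ← ENNReal.ofReal_mul (by norm_num)]
  exact ENNReal.ofReal_le_ofReal (by nlinarith [sq_nonneg (f w - g w)])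

lemma msq_sum_le (l : ℕ) {ι : Type*} (s : Finset ι) {f : ι → (ℕ → ℝ) → ℝ}
    (hf : ∀ j, Measurable (f j)) :
    msq l (fun w => ∑ j ∈ s, f j w) ≤ s.card * ∑ j ∈ s, msq l (f j) := by
  unfold msq
  rw [← lintegral_finsetSum _ fun j _ => ((hf j).pow_const 2).ennreal_ofReal,
    ← lintegral_const_mul' _ _ (ENNReal.natCast_ne_top _)]
  refine lintegral_mono fun w => ?_
  rw [← ENNReal.ofReal_sum_of_nonneg fun _ _ => sq_nonneg _, ← ENNReal.ofReal_natCast,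
    ← ENNReal.ofReal_mul (by positivity)]
  exact ENNReal.ofReal_le_ofReal sq_sum_le_card_mul_sum_sq

/-- The majorant A(1 + B)^k satisfies the recursion with equality. In ℝ≥0∞ no prior finiteness of u
is required; for the Euler scheme, finiteness of the moments is a conclusion. -/
lemma discrete_gronwall {n : ℕ} {u : ℕ → ℝ≥0∞} {A B : ℝ≥0∞}
    (hu : ∀ k ≤ n, u k ≤ A + B * ∑ j ∈ Finset.range k, u j) :
    ∀ k ≤ n, u k ≤ A * (1 + B) ^ k := by
  intro k
  induction k using Nat.strong_induction_on with
  | _ k ih =>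
    intro hk
    have key : ∀ m, A + B * ∑ j ∈ Finset.range m, A * (1 + B) ^ j = A * (1 + B) ^ m := by
      intro m
      induction m with
      | zero => simp
      | succ m ihm => rw [Finset.sum_range_succ, mul_add, ← add_assoc, ihm]; ring
    rw [← key k]
    refine (hu k hk).trans ?_
    gcongr with j hj
    have hj' := Finset.mem_range.1 hj
    exact ih j hj' (hj'.le.trans hk)

namespace Model

variable {Θ Y : Type*} [MeasurableSpace Θ] (M : Model Θ Y)

/-! ### The Euler scheme -/

lemma euler_eq (l : ℕ) (θ : Θ) (w : ℕ → ℝ) (k : ℕ) :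
    M.euler l θ w k = M.v₀ + ∑ j ∈ Finset.range k, M.K (((k : ℝ) - j) * stepSize l) *
      (M.b θ (M.euler l θ w j) * stepSize l + M.σ θ (M.euler l θ w j) * w j) := by
  cases k with
  | zero => rw [euler]; simp
  | succ k =>
    rw [euler]
    congr 1
    rw [← Fin.sum_univ_eq_sum_range fun j => M.K ((((k + 1 : ℕ) : ℝ) - j) * stepSize l) *
      (M.b θ (M.euler l θ w j) * stepSize l + M.σ θ (M.euler l θ w j) * w j)]
    push_cast
    rfl

/-- Pathwise adaptedness: it makes the integrands of the isometry predictable and lets truncated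
noise replace the full sequence. -/
lemma dependsOn_euler (l : ℕ) (θ : Θ) (k : ℕ) :
    DependsOn (fun w => M.euler l θ w k) (Set.Iio k) := by
  induction k using Nat.strong_induction_on with
  | _ k ih =>
    intro x y h
    simp only
    rw [euler_eq, euler_eq M l θ y]
    congr 1
    refine Finset.sum_congr rfl fun j hj => ?_
    have hj' := Finset.mem_range.1 hj
    have e : M.euler l θ x j = M.euler l θ y j :=
      ih j hj' fun i hi => h i (lt_trans (Set.mem_Iio.1 hi) hj')
    rw [e, h j hj']

variable {M} in
lemma measurable_euler (hb : Measurable (Function.uncurry M.b))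
    (hσ : Measurable (Function.uncurry M.σ)) (l k : ℕ) :
    Measurable fun p : Θ × (ℕ → ℝ) => M.euler l p.1 p.2 k := by
  induction k using Nat.strong_induction_on with
  | _ k ih =>
    simp_rw [euler_eq M l _ _ k]
    refine measurable_const.add (Finset.measurable_fun_sum _ fun j hj => ?_)
    have h1 := ih j (Finset.mem_range.1 hj)
    have h2 : Measurable fun p : Θ × (ℕ → ℝ) => (p.1, M.euler l p.1 p.2 j) :=
      measurable_fst.prodMk h1
    have h3 : Measurable fun p : Θ × (ℕ → ℝ) => M.b p.1 (M.euler l p.1 p.2 j) := hb.comp h2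
    have h4 : Measurable fun p : Θ × (ℕ → ℝ) => M.σ p.1 (M.euler l p.1 p.2 j) := hσ.comp h2
    exact ((h3.mul_const _).add (h4.mul
      ((measurable_pi_apply j).comp measurable_snd))).const_mul _

variable {M} in
lemma measurable_euler_right (hb : Measurable (Function.uncurry M.b))
    (hσ : Measurable (Function.uncurry M.σ)) (l k : ℕ) (θ : Θ) :
    Measurable fun w : ℕ → ℝ => M.euler l θ w k :=
  (measurable_euler hb hσ l k).comp measurable_prodMk_left

/-- The mean square of `1 + |v_k|` for the Euler scheme. -/
noncomputable def eulerMoment (l : ℕ) (θ : Θ) (k : ℕ) : ℝ≥0∞ :=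
  msq l fun w => 1 + |M.euler l θ w k|

variable {M} in
lemma Standing.growth {H : ℝ} (hM : M.Standing H) : ∃ C : ℝ, 0 ≤ C ∧
    ∀ θ v, |M.b θ v| ≤ C * (1 + |v|) ∧ |M.σ θ v| ≤ C * (1 + |v|) := by
  obtain ⟨C, hC⟩ := hM.linear_growth
  refine ⟨|C|, abs_nonneg _, fun θ v => ?_⟩
  have h1 := hC θ v
  have h2 : C * (1 + |v|) ≤ |C| * (1 + |v|) := by gcongr; exact le_abs_self C
  constructor <;> linarith [abs_nonneg (M.b θ v), abs_nonneg (M.σ θ v)]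

variable {M} in
/-- Mean square of weighted sums of the increments of the Euler scheme. -/
lemma msq_weighted_sum_le {C : ℝ} (hb : Measurable (Function.uncurry M.b))
    (hσ : Measurable (Function.uncurry M.σ))
    (hC : ∀ θ v, |M.b θ v| ≤ C * (1 + |v|) ∧ |M.σ θ v| ≤ C * (1 + |v|))
    (l : ℕ) (θ : Θ) (a : ℕ → ℝ) {n : ℕ} (hn : n ≤ M.T * 2 ^ l) :
    msq l (fun w => ∑ j ∈ Finset.range n, a j *
      (M.b θ (M.euler l θ w j) * stepSize l + M.σ θ (M.euler l θ w j) * w j)) ≤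
      ENNReal.ofReal (2 * (M.T + 1) * C ^ 2) * ∑ j ∈ Finset.range n,
        ENNReal.ofReal (stepSize l * a j ^ 2) * M.eulerMoment l θ j := by
  have hv := fun j => measurable_euler_right hb hσ l j θ
  have hbv : ∀ j, Measurable fun w => M.b θ (M.euler l θ w j) := fun j =>
    hb.comp (measurable_const.prodMk (hv j))
  have hσv : ∀ j, Measurable fun w => M.σ θ (M.euler l θ w j) := fun j =>
    hσ.comp (measurable_const.prodMk (hv j))
  have e : (fun w => ∑ j ∈ Finset.range n, a j *
      (M.b θ (M.euler l θ w j) * stepSize l + M.σ θ (M.euler l θ w j) * w j)) =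
      fun w => (∑ j ∈ Finset.range n, (a j * stepSize l) * M.b θ (M.euler l θ w j)) +
        ∑ j ∈ Finset.range n, (a j * M.σ θ (M.euler l θ w j)) * w j := by
    funext w
    rw [← Finset.sum_add_distrib]
    exact Finset.sum_congr rfl fun j _ => by ring
  have mb : ∀ j, msq l (fun w => M.b θ (M.euler l θ w j)) ≤
      ENNReal.ofReal (C ^ 2) * M.eulerMoment l θ j := by
    intro j
    rw [eulerMoment, ← msq_const_mul]
    exact msq_mono fun w => ((hC θ _).1.trans (le_abs_self _))
  have mσ : ∀ j, msq l (fun w => M.σ θ (M.euler l θ w j)) ≤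
      ENNReal.ofReal (C ^ 2) * M.eulerMoment l θ j := by
    intro j
    rw [eulerMoment, ← msq_const_mul]
    exact msq_mono fun w => ((hC θ _).2.trans (le_abs_self _))
  rw [e]
  refine (msq_add_le l (Finset.measurable_fun_sum _ fun j _ => (hbv j).const_mul _)).trans ?_
  -- Drift: Cauchy–Schwarz costs a factor n, which one of the two factors Δ absorbs because nΔ ≤ T.
  have h1 : msq l (fun w => ∑ j ∈ Finset.range n, (a j * stepSize l) * M.b θ (M.euler l θ w j)) ≤
      ENNReal.ofReal (M.T * C ^ 2) * ∑ j ∈ Finset.range n,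
        ENNReal.ofReal (stepSize l * a j ^ 2) * M.eulerMoment l θ j := by
    refine (msq_sum_le l _ fun j => (hbv j).const_mul _).trans ?_
    rw [Finset.card_range, Finset.mul_sum, Finset.mul_sum]
    refine Finset.sum_le_sum fun j _ => ?_
    rw [msq_const_mul]
    calc _ ≤ (n : ℝ≥0∞) * (ENNReal.ofReal ((a j * stepSize l) ^ 2) *
          (ENNReal.ofReal (C ^ 2) * M.eulerMoment l θ j)) := by gcongr; exact mb j
      _ = ENNReal.ofReal (n * (a j * stepSize l) ^ 2 * C ^ 2) * M.eulerMoment l θ j := by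
        rw [ENNReal.ofReal_mul (by positivity), ENNReal.ofReal_mul (by positivity),
          ENNReal.ofReal_natCast]
        ring
      _ ≤ ENNReal.ofReal (M.T * C ^ 2 * (stepSize l * a j ^ 2)) * M.eulerMoment l θ j := by
        refine mul_le_mul' (ENNReal.ofReal_le_ofReal ?_) le_rfl
        have : (n : ℝ) * stepSize l ≤ M.T := by
          calc (n : ℝ) * stepSize l ≤ (M.T * 2 ^ l : ℕ) * stepSize l := by gcongr
            _ = _ := by push_cast; rw [mul_assoc, two_pow_mul_stepSize, mul_one]
        calc (n : ℝ) * (a j * stepSize l) ^ 2 * C ^ 2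
            = (n * stepSize l) * (C ^ 2 * (stepSize l * a j ^ 2)) := by ring
          _ ≤ M.T * (C ^ 2 * (stepSize l * a j ^ 2)) := by gcongr
          _ = _ := by ring
      _ = _ := by rw [ENNReal.ofReal_mul (by positivity), mul_assoc]
  -- Noise: the isometry yields the weights Δ a_j² without any loss in n.
  have h2 : msq l (fun w => ∑ j ∈ Finset.range n, (a j * M.σ θ (M.euler l θ w j)) * w j) ≤
      ENNReal.ofReal (C ^ 2) * ∑ j ∈ Finset.range n,
        ENNReal.ofReal (stepSize l * a j ^ 2) * M.eulerMoment l θ j := by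
    unfold msq
    rw [lintegral_sq_sum_mul_noise l (Z := fun j w => a j * M.σ θ (M.euler l θ w j))
      (fun j => (hσv j).const_mul _) (fun j x y h => by
        have := M.dependsOn_euler l θ j h
        simp only at this
        simp only [this]), Finset.mul_sum, Finset.mul_sum]
    refine Finset.sum_le_sum fun j _ => ?_
    change _ * msq l (fun w => a j * M.σ θ (M.euler l θ w j)) ≤ _
    rw [msq_const_mul, ENNReal.ofReal_mul (by positivity), ENNReal.ofReal_coe_nnreal]
    calc _ ≤ (stepSize l : ℝ≥0∞) * (ENNReal.ofReal (a j ^ 2) *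
          (ENNReal.ofReal (C ^ 2) * M.eulerMoment l θ j)) := by gcongr; exact mσ j
      _ = _ := by ring
  refine (mul_le_mul_right (add_le_add h1 h2) _).trans (le_of_eq ?_)
  rw [← add_mul, ← mul_assoc, ← ENNReal.ofReal_add (by positivity) (by positivity),
    ← ENNReal.ofReal_ofNat 2, ← ENNReal.ofReal_mul (by norm_num)]
  congr 2
  ring

variable {M} in
/-- Second moments of the Euler schemes are bounded, uniformly in level and parameter. -/
lemma Standing.exists_eulerMoment_le {H : ℝ} (hM : M.Standing H) (hH : 0 ≤ H) :
    ∃ C : ℝ≥0, ∀ (l : ℕ) (θ : Θ), ∀ k ≤ M.T * 2 ^ l, M.eulerMoment l θ k ≤ C := by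
  obtain ⟨C, hC0, hC⟩ := hM.growth
  obtain ⟨c, hc⟩ := hM.kernel_bound
  have hc0 : 0 ≤ c := by
    have h1 := hc 1 one_pos (by exact_mod_cast hM.T_pos)
    rw [Real.one_rpow, mul_one] at h1
    exact (abs_nonneg _).trans h1
  -- As H ≥ 0, the power bound at T bounds the Volterra kernel on all of (0, T].
  set κ := c * (M.T : ℝ) ^ H
  have hκ : 0 ≤ κ := by positivity
  have hK : ∀ t : ℝ, 0 < t → t ≤ M.T → M.K t ^ 2 ≤ κ ^ 2 := by
    intro t h0 h1
    have : |M.K t| ≤ κ := (hc t h0 h1).trans (by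
      simp only [κ]; gcongr)
    exact sq_le_sq' (by linarith [(abs_le.1 this).1]) (abs_le.1 this).2
  set B : ℝ := 2 * (2 * (M.T + 1) * C ^ 2) * κ ^ 2
  have hB : 0 ≤ B := by positivity
  set A : ℝ := 2 * (1 + |M.v₀|) ^ 2
  refine ⟨(A * Real.exp (B * M.T)).toNNReal, fun l θ k hk => ?_⟩
  have hrec : ∀ k ≤ M.T * 2 ^ l, M.eulerMoment l θ k ≤ ENNReal.ofReal A +
      ENNReal.ofReal (B * stepSize l) * ∑ j ∈ Finset.range k, M.eulerMoment l θ j := by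
    intro k hk
    set a : ℕ → ℝ := fun j => M.K (((k : ℝ) - j) * stepSize l)
    have h1 : M.eulerMoment l θ k ≤ msq l (fun w => (1 + |M.v₀|) +
        |∑ j ∈ Finset.range k, a j * (M.b θ (M.euler l θ w j) * stepSize l
          + M.σ θ (M.euler l θ w j) * w j)|) := by
      refine msq_mono fun w => ?_
      refine abs_le_abs_of_nonneg (by positivity) ?_
      rw [euler_eq M l θ w k, add_assoc]
      exact add_le_add_right (abs_add_le _ _) _
    refine h1.trans ((msq_add_le l measurable_const).trans ?_)
    have h2 := msq_weighted_sum_le hM.b_measurable hM.σ_measurable hC l θ a hk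
    have h3 : msq l (fun _ => 1 + |M.v₀|) = ENNReal.ofReal ((1 + |M.v₀|) ^ 2) := by
      simp [msq]
    have h4 : msq l (fun w => |∑ j ∈ Finset.range k, a j * (M.b θ (M.euler l θ w j) * stepSize l
          + M.σ θ (M.euler l θ w j) * w j)|) = msq l (fun w => ∑ j ∈ Finset.range k, a j *
          (M.b θ (M.euler l θ w j) * stepSize l + M.σ θ (M.euler l θ w j) * w j)) := by
      simp only [msq, sq_abs]
    rw [h3, h4, mul_add]
    refine add_le_add (le_of_eq ?_) ?_
    · rw [← ENNReal.ofReal_ofNat 2, ← ENNReal.ofReal_mul (by norm_num)]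
    · calc _ ≤ 2 * (ENNReal.ofReal (2 * (M.T + 1) * C ^ 2) * ∑ j ∈ Finset.range k,
            ENNReal.ofReal (stepSize l * κ ^ 2) * M.eulerMoment l θ j) := by
            refine mul_le_mul_right (h2.trans (mul_le_mul_right
              (Finset.sum_le_sum fun j hj => ?_) _)) _
            have hj' := Finset.mem_range.1 hj
            refine mul_le_mul' (ENNReal.ofReal_le_ofReal (mul_le_mul_of_nonneg_left ?_
              (stepSize l).coe_nonneg)) le_rfl
            refine hK _ (mul_pos (sub_pos.2 (by exact_mod_cast hj')) (stepSize_pos l)) ?_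
            calc ((k : ℝ) - j) * stepSize l ≤ (M.T * 2 ^ l : ℕ) * stepSize l := by
                  gcongr
                  have : (k : ℝ) ≤ (M.T * 2 ^ l : ℕ) := by exact_mod_cast hk
                  linarith [(Nat.cast_nonneg j : (0 : ℝ) ≤ j)]
              _ = _ := by push_cast; rw [mul_assoc, two_pow_mul_stepSize, mul_one]
        _ = _ := by
          rw [← Finset.mul_sum, ← mul_assoc, ← mul_assoc, ← ENNReal.ofReal_ofNat 2,
            ← ENNReal.ofReal_mul (by norm_num), ← ENNReal.ofReal_mul (by positivity)]
          congr 2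
          simp only [B]; ring
  -- The factor (1 + BΔ)^k is at most exp(BkΔ), and kΔ ≤ T removes the dependence on the level.
  refine (discrete_gronwall hrec k hk).trans ?_
  rw [← ENNReal.ofReal_one, ← ENNReal.ofReal_add zero_le_one (by positivity),
    ← ENNReal.ofReal_pow (by positivity), ← ENNReal.ofReal_mul (by positivity)]
  change ENNReal.ofReal _ ≤ ENNReal.ofReal _
  refine ENNReal.ofReal_le_ofReal (mul_le_mul_of_nonneg_left ?_ (by positivity))
  calc (1 + B * stepSize l) ^ k ≤ Real.exp (B * stepSize l) ^ k := by
        gcongr; rw [add_comm]; exact Real.add_one_le_exp _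
    _ = Real.exp (B * (k * stepSize l)) := by rw [← Real.exp_nat_mul]; congr 1; ring
    _ ≤ _ := by
      gcongr
      calc (k : ℝ) * stepSize l ≤ (M.T * 2 ^ l : ℕ) * stepSize l := by gcongr
        _ = _ := by push_cast; rw [mul_assoc, two_pow_mul_stepSize, mul_one]

end Model

lemma sum_range_two_mul {A : Type*} [AddCommMonoid A] (n : ℕ) (x : ℕ → A) :
    ∑ k ∈ Finset.range (2 * n), x k = ∑ k ∈ Finset.range n, (x (2 * k) + x (2 * k + 1)) := by
  induction n with
  | zero => simp
  | succ n ih =>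
    rw [show 2 * (n + 1) = 2 * n + 1 + 1 by ring, Finset.sum_range_succ, Finset.sum_range_succ, ih,
      Finset.sum_range_succ, add_assoc]

namespace Model

variable {Θ Y : Type*} [MeasurableSpace Θ] {M : Model Θ Y}

/-! ### Increments of the Euler scheme -/

/-- The time regularity of the Euler scheme. -/
lemma Standing.exists_msq_euler_sub_le {H β : ℝ} (hM : M.Standing H) (hH : 0 ≤ H) (hH₁ : H < 1 / 2)
    (hβ : β ≤ H + 1 / 2) : ∃ C : ℝ≥0, ∀ (l : ℕ) (θ : Θ), ∀ k, k + 1 ≤ M.T * 2 ^ l →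
      msq l (fun w => M.euler l θ w (k + 1) - M.euler l θ w k) ≤
        C * ENNReal.ofReal ((stepSize l : ℝ) ^ (2 * β)) := by
  obtain ⟨C, hC0, hC⟩ := hM.growth
  obtain ⟨Cm, hCm⟩ := hM.exists_eulerMoment_le hH
  obtain ⟨c, hc⟩ := hM.kernel_bound
  obtain ⟨c', hc'⟩ := hM.kernel_modulus
  -- Convergent because 2H - 2 < -1; this is where H < 1/2 enters.
  set S : ℝ := ∑' i : ℕ, (i : ℝ) ^ (2 * H - 2)
  have hS : Summable fun i : ℕ => (i : ℝ) ^ (2 * H - 2) := Real.summable_nat_rpow.2 (by linarith)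
  have hS0 : 0 ≤ S := tsum_nonneg fun i => by positivity
  set D : ℝ := 2 * (M.T + 1) * C ^ 2
  refine ⟨(D * (c' ^ 2 * S + c ^ 2)).toNNReal * Cm, fun l θ k hk => ?_⟩
  set Δ : ℝ := ((stepSize l : ℝ≥0) : ℝ)
  have hΔ : 0 < Δ := NNReal.coe_pos.2 (stepSize_pos l)
  have hΔ1 : Δ ≤ 1 := NNReal.coe_le_coe.2 (stepSize_le_one l)
  -- Weights of the one-step increment: a difference of kernel values for the old terms j < k, and
  -- the kernel at Δ for the new term j = k.
  set a : ℕ → ℝ := fun j => M.K ((((k + 1 : ℕ) : ℝ) - j) * Δ) -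
    if j < k then M.K (((k : ℝ) - j) * Δ) else 0
  have hkT : ((k : ℝ) + 1) * Δ ≤ M.T := by
    calc ((k : ℝ) + 1) * Δ ≤ (M.T * 2 ^ l : ℕ) * Δ := by
          gcongr; exact_mod_cast hk
      _ = _ := by push_cast; rw [mul_assoc, two_pow_mul_stepSize, mul_one]
  have e : (fun w => M.euler l θ w (k + 1) - M.euler l θ w k) = fun w =>
      ∑ j ∈ Finset.range (k + 1), a j *
        (M.b θ (M.euler l θ w j) * stepSize l + M.σ θ (M.euler l θ w j) * w j) := by
    funext w
    rw [euler_eq M l θ w (k + 1), euler_eq M l θ w k, add_sub_add_left_eq_sub,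
      Finset.sum_range_succ, Finset.sum_range_succ, add_sub_right_comm, ← Finset.sum_sub_distrib]
    congr 1
    · refine Finset.sum_congr rfl fun j hj => ?_
      simp only [a, if_pos (Finset.mem_range.1 hj), Δ]
      ring
    · simp only [a, lt_irrefl, if_false, sub_zero, Δ]
  rw [e]
  refine (msq_weighted_sum_le hM.b_measurable hM.σ_measurable hC l θ a hk).trans ?_
  have ha : ∑ j ∈ Finset.range (k + 1), Δ * a j ^ 2 ≤ Δ ^ (2 * H + 1) * (c' ^ 2 * S + c ^ 2) := by
    rw [Finset.sum_range_succ, mul_add]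
    refine add_le_add ?_ ?_
    · have h1 : ∀ j ∈ Finset.range k, Δ * a j ^ 2 ≤
          Δ ^ (2 * H + 1) * (c' ^ 2 * (((k - 1 - j : ℕ) : ℝ) + 1) ^ (2 * H - 2)) := by
        intro j hj
        have hj' := Finset.mem_range.1 hj
        have hjk : ((k - 1 - j : ℕ) : ℝ) + 1 = (k : ℝ) - j := by
          rw [Nat.cast_sub (by omega), Nat.cast_sub (by omega)]; push_cast; ring
        have hpos : (0 : ℝ) < (k : ℝ) - j := sub_pos.2 (by exact_mod_cast hj')
        have h2 := hc' (((k : ℝ) - j) * Δ) ((((k + 1 : ℕ) : ℝ) - j) * Δ) (mul_pos hpos hΔ)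
          (by push_cast; gcongr; linarith)
          (by push_cast; refine le_trans ?_ hkT; gcongr; linarith [(Nat.cast_nonneg j : (0:ℝ) ≤ j)])
        rw [show (((k + 1 : ℕ) : ℝ) - j) * Δ - ((k : ℝ) - j) * Δ = Δ by push_cast; ring] at h2
        have h3 : a j ^ 2 ≤ (c' * (((k : ℝ) - j) * Δ) ^ (H - 1) * Δ) ^ 2 := by
          simp only [a, if_pos hj']
          exact sq_le_sq.2 (h2.trans (le_abs_self _))
        rw [hjk]
        -- Scaling: the kernel modulus at distance (k - j)Δ gives Δ^{2H+1} times a power of k - j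
        -- that is summable.
        calc Δ * a j ^ 2 ≤ Δ * (c' * (((k : ℝ) - j) * Δ) ^ (H - 1) * Δ) ^ 2 := by gcongr
          _ = _ := by
            rw [Real.mul_rpow hpos.le hΔ.le, mul_pow, mul_pow, mul_pow, ← Real.rpow_mul_natCast
              hpos.le, ← Real.rpow_mul_natCast hΔ.le, show 2 * H + 1 = (H - 1) * (2 : ℕ) + 3 by
              push_cast; ring, Real.rpow_add hΔ, show (2 * H - 2) = (H - 1) * (2 : ℕ) by
              push_cast; ring, show ((3 : ℝ)) = ((3 : ℕ) : ℝ) by norm_num, Real.rpow_natCast]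
            ring
      refine (Finset.sum_le_sum h1).trans ?_
      rw [← Finset.mul_sum, ← Finset.mul_sum]
      refine mul_le_mul_of_nonneg_left (mul_le_mul_of_nonneg_left ?_ (sq_nonneg _)) (by positivity)
      -- Counted from the nearest term the sum runs over (i + 1)^{2H-2}; adding the nonnegative term
      -- at zero makes it a partial sum of S.
      rw [Finset.sum_range_reflect (fun i : ℕ => ((i : ℝ) + 1) ^ (2 * H - 2))]
      have h3 := hS.sum_le_tsum (Finset.range (k + 1)) fun i _ => by positivity
      rw [Finset.sum_range_succ'] at h3
      push_cast at h3
      have h4 : (0 : ℝ) ≤ (0 : ℝ) ^ (2 * H - 2) := by positivity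
      linarith
    · simp only [a, lt_irrefl, if_false, sub_zero]
      have h1 : (((k + 1 : ℕ) : ℝ) - k) * Δ = Δ := by push_cast; ring
      have hk1 : Δ ≤ M.T := by
        refine le_trans ?_ hkT
        nlinarith [(Nat.cast_nonneg k : (0 : ℝ) ≤ k)]
      have h2 : M.K Δ ^ 2 ≤ (c * Δ ^ H) ^ 2 := sq_le_sq.2 ((hc Δ hΔ hk1).trans (le_abs_self _))
      rw [h1]
      calc Δ * M.K Δ ^ 2 ≤ Δ * (c * Δ ^ H) ^ 2 := by gcongr
        _ = _ := by
          rw [mul_pow, ← Real.rpow_mul_natCast hΔ.le, Real.rpow_add hΔ, Real.rpow_one,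
            show 2 * H = H * (2 : ℕ) by push_cast; ring]
          ring
  -- The restriction β ≤ H + 1/2 ensures that the time regularity is no worse than the strong rate.
  have hpow : Δ ^ (2 * H + 1) ≤ Δ ^ (2 * β) :=
    Real.rpow_le_rpow_of_exponent_ge hΔ hΔ1 (by linarith)
  calc _ ≤ ENNReal.ofReal D * ∑ j ∈ Finset.range (k + 1), ENNReal.ofReal (Δ * a j ^ 2) * Cm := by
        refine mul_le_mul' le_rfl (Finset.sum_le_sum fun j hj => mul_le_mul' le_rfl ?_)
        exact hCm l θ j ((Finset.mem_range.1 hj).le.trans hk)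
    _ = ENNReal.ofReal (D * ∑ j ∈ Finset.range (k + 1), Δ * a j ^ 2) * Cm := by
        rw [← Finset.sum_mul, ← ENNReal.ofReal_sum_of_nonneg fun j _ => by positivity,
          ENNReal.ofReal_mul (p := D) (by positivity), mul_assoc]
    _ ≤ ENNReal.ofReal (D * (Δ ^ (2 * β) * (c' ^ 2 * S + c ^ 2))) * Cm := by
        refine mul_le_mul' (ENNReal.ofReal_le_ofReal ?_) le_rfl
        refine mul_le_mul_of_nonneg_left (ha.trans ?_) (by positivity)
        gcongr
    _ = _ := by
        rw [show D * (Δ ^ (2 * β) * (c' ^ 2 * S + c ^ 2)) =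
          (D * (c' ^ 2 * S + c ^ 2)) * Δ ^ (2 * β) by ring, ENNReal.ofReal_mul (by positivity),
          ENNReal.coe_mul]
        change ENNReal.ofReal _ * _ * _ = ENNReal.ofReal _ * _ * _
        ring

/-! ### Coupled Euler schemes -/

lemma lintegral_sq_le_of_eLpNorm_le {Ω : Type*} [MeasurableSpace Ω] {P : Measure Ω} {f : Ω → ℝ}
    {a : ℝ} (h : eLpNorm f (ENNReal.ofReal 2) P ≤ ENNReal.ofReal a) :
    ∫⁻ ω, ENNReal.ofReal (f ω ^ 2) ∂P ≤ ENNReal.ofReal (a ^ 2) := by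
  rw [eLpNorm_eq_lintegral_rpow_enorm_toReal (by norm_num) (by norm_num)] at h
  rw [ENNReal.toReal_ofReal (by norm_num), one_div] at h
  have h2 := ENNReal.rpow_le_rpow h (z := 2) (by norm_num)
  rw [← ENNReal.rpow_mul, inv_mul_cancel₀ two_ne_zero, ENNReal.rpow_one] at h2
  calc _ = ∫⁻ ω, ‖f ω‖ₑ ^ (2 : ℝ) ∂P := by
        refine lintegral_congr fun ω => ?_
        rw [← sq_abs, ← Real.norm_eq_abs, ENNReal.ofReal_pow (norm_nonneg _), ofReal_norm]
        norm_cast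
    _ ≤ _ := h2
    _ ≤ ENNReal.ofReal |a| ^ (2 : ℝ) := by gcongr; exact le_abs_self a
    _ = _ := by
        rw [← sq_abs, ENNReal.ofReal_pow (abs_nonneg _)]; norm_cast

/-- The strong error transfers to the coupled Euler schemes of consecutive levels. -/
lemma StrongError.exists_msq_coupled_le {Ω : Type*} [MeasurableSpace Ω] {P : Measure Ω}
    {W : ℝ≥0 → Ω → ℝ} {V : Θ → ℝ≥0 → Ω → ℝ} {H β : ℝ} (h : M.StrongError P W V β)
    (hW : IsPreBrownianReal W P) (hV : ∀ θ t, AEMeasurable (V θ t) P) (hM : M.Standing H) :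
    ∃ C : ℝ≥0, ∀ (l : ℕ) (θ : Θ), ∀ k ≤ M.T * 2 ^ l,
      msq (l + 1) (fun w => M.euler (l + 1) θ w (2 * k) - M.euler l θ (coarsen w) k) ≤
        C * ENNReal.ofReal ((stepSize (l + 1) : ℝ) ^ (2 * β)) := by
  obtain ⟨C, hC⟩ := h 2 (by norm_num) le_rfl
  refine ⟨(2 * C ^ 2 * (1 + (2 : ℝ) ^ (2 * β))).toNNReal, fun l θ k hk => ?_⟩
  -- The strong error is assumed only at positive times; at time zero both schemes equal v₀.
  rcases Nat.eq_zero_or_pos k with rfl | hk0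
  · have e0 : ∀ l w, M.euler l θ w 0 = M.v₀ := fun l w => by rw [euler_eq]; simp
    simp [e0, msq]
  have hme : ∀ l k, Measurable fun w : ℕ → ℝ => M.euler l θ w k := fun l k =>
    measurable_euler_right hM.b_measurable hM.σ_measurable l k θ
  have hf : Measurable fun w =>
      ENNReal.ofReal ((M.euler (l + 1) θ w (2 * k) - M.euler l θ (coarsen w) k) ^ 2) :=
    (((hme _ _).sub ((hme _ _).comp measurable_coarsen)).pow_const 2).ennreal_ofReal
  have h1 := lintegral_sq_le_of_eLpNorm_le (hC (l + 1) (2 * k) (by omega)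
    (by rw [pow_succ]; nlinarith) θ)
  have h2 := lintegral_sq_le_of_eLpNorm_le (hC l k hk0 hk θ)
  change ∫⁻ ω, ENNReal.ofReal ((M.euler (l + 1) θ (increments W (l + 1) ω) (2 * k) - _) ^ 2) ∂P
    ≤ _ at h1
  change ∫⁻ ω, ENNReal.ofReal ((M.euler l θ (increments W l ω) k - _) ^ 2) ∂P ≤ _ at h2
  -- Index 2k of the fine grid and k of the coarse grid are the same time, so the Volterra process
  -- drops out of the difference.
  rw [show (((2 * k : ℕ) : ℝ≥0)) * stepSize (l + 1) = (k : ℝ≥0) * stepSize l by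
    rw [stepSize_eq l]; push_cast; ring] at h1
  unfold msq
  rw [← map_increments hW, lintegral_map' hf.aemeasurable (aemeasurable_increments hW _)]
  simp_rw [coarsen_increments]
  set x : Ω → ℝ := fun ω => M.euler (l + 1) θ (increments W (l + 1) ω) (2 * k) -
    V θ (k * stepSize l) ω
  set y : Ω → ℝ := fun ω => M.euler l θ (increments W l ω) k - V θ (k * stepSize l) ω
  have hx : AEMeasurable x P :=
    ((hme _ _).comp_aemeasurable (aemeasurable_increments hW _)).sub (hV _ _)
  have hp : (stepSize l : ℝ) ^ β = 2 ^ β * (stepSize (l + 1) : ℝ) ^ β := by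
    rw [stepSize_eq l]; push_cast
    rw [Real.mul_rpow (by norm_num) (stepSize _).coe_nonneg]
  have hsq : ∀ z : ℝ, 0 ≤ z → (z ^ β) ^ 2 = z ^ (2 * β) := fun z hz => by
    rw [← Real.rpow_mul_natCast hz, mul_comm]; norm_num
  calc _ ≤ ∫⁻ ω, 2 * (ENNReal.ofReal (x ω ^ 2) + ENNReal.ofReal (y ω ^ 2)) ∂P := by
        refine lintegral_mono fun ω => ?_
        rw [← ENNReal.ofReal_add (sq_nonneg _) (sq_nonneg _), ← ENNReal.ofReal_ofNat 2,
          ← ENNReal.ofReal_mul (by norm_num)]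
        refine ENNReal.ofReal_le_ofReal ?_
        rw [show M.euler (l + 1) θ (increments W (l + 1) ω) (2 * k) -
          M.euler l θ (increments W l ω) k = x ω - y ω by simp only [x, y]; ring]
        nlinarith [sq_nonneg (x ω + y ω)]
    _ = 2 * (∫⁻ ω, ENNReal.ofReal (x ω ^ 2) ∂P + ∫⁻ ω, ENNReal.ofReal (y ω ^ 2) ∂P) := by
        rw [lintegral_const_mul' _ _ ENNReal.ofNat_ne_top,
          lintegral_add_left' (hx.pow_const 2).ennreal_ofReal]
    _ ≤ 2 * (_ + _) := mul_le_mul' le_rfl (add_le_add h1 h2)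
    _ = _ := by
        rw [← ENNReal.ofReal_add (sq_nonneg _) (sq_nonneg _), ← ENNReal.ofReal_ofNat 2,
          ← ENNReal.ofReal_mul (by norm_num)]
        change _ = ENNReal.ofReal _ * _
        rw [← ENNReal.ofReal_mul (by positivity)]
        congr 1
        rw [mul_pow, mul_pow, hp, mul_pow, hsq _ (stepSize _).coe_nonneg, hsq _ (by norm_num)]
        ring

/-- The mean square distance of the coupled Euler schemes of consecutive levels. -/
lemma StrongError.exists_msq_euler_half_le {Ω : Type*} [MeasurableSpace Ω] {P : Measure Ω}
    {W : ℝ≥0 → Ω → ℝ} {V : Θ → ℝ≥0 → Ω → ℝ} {H β : ℝ} (h : M.StrongError P W V β)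
    (hW : IsPreBrownianReal W P) (hV : ∀ θ t, AEMeasurable (V θ t) P) (hM : M.Standing H)
    (hH : 0 ≤ H) (hH₁ : H < 1 / 2) (hβ : β ≤ H + 1 / 2) :
    ∃ C : ℝ≥0, ∀ (l : ℕ) (θ : Θ), ∀ k ≤ M.T * 2 ^ (l + 1),
      msq (l + 1) (fun w => M.euler (l + 1) θ w k - M.euler l θ (coarsen w) (k / 2)) ≤
        C * ENNReal.ofReal ((stepSize (l + 1) : ℝ) ^ (2 * β)) := by
  obtain ⟨C₁, h₁⟩ := h.exists_msq_coupled_le hW hV hM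
  obtain ⟨C₂, h₂⟩ := hM.exists_msq_euler_sub_le hH hH₁ hβ
  have hme : ∀ l k θ, Measurable fun w : ℕ → ℝ => M.euler l θ w k := fun l k θ =>
    measurable_euler_right hM.b_measurable hM.σ_measurable l k θ
  refine ⟨2 * (C₁ + C₂), fun l θ k hk => ?_⟩
  rw [pow_succ] at hk
  rcases Nat.even_or_odd' k with ⟨j, rfl | rfl⟩
  · have h3 := h₁ l θ j (by nlinarith)
    rw [Nat.mul_div_cancel_left _ two_pos]
    refine h3.trans (mul_le_mul' ?_ le_rfl)
    norm_cast
    calc C₁ ≤ C₁ + (C₁ + 2 * C₂) := le_self_add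
      _ = _ := by ring
  -- An odd fine point is not on the coarse grid; one step back along the fine scheme reaches a
  -- common point.
  · have h3 := h₁ l θ j (by nlinarith)
    have h4 := h₂ (l + 1) θ (2 * j) (by rw [pow_succ]; exact hk)
    rw [show (2 * j + 1) / 2 = j by omega]
    have e : (fun w => M.euler (l + 1) θ w (2 * j + 1) - M.euler l θ (coarsen w) j) = fun w =>
        (M.euler (l + 1) θ w (2 * j + 1) - M.euler (l + 1) θ w (2 * j)) +
        (M.euler (l + 1) θ w (2 * j) - M.euler l θ (coarsen w) j) := by
      funext w; ring
    rw [e]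
    refine (msq_add_le _ ((hme _ _ _).sub (hme _ _ _))).trans
      ((mul_le_mul' le_rfl (add_le_add h4 h3)).trans (le_of_eq ?_))
    push_cast
    ring

/-! ### Likelihoods -/

/-- Bounds and a Lipschitz constant that are common to all likelihood factors. -/
lemma LikelihoodRegular.exists_bounds (h : M.LikelihoodRegular) (n : ℕ) :
    ∃ c C L : ℝ, 0 < c ∧ c ≤ C ∧ 0 ≤ L ∧ ∀ t < n,
      (∀ x₁ x₂, c ≤ M.g (M.y (t + 1)) (M.y t) x₁ x₂ ∧ M.g (M.y (t + 1)) (M.y t) x₁ x₂ ≤ C) ∧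
      ∀ x₁ x₂ x₁' x₂', |M.g (M.y (t + 1)) (M.y t) x₁ x₂ - M.g (M.y (t + 1)) (M.y t) x₁' x₂'| ≤
        L * (|x₁ - x₁'| + |x₂ - x₂'|) := by
  induction n with
  | zero => exact ⟨1, 1, 0, one_pos, le_rfl, le_rfl, fun t ht => absurd ht (Nat.not_lt_zero t)⟩
  | succ n ih =>
    obtain ⟨c, C, L, hc, hcC, hL, ih⟩ := ih
    obtain ⟨c', C', hc', hcC', hb⟩ := h.g_bdd (M.y (n + 1)) (M.y n)
    obtain ⟨L', hL'⟩ := h.g_lip (M.y (n + 1)) (M.y n)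
    refine ⟨min c c', max C C', max L L', lt_min hc hc',
      (min_le_left _ _).trans (hcC.trans (le_max_left _ _)), hL.trans (le_max_left _ _),
      fun t ht => ?_⟩
    rcases Nat.lt_succ_iff_lt_or_eq.1 ht with ht | rfl
    · refine ⟨fun x₁ x₂ => ⟨(min_le_left _ _).trans ((ih t ht).1 x₁ x₂).1,
        ((ih t ht).1 x₁ x₂).2.trans (le_max_left _ _)⟩, fun x₁ x₂ x₁' x₂' =>
        ((ih t ht).2 x₁ x₂ x₁' x₂').trans ?_⟩
      gcongr
      exact le_max_left _ _
    · refine ⟨fun x₁ x₂ => ⟨(min_le_right _ _).trans (hb x₁ x₂).1,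
        (hb x₁ x₂).2.trans (le_max_right _ _)⟩, fun x₁ x₂ x₁' x₂' =>
        (hL' x₁ x₂ x₁' x₂').trans ?_⟩
      gcongr
      exact le_max_right _ _

lemma LikelihoodRegular.continuous_g (h : M.LikelihoodRegular) (y y' : Y) :
    Continuous fun p : ℝ × ℝ => M.g y y' p.1 p.2 := by
  obtain ⟨C, hC⟩ := h.g_lip y y'
  refine (LipschitzWith.of_dist_le' (K := 2 * |C|) fun p q => ?_).continuous
  rw [Real.dist_eq]
  refine (hC _ _ _ _).trans ?_
  have h1 : |p.1 - q.1| ≤ dist p q := by rw [← Real.dist_eq]; exact le_max_left _ _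
  have h2 : |p.2 - q.2| ≤ dist p q := by rw [← Real.dist_eq]; exact le_max_right _ _
  calc C * (|p.1 - q.1| + |p.2 - q.2|) ≤ |C| * (dist p q + dist p q) := by
        gcongr; exact le_abs_self C
    _ = _ := by ring

lemma measurable_lik {H : ℝ} (hM : M.Standing H) (h : M.LikelihoodRegular) (l t : ℕ) :
    Measurable fun p : Θ × (ℕ → ℝ) => M.lik l p.1 p.2 t := by
  have he := fun k => measurable_euler hM.b_measurable hM.σ_measurable l k
  obtain ⟨_, hf⟩ := h.f_lip
  obtain ⟨_, hh⟩ := h.h_lip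
  refine (h.continuous_g _ _).measurable.comp (Measurable.prodMk ?_ ?_)
  · exact (Finset.measurable_fun_sum _ fun k _ =>
      hf.continuous.measurable.comp (he _)).const_mul _
  · refine Finset.measurable_fun_sum (Finset.range (2 ^ l)) fun k _ => ?_
    exact (hh.continuous.measurable.comp (he (t * 2 ^ l + k))).mul
      ((measurable_pi_apply (t * 2 ^ l + k)).comp measurable_snd)

lemma dependsOn_lik (l : ℕ) (θ : Θ) (t : ℕ) :
    DependsOn (fun w => M.lik l θ w t) (Set.Iio ((t + 1) * 2 ^ l)) := by
  intro x y hxy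
  have h1 : ∀ k ∈ Finset.range (2 ^ l),
      M.euler l θ x (t * 2 ^ l + k) = M.euler l θ y (t * 2 ^ l + k) := fun k hk =>
    M.dependsOn_euler l θ _ fun i hi => hxy i (by
      have := Finset.mem_range.1 hk
      simp only [Set.mem_Iio] at hi ⊢
      rw [add_mul, one_mul]; omega)
  have h2 : ∀ k ∈ Finset.range (2 ^ l), x (t * 2 ^ l + k) = y (t * 2 ^ l + k) := fun k hk =>
    hxy _ (by
      have := Finset.mem_range.1 hk
      simp only [Set.mem_Iio]
      rw [add_mul, one_mul]; omega)
  simp only [lik]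
  congr 1
  · congr 1
    exact Finset.sum_congr rfl fun k hk => by rw [h1 k hk]
  · exact Finset.sum_congr rfl fun k hk => by rw [h1 k hk, h2 k hk]

/-- The mean square distance of the coupled likelihood factors of consecutive levels. -/
lemma exists_msq_lik_sub_le {H β : ℝ} (hM : M.Standing H) (h : M.LikelihoodRegular) {C : ℝ≥0}
    (hC : ∀ (l : ℕ) (θ : Θ), ∀ k ≤ M.T * 2 ^ (l + 1),
      msq (l + 1) (fun w => M.euler (l + 1) θ w k - M.euler l θ (coarsen w) (k / 2)) ≤
        C * ENNReal.ofReal ((stepSize (l + 1) : ℝ) ^ (2 * β))) :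
    ∃ C' : ℝ≥0, ∀ (l : ℕ) (θ : Θ), ∀ t < M.T,
      msq (l + 1) (fun w => M.lik (l + 1) θ w t - M.lik l θ (coarsen w) t) ≤
        C' * ENNReal.ofReal ((stepSize (l + 1) : ℝ) ^ (2 * β)) := by
  obtain ⟨_, _, L, _, _, _, hg⟩ := h.exists_bounds M.T
  obtain ⟨Lf, hf⟩ := h.f_lip
  obtain ⟨Lh, hh⟩ := h.h_lip
  refine ⟨(L ^ 2).toNNReal * (2 * (Lf ^ 2 * C + Lh ^ 2 * C)), fun l θ t ht => ?_⟩
  set ε := ENNReal.ofReal ((stepSize (l + 1) : ℝ) ^ (2 * β))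
  set n := 2 ^ (l + 1)
  -- The coarse path is held constant over the two fine steps of a coarse step, so sums of level l
  -- become sums over the fine grid.
  set Z : ((ℝ → ℝ)) → ℕ → (ℕ → ℝ) → ℝ := fun f j w =>
    f (M.euler (l + 1) θ w j) - f (M.euler l θ (coarsen w) (j / 2))
  have hme : ∀ l k, Measurable fun w : ℕ → ℝ => M.euler l θ w k := fun l k =>
    measurable_euler_right hM.b_measurable hM.σ_measurable l k θ
  have hZm : ∀ {f : ℝ → ℝ}, Measurable f → ∀ j, Measurable (Z f j) := fun hf j =>
    (hf.comp (hme _ _)).sub (hf.comp ((hme _ _).comp measurable_coarsen))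
  have hZ : ∀ {f : ℝ → ℝ} {K : ℝ≥0}, LipschitzWith K f → ∀ k ∈ Finset.range n,
      msq (l + 1) (Z f (t * n + k)) ≤ K ^ 2 * C * ε := by
    intro f K hf k hk
    have hj : t * n + k ≤ M.T * n := by
      have := Finset.mem_range.1 hk
      calc t * n + k ≤ t * n + n := by omega
        _ = (t + 1) * n := by ring
        _ ≤ M.T * n := Nat.mul_le_mul_right _ ht
    have h1 : msq (l + 1) (Z f (t * n + k)) ≤ msq (l + 1) fun w => (K : ℝ) *
        (M.euler (l + 1) θ w (t * n + k) - M.euler l θ (coarsen w) ((t * n + k) / 2)) := by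
      refine msq_mono fun w => ?_
      rw [abs_mul, abs_of_nonneg K.coe_nonneg, ← Real.dist_eq, ← Real.dist_eq]
      exact hf.dist_le_mul _ _
    refine h1.trans ?_
    rw [msq_const_mul, mul_assoc]
    refine mul_le_mul' (le_of_eq ?_) (hC l θ _ hj)
    rw [ENNReal.ofReal_pow K.coe_nonneg, ENNReal.ofReal_coe_nnreal]
  have hn2 : n = 2 * 2 ^ l := by simp only [n, pow_succ]; ring
  have htk : ∀ k, (t * n + 2 * k) / 2 = t * 2 ^ l + k ∧
      (t * n + (2 * k + 1)) / 2 = t * 2 ^ l + k := fun k => by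
    rw [hn2, show t * (2 * 2 ^ l) = 2 * (t * 2 ^ l) by ring]; omega
  -- the two arguments of the observation density
  have e₁ : ∀ w, stepSize (l + 1) * ∑ k ∈ Finset.range n, M.f (M.euler (l + 1) θ w (t * n + k)) -
      stepSize l * ∑ k ∈ Finset.range (2 ^ l), M.f (M.euler l θ (coarsen w) (t * 2 ^ l + k)) =
      (stepSize (l + 1) : ℝ) * ∑ k ∈ Finset.range n, Z M.f (t * n + k) w := by
    intro w
    simp only [Z, Finset.sum_sub_distrib, mul_sub]
    congr 1
    rw [hn2, sum_range_two_mul, ← hn2]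
    simp only [htk, stepSize_eq l, ← two_mul, ← Finset.mul_sum]
    push_cast
    ring
  -- Synchronous coupling: a coarse increment is the sum of two fine ones, and both multiply the
  -- same held value.
  have e₂ : ∀ w, ∑ k ∈ Finset.range n, M.h (M.euler (l + 1) θ w (t * n + k)) * w (t * n + k) -
      ∑ k ∈ Finset.range (2 ^ l), M.h (M.euler l θ (coarsen w) (t * 2 ^ l + k)) *
        coarsen w (t * 2 ^ l + k) =
      ∑ k ∈ Finset.range n, Z M.h (t * n + k) w * w (t * n + k) := by
    intro w
    simp only [Z, sub_mul, Finset.sum_sub_distrib]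
    congr 1
    conv_rhs => rw [hn2, sum_range_two_mul, ← hn2]
    refine Finset.sum_congr rfl fun k _ => ?_
    rw [(htk k).1, (htk k).2, coarsen, mul_add, hn2]
    congr 3 <;> ring
  have m₁ : msq (l + 1) (fun w => (stepSize (l + 1) : ℝ) *
      ∑ k ∈ Finset.range n, Z M.f (t * n + k) w) ≤ Lf ^ 2 * C * ε := by
    rw [msq_const_mul]
    refine (mul_le_mul' le_rfl ((msq_sum_le _ _ fun j => hZm hf.continuous.measurable _).trans
      (mul_le_mul' le_rfl (Finset.sum_le_sum fun k hk => hZ hf k hk)))).trans (le_of_eq ?_)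
    rw [Finset.sum_const, Finset.card_range, nsmul_eq_mul, ← mul_assoc, ← mul_assoc,
      ← ENNReal.ofReal_natCast, ← ENNReal.ofReal_mul (sq_nonneg _),
      ← ENNReal.ofReal_mul (by positivity)]
    have : (stepSize (l + 1) : ℝ) ^ 2 * n * n = 1 := by
      have h3 := two_pow_mul_stepSize (l + 1)
      calc (stepSize (l + 1) : ℝ) ^ 2 * n * n = (2 ^ (l + 1) * stepSize (l + 1)) ^ 2 := by
            simp only [n]; push_cast; ring
        _ = 1 := by rw [h3, one_pow]
    rw [this, ENNReal.ofReal_one, one_mul]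
  have m₂ : msq (l + 1) (fun w => ∑ k ∈ Finset.range n, Z M.h (t * n + k) w * w (t * n + k)) ≤
      Lh ^ 2 * C * ε := by
    -- The integrand is set to zero before the unit interval, so that the isometry, which starts at
    -- index 0, applies.
    set Z' : ℕ → (ℕ → ℝ) → ℝ := fun j => if t * n ≤ j then Z M.h j else fun _ => 0
    have hs : ∀ F : ℕ → ℝ≥0∞, (∀ j < t * n, F j = 0) → ∑ j ∈ Finset.range (t * n + n), F j =
        ∑ k ∈ Finset.range n, F (t * n + k) := by
      intro F hF
      rw [Finset.sum_range_add, Finset.sum_eq_zero fun j hj => hF j (Finset.mem_range.1 hj),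
        zero_add]
    have e : (fun w => ∑ k ∈ Finset.range n, Z M.h (t * n + k) w * w (t * n + k)) =
        fun w => ∑ j ∈ Finset.range (t * n + n), Z' j w * w j := by
      funext w
      rw [Finset.sum_range_add, Finset.sum_eq_zero (s := Finset.range (t * n)), zero_add]
      · exact Finset.sum_congr rfl fun k _ => by simp [Z']
      · intro j hj
        simp [Z', not_le.2 (Finset.mem_range.1 hj)]
    -- Rounding j/2 down preserves predictability: the held coarse value uses fine increments with
    -- index below 2⌊j/2⌋ ≤ j.
    have hdep : ∀ j, DependsOn (Z' j) (Set.Iio j) := by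
      intro j x y hxy
      simp only [Z']
      split_ifs with hj
      · have h1 : M.euler (l + 1) θ x j = M.euler (l + 1) θ y j := M.dependsOn_euler _ θ j hxy
        have h2 : M.euler l θ (coarsen x) (j / 2) = M.euler l θ (coarsen y) (j / 2) :=
          M.dependsOn_euler _ θ (j / 2) fun i hi => by
            have hi' := Set.mem_Iio.1 hi
            simp only [coarsen]
            rw [hxy (2 * i) (Set.mem_Iio.2 (by omega)), hxy (2 * i + 1) (Set.mem_Iio.2 (by omega))]
        simp only [Z, h1, h2]
      · rfl
    have hmeas : ∀ j, Measurable (Z' j) := by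
      intro j
      simp only [Z']
      split_ifs
      · exact hZm hh.continuous.measurable j
      · exact measurable_const
    rw [e, msq, lintegral_sq_sum_mul_noise _ hmeas hdep, hs]
    · have h1 : ∀ k ∈ Finset.range n, ∫⁻ w, ENNReal.ofReal (Z' (t * n + k) w ^ 2) ∂noise (l + 1) ≤
          Lh ^ 2 * C * ε := fun k hk => by simpa [Z', msq] using hZ hh k hk
      refine (mul_le_mul' le_rfl (Finset.sum_le_sum h1)).trans (le_of_eq ?_)
      · rw [Finset.sum_const, Finset.card_range, nsmul_eq_mul, ← mul_assoc]
        have : (stepSize (l + 1) : ℝ≥0∞) * (n : ℝ≥0∞) = 1 := by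
          rw [← ENNReal.ofReal_coe_nnreal, ← ENNReal.ofReal_natCast,
            ← ENNReal.ofReal_mul (stepSize _).coe_nonneg, mul_comm, ← ENNReal.ofReal_one]
          congr 1
          simp only [n]
          push_cast
          exact two_pow_mul_stepSize (l + 1)
        rw [this, one_mul]
    · intro j hj
      simp [Z', not_le.2 hj]
  have h1 : msq (l + 1) (fun w => M.lik (l + 1) θ w t - M.lik l θ (coarsen w) t) ≤
      msq (l + 1) (fun w => L * (|(stepSize (l + 1) : ℝ) *
        ∑ k ∈ Finset.range n, Z M.f (t * n + k) w| +
        |∑ k ∈ Finset.range n, Z M.h (t * n + k) w * w (t * n + k)|)) := by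
    refine msq_mono fun w => ?_
    rw [← e₁, ← e₂]
    exact ((hg t ht).2 _ _ _ _).trans (le_abs_self _)
  have hm₁ : Measurable fun w => |(stepSize (l + 1) : ℝ) *
      ∑ k ∈ Finset.range n, Z M.f (t * n + k) w| :=
    measurable_norm.comp ((Finset.measurable_fun_sum _ fun k _ =>
      hZm hf.continuous.measurable _).const_mul _)
  have habs : ∀ F : (ℕ → ℝ) → ℝ, msq (l + 1) (fun w => |F w|) = msq (l + 1) F := fun F => by
    simp [msq]
  refine h1.trans ?_
  rw [msq_const_mul]
  refine (mul_le_mul' le_rfl (msq_add_le _ hm₁)).trans ?_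
  rw [habs, habs]
  refine (mul_le_mul' le_rfl (mul_le_mul' le_rfl (add_le_add m₁ m₂))).trans (le_of_eq ?_)
  push_cast
  change _ = ENNReal.ofReal _ * _ * _
  ring

end Model

/-! ### Counting identities for resampling -/

/-- Exchanging the new value with the overwritten one is an involution of the pairs (a, b). This is
the counting-measure analogue of resampling a coordinate, with the number of values in place of a
total mass one. -/
lemma sum_update {ι B A : Type*} [Fintype ι] [DecidableEq ι] [Fintype B] [CommSemiring A]
    (i : ι) (f : (ι → B) → A) :
    ∑ a : ι → B, ∑ b : B, f (Function.update a i b) = Fintype.card B * ∑ a : ι → B, f a := by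
  have e : ∑ p : (ι → B) × B, f (Function.update p.1 i p.2) = ∑ p : (ι → B) × B, f p.1 := by
    have hinv : Function.Involutive
        fun p : (ι → B) × B => (Function.update p.1 i p.2, p.1 i) := fun p => by simp
    exact Fintype.sum_equiv hinv.toPerm _ _ fun p => rfl
  rw [Fintype.sum_prod_type] at e
  rw [e, Fintype.sum_prod_type]
  simp [Finset.mul_sum]

/-- The mean of a function of one coordinate under a product of copies of q: all other factors sum
to one. In the filter, q gives the resampling probabilities. -/
lemma sum_prod_mul_eval {ι J A : Type*} [Fintype ι] [DecidableEq ι] [Fintype J] [CommSemiring A]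
    {q : J → A} (hq : ∑ j, q j = 1) (x : J → A) (i : ι) :
    ∑ b : ι → J, (∏ k, q (b k)) * x (b i) = ∑ j, q j * x j := by
  have h := Finset.prod_univ_sum (fun _ : ι => (Finset.univ : Finset J))
    (fun k j => q j * if k = i then x j else 1)
  rw [Fintype.piFinset_univ] at h
  have h1 : ∀ b : ι → J, ∏ k, (q (b k) * if k = i then x (b k) else 1) =
      (∏ k, q (b k)) * x (b i) := fun b => by
    rw [Finset.prod_mul_distrib]; simp
  simp_rw [h1] at h
  rw [← h, Finset.prod_eq_single i]
  · simp
  · intro k _ hk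
    simp [hk, hq]
  · simp

namespace Model

variable {Θ Y : Type*} [MeasurableSpace Θ] {M : Model Θ Y} {l : ℕ}

/-! ### The particles -/

lemma innov_eq_extend (u : M.Innovations l) {t : ℕ} (ht : t < M.T) (i : Fin M.N) :
    innov u t i = extend (u ⟨t, ht⟩ i) := by
  funext k
  by_cases hk : k < 2 ^ l <;> simp [innov, extend, ht, hk]

lemma particle_zero (u : M.Innovations l) (a : M.Ancestors) (hT : 0 < M.T) (i : Fin M.N) :
    particle u a 0 i = extend (u ⟨0, hT⟩ i) := by
  rw [particle, innov_eq_extend u hT]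

lemma particle_succ (u : M.Innovations l) (a : M.Ancestors) {t : ℕ} (ht : t + 1 < M.T)
    (i : Fin M.N) : particle u a (t + 1) i =
      append ((t + 1) * 2 ^ l) (particle u a t (parent a t i)) (extend (u ⟨t + 1, ht⟩ i)) := by
  rw [particle, innov_eq_extend u ht]
  rfl

/-- Causality: particles up to time t are built before the innovations at t + 1 and the ancestors
drawn at t. -/
lemma particle_update (u : M.Innovations l) (a : M.Ancestors) {t : ℕ} (ht : t + 1 < M.T)
    (v : Fin M.N → Fin (2 ^ l) → ℝ) (b : Fin M.N → Fin M.N) {s : ℕ} (hs : s ≤ t) :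
    particle (Function.update u ⟨t + 1, ht⟩ v) (Function.update a ⟨t, by omega⟩ b) s =
      particle u a s := by
  induction s with
  | zero =>
    funext i
    rw [particle_zero _ _ (by omega), particle_zero _ _ (by omega),
      Function.update_of_ne (by simp [Fin.ext_iff])]
  | succ s ih =>
    funext i
    rw [particle_succ _ _ (by omega), particle_succ _ _ (by omega), ih (by omega),
      Function.update_of_ne (by simp [Fin.ext_iff]; omega)]
    congr 2
    simp only [parent]
    rw [dif_pos (by omega), dif_pos (by omega), Function.update_of_ne (by simp [Fin.ext_iff]; omega)]

lemma parent_update_of_lt (a : M.Ancestors) {t : ℕ} (ht : t < M.T - 1) (b : Fin M.N → Fin M.N)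
    {s : ℕ} (hs : s < t) : parent (Function.update a ⟨t, ht⟩ b) s = parent a s := by
  funext i
  simp only [parent]
  rw [dif_pos (by omega), dif_pos (by omega), Function.update_of_ne (by simp [Fin.ext_iff]; omega)]

lemma measurable_particle (a : M.Ancestors) {t : ℕ} (ht : t < M.T) (i : Fin M.N) :
    Measurable fun u : M.Innovations l => particle u a t i := by
  induction t generalizing i with
  | zero =>
    simp_rw [particle_zero _ a ht]
    exact measurable_extend.comp ((measurable_pi_apply i).comp (measurable_pi_apply _))
  | succ t ih =>
    simp_rw [particle_succ _ a ht]
    exact (measurable_append _).comp ((ih (by omega) _).prodMk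
      (measurable_extend.comp ((measurable_pi_apply i).comp (measurable_pi_apply _))))

/-! ### Unbiasedness of the particle filter -/

section Unbiased

/-- The law of the innovations of one particle in one unit interval. -/
noncomputable abbrev blockMeasure (l : ℕ) : Measure (Fin (2 ^ l) → ℝ) :=
  Measure.pi fun _ => gaussianReal 0 (stepSize l)

/-- The law of the innovations. -/
noncomputable abbrev innovMeasure (M : Model Θ Y) (l : ℕ) : Measure (M.Innovations l) :=
  Measure.pi fun _ => Measure.pi fun _ => blockMeasure l

variable (g : ℕ → (ℕ → ℝ) → ℝ≥0∞)

/-- The sum of the weights of the particles at time `t`. -/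
noncomputable def totalWeight (u : M.Innovations l) (a : M.Ancestors) (t : ℕ) : ℝ≥0∞ :=
  ∑ i, g t (particle u a t i)

/-- The normalizing constant estimate at time `t` times the probability of the ancestors drawn
at time `t`. -/
noncomputable def stepFactor (u : M.Innovations l) (a : M.Ancestors) (t : ℕ) : ℝ≥0∞ :=
  (M.N : ℝ≥0∞)⁻¹ * totalWeight g u a t *
    ∏ i, (g t (particle u a t (parent a t i)) / totalWeight g u a t)

/-- The weighted empirical measure at time `t`, weighted by the past of the filter. -/
noncomputable def filterFunctional (t : ℕ) (Φ : (ℕ → ℝ) → ℝ≥0∞) (u : M.Innovations l)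
    (a : M.Ancestors) : ℝ≥0∞ :=
  (∏ s ∈ Finset.range t, stepFactor g u a s) *
    ((M.N : ℝ≥0∞)⁻¹ * ∑ i, g t (particle u a t i) * Φ (particle u a t i))

variable {g}

lemma measurable_totalWeight (hg : ∀ t, Measurable (g t)) (a : M.Ancestors) {t : ℕ} (ht : t < M.T) :
    Measurable fun u : M.Innovations l => totalWeight g u a t :=
  Finset.measurable_fun_sum _ fun i _ => (hg t).comp (measurable_particle a ht i)

lemma measurable_filterFunctional (hg : ∀ t, Measurable (g t)) {Φ : (ℕ → ℝ) → ℝ≥0∞}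
    (hΦ : Measurable Φ) (a : M.Ancestors) {t : ℕ} (ht : t < M.T) :
    Measurable fun u : M.Innovations l => filterFunctional g t Φ u a := by
  refine Measurable.mul (Finset.measurable_fun_prod _ fun s hs => ?_) ?_
  · have hs' : s < M.T := (Finset.mem_range.1 hs).trans ht
    exact ((measurable_totalWeight hg a hs').const_mul _).mul
      (Finset.measurable_fun_prod _ fun i _ =>
        ((hg s).comp (measurable_particle a hs' _)).div (measurable_totalWeight hg a hs'))
  · exact (Finset.measurable_fun_sum _ fun i _ => ((hg t).comp (measurable_particle a ht i)).mul
      (hΦ.comp (measurable_particle a ht i))).const_mul _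

lemma totalWeight_ne_zero (hN : 1 ≤ M.N) (hg0 : ∀ t w, g t w ≠ 0) (u : M.Innovations l)
    (a : M.Ancestors) (t : ℕ) : totalWeight g u a t ≠ 0 := fun h =>
  hg0 t _ (Finset.sum_eq_zero_iff.1 h ⟨0, hN⟩ (Finset.mem_univ _))

lemma totalWeight_ne_top (hg1 : ∀ t w, g t w ≠ ∞) (u : M.Innovations l)
    (a : M.Ancestors) (t : ℕ) : totalWeight g u a t ≠ ∞ :=
  ENNReal.sum_ne_top.2 fun _ _ => hg1 _ _

lemma lintegral_innov_eval (t : Fin M.T) (i : Fin M.N) {F : (Fin (2 ^ l) → ℝ) → ℝ≥0∞}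
    (hF : Measurable F) : ∫⁻ u, F (u t i) ∂M.innovMeasure l = ∫⁻ x, F x ∂blockMeasure l := by
  have h1 := (measurePreserving_eval (fun _ : Fin M.T =>
    Measure.pi fun _ : Fin M.N => blockMeasure l) t).lintegral_comp
    (f := fun v => F (v i)) (hF.comp (measurable_pi_apply i))
  have h2 := (measurePreserving_eval (fun _ : Fin M.N => blockMeasure l) i).lintegral_comp hF
  exact h1.trans h2

/-- One step of the particle filter: the innovations and the ancestors drawn last are integrated
out. -/
lemma lintegral_sum_filterFunctional_succ (hN : 1 ≤ M.N) (hg : ∀ t, Measurable (g t))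
    (hg0 : ∀ t w, g t w ≠ 0) (hg1 : ∀ t w, g t w ≠ ∞) {Φ : (ℕ → ℝ) → ℝ≥0∞} (hΦ : Measurable Φ)
    {t : ℕ} (ht : t + 1 < M.T) :
    (Fintype.card (Fin M.N → Fin M.N) : ℝ≥0∞) *
      ∫⁻ u, ∑ a : M.Ancestors, filterFunctional g (t + 1) Φ u a ∂M.innovMeasure l =
    ∫⁻ u, ∑ a : M.Ancestors, filterFunctional g t (fun w => ∫⁻ x,
      g (t + 1) (append ((t + 1) * 2 ^ l) w (extend x)) *
        Φ (append ((t + 1) * 2 ^ l) w (extend x)) ∂blockMeasure l) u a ∂M.innovMeasure l := by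
  set Ψ : (ℕ → ℝ) → (Fin (2 ^ l) → ℝ) → ℝ≥0∞ := fun w x =>
      g (t + 1) (append ((t + 1) * 2 ^ l) w (extend x)) *
        Φ (append ((t + 1) * 2 ^ l) w (extend x))
  have hΨ : ∀ w, Measurable (Ψ w) := fun w => by
    have h1 : Measurable fun x : Fin (2 ^ l) → ℝ => append ((t + 1) * 2 ^ l) w (extend x) :=
      (measurable_append _).comp (measurable_const.prodMk measurable_extend)
    exact ((hg _).comp h1).mul (hΦ.comp h1)
  have hmeas := fun a => measurable_filterFunctional (l := l) hg hΦ a ht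
  rw [← lintegral_const_mul _ (Finset.measurable_fun_sum _ fun a _ => hmeas a)]
  have ht1 : t < M.T - 1 := by omega
  -- The ancestors drawn at time t are resummed separately, which uses up the cardinality factor.
  simp_rw [← sum_update (⟨t, ht1⟩ : Fin (M.T - 1))]
  rw [lintegral_pi_update _ (⟨t + 1, ht⟩ : Fin M.T) (Finset.measurable_fun_sum _ fun a _ =>
    Finset.measurable_fun_sum _ fun b _ => hmeas _)]
  refine lintegral_congr fun u => ?_
  have hup : ∀ a b, Measurable fun v => filterFunctional g (t + 1) Φ
      (Function.update u ⟨t + 1, ht⟩ v) (Function.update a ⟨t, ht1⟩ b) := fun a b =>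
    (hmeas _).comp (measurable_update u)
  rw [lintegral_finsetSum _ fun a _ => Finset.measurable_fun_sum _ fun b _ => hup a b]
  refine Finset.sum_congr rfl fun a _ => ?_
  rw [lintegral_finsetSum _ fun b _ => hup a b]
  set S := totalWeight g u a t
  have hS0 : S ≠ 0 := totalWeight_ne_zero hN hg0 u a t
  have hS1 : S ≠ ∞ := totalWeight_ne_top hg1 u a t
  set q : Fin M.N → ℝ≥0∞ := fun j => g t (particle u a t j) / S
  have hq : ∑ j, q j = 1 := by
    simp only [q, div_eq_mul_inv]
    rw [← Finset.sum_mul]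
    exact ENNReal.mul_inv_cancel hS0 hS1
  set R := ∏ s ∈ Finset.range t, stepFactor g u a s
  -- By causality the past factor R, the total weight S and the particles at t are constant in (b,
  -- v); only the resampling probabilities and the new blocks vary.
  have hval : ∀ (b : Fin M.N → Fin M.N) (v : Fin M.N → Fin (2 ^ l) → ℝ),
      filterFunctional g (t + 1) Φ (Function.update u ⟨t + 1, ht⟩ v)
        (Function.update a ⟨t, ht1⟩ b) =
      R * ((M.N : ℝ≥0∞)⁻¹ * S * ∏ i, q (b i)) *
        ((M.N : ℝ≥0∞)⁻¹ * ∑ i, Ψ (particle u a t (b i)) (v i)) := by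
    intro b v
    have hp : ∀ s ≤ t, particle (Function.update u ⟨t + 1, ht⟩ v)
        (Function.update a ⟨t, ht1⟩ b) s = particle u a s := fun s hs =>
      particle_update u a ht v b hs
    have hpar : ∀ i, parent (Function.update a ⟨t, ht1⟩ b) t i = b i := fun i => by
      simp only [parent]; rw [dif_pos ht1, Function.update_self]
    simp only [filterFunctional]
    rw [Finset.prod_range_succ]
    congr 1
    · congr 1
      · refine Finset.prod_congr rfl fun s hs => ?_
        have hs' := Finset.mem_range.1 hs
        simp only [stepFactor, totalWeight, hp s hs'.le, parent_update_of_lt a ht1 b hs']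
      · simp only [stepFactor, totalWeight, hp t le_rfl, hpar]
        rfl
    · congr 1
      refine Finset.sum_congr rfl fun i _ => ?_
      rw [particle_succ _ _ ht, hp t le_rfl, hpar, Function.update_self]
  have hint : ∀ b : Fin M.N → Fin M.N,
      ∫⁻ v, filterFunctional g (t + 1) Φ (Function.update u ⟨t + 1, ht⟩ v)
        (Function.update a ⟨t, ht1⟩ b) ∂(Measure.pi fun _ => blockMeasure l) =
      R * ((M.N : ℝ≥0∞)⁻¹ * S) * (M.N : ℝ≥0∞)⁻¹ *
        ∑ i, (∏ k, q (b k)) * ∫⁻ x, Ψ (particle u a t (b i)) x ∂blockMeasure l := by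
    intro b
    have hv : ∀ i, Measurable fun v : Fin M.N → Fin (2 ^ l) → ℝ =>
        Ψ (particle u a t (b i)) (v i) := fun i => (hΨ _).comp (measurable_pi_apply i)
    simp_rw [hval]
    rw [lintegral_const_mul _ ((Finset.measurable_fun_sum _ fun i _ => hv i).const_mul _),
      lintegral_const_mul _ (Finset.measurable_fun_sum _ fun i _ => hv i),
      lintegral_finsetSum _ fun i _ => hv i, ← Finset.mul_sum]
    have h2 : ∀ i, ∫⁻ v, Ψ (particle u a t (b i)) (v i)
        ∂(Measure.pi fun _ : Fin M.N => blockMeasure l) =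
        ∫⁻ x, Ψ (particle u a t (b i)) x ∂blockMeasure l := fun i =>
      (measurePreserving_eval (fun _ : Fin M.N => blockMeasure l) i).lintegral_comp (hΨ _)
    simp_rw [h2]
    ring
  simp_rw [hint]
  rw [← Finset.mul_sum, Finset.sum_comm]
  simp_rw [sum_prod_mul_eval hq (fun j => ∫⁻ x, Ψ (particle u a t j) x ∂blockMeasure l)]
  rw [Finset.sum_const, Finset.card_univ, Fintype.card_fin, nsmul_eq_mul, filterFunctional]
  have hN0 : (M.N : ℝ≥0∞) ≠ 0 := by
    have : M.N ≠ 0 := by omega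
    exact_mod_cast this
  have hNN : (M.N : ℝ≥0∞)⁻¹ * M.N = 1 := ENNReal.inv_mul_cancel hN0 (ENNReal.natCast_ne_top _)
  -- The factor S of the normalizing constant cancels the normalization of the resampling weights;
  -- this cancellation is the source of unbiasedness.
  have hSq : S * ∑ j, q j * ∫⁻ x, Ψ (particle u a t j) x ∂blockMeasure l =
      ∑ j, g t (particle u a t j) * ∫⁻ x, Ψ (particle u a t j) x ∂blockMeasure l := by
    rw [Finset.mul_sum]
    refine Finset.sum_congr rfl fun j _ => ?_
    rw [← mul_assoc]
    congr 1
    exact ENNReal.mul_div_cancel hS0 hS1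
  calc _ = R * ((M.N : ℝ≥0∞)⁻¹ * (S * ∑ j, q j *
        ∫⁻ x, Ψ (particle u a t j) x ∂blockMeasure l)) * ((M.N : ℝ≥0∞)⁻¹ * M.N) := by ring
    _ = _ := by rw [hNN, mul_one, hSq]

/-- Backward Feynman–Kac induction: the last weight and mutation are absorbed into the test
function, hence the generality in Φ. The functional at time t ignores the T - 1 - t ancestor maps
drawn from time t on, so the unrestricted sum overcounts by that power of the number of maps; the
powers on both sides record this without division and agree at t = T - 1. -/
lemma lintegral_sum_filterFunctional (hN : 1 ≤ M.N) (hg : ∀ t, Measurable (g t))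
    (hg0 : ∀ t w, g t w ≠ 0) (hg1 : ∀ t w, g t w ≠ ∞)
    (hloc : ∀ t, DependsOn (g t) (Set.Iio ((t + 1) * 2 ^ l))) {t : ℕ} (ht : t < M.T)
    {Φ : (ℕ → ℝ) → ℝ≥0∞} (hΦ : Measurable Φ) :
    (Fintype.card (Fin M.N → Fin M.N) : ℝ≥0∞) ^ t *
      ∫⁻ u, ∑ a : M.Ancestors, filterFunctional g t Φ u a ∂M.innovMeasure l =
    (Fintype.card (Fin M.N → Fin M.N) : ℝ≥0∞) ^ (M.T - 1) *
      ∫⁻ w, (∏ s ∈ Finset.range (t + 1), g s (trunc ((t + 1) * 2 ^ l) w)) *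
        Φ (trunc ((t + 1) * 2 ^ l) w) ∂noise l := by
  induction t generalizing Φ with
  | zero =>
    have hN0 : (M.N : ℝ≥0∞) ≠ 0 := by
      have : M.N ≠ 0 := by omega
      exact_mod_cast this
    have hNN : (M.N : ℝ≥0∞)⁻¹ * M.N = 1 :=
      ENNReal.inv_mul_cancel hN0 (ENNReal.natCast_ne_top _)
    have hF : Measurable fun w => g 0 w * Φ w := (hg 0).mul hΦ
    simp only [filterFunctional, Finset.range_zero, Finset.prod_empty, one_mul, pow_zero,
      particle_zero _ _ ht, Finset.sum_const, Finset.card_univ, nsmul_eq_mul, zero_add,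
      Finset.range_one, Finset.prod_singleton]
    have hm : ∀ i : Fin M.N, Measurable fun u : M.Innovations l =>
        g 0 (extend (u ⟨0, ht⟩ i)) * Φ (extend (u ⟨0, ht⟩ i)) := fun i =>
      hF.comp (measurable_extend.comp ((measurable_pi_apply i).comp (measurable_pi_apply _)))
    rw [lintegral_const_mul _ ((Finset.measurable_fun_sum _ fun i _ => hm i).const_mul _),
      lintegral_const_mul _ (Finset.measurable_fun_sum _ fun i _ => hm i),
      lintegral_finsetSum _ fun i _ => hm i]
    have h1 : ∀ i : Fin M.N, ∫⁻ u, g 0 (extend (u ⟨0, ht⟩ i)) * Φ (extend (u ⟨0, ht⟩ i))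
        ∂M.innovMeasure l = ∫⁻ w, g 0 (trunc (2 ^ l) w) * Φ (trunc (2 ^ l) w) ∂noise l := by
      intro i
      rw [lintegral_innov_eval ⟨0, ht⟩ i (F := fun x => g 0 (extend x) * Φ (extend x))
        (hF.comp measurable_extend), lintegral_pi_extend l _ hF]
    simp_rw [h1]
    rw [Finset.sum_const, Finset.card_univ, Fintype.card_fin, nsmul_eq_mul, ← mul_assoc (_⁻¹),
      hNN, one_mul]
    congr 1
    simp
  | succ t ih =>
    have hj : Measurable fun p : (ℕ → ℝ) × (Fin (2 ^ l) → ℝ) =>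
        append ((t + 1) * 2 ^ l) p.1 (extend p.2) :=
      (measurable_append _).comp (measurable_fst.prodMk (measurable_extend.comp measurable_snd))
    have hjm : Measurable fun p : (ℕ → ℝ) × (Fin (2 ^ l) → ℝ) =>
        g (t + 1) (append ((t + 1) * 2 ^ l) p.1 (extend p.2)) *
          Φ (append ((t + 1) * 2 ^ l) p.1 (extend p.2)) :=
      ((hg _).comp hj).mul (hΦ.comp hj)
    rw [pow_succ, mul_assoc, lintegral_sum_filterFunctional_succ hN hg hg0 hg1 hΦ ht,
      ih (by omega) hjm.lintegral_prod_right']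
    congr 1
    have hF : Measurable fun w => (∏ s ∈ Finset.range (t + 1 + 1), g s w) * Φ w :=
      (Finset.measurable_fun_prod _ fun s _ => hg s).mul hΦ
    have h2 := lintegral_append l ((t + 1) * 2 ^ l) (2 ^ l) hF
    rw [show (t + 1) * 2 ^ l + 2 ^ l = (t + 1 + 1) * 2 ^ l by ring] at h2
    rw [← h2]
    refine lintegral_congr fun w => ?_
    refine (lintegral_const_mul _ (hjm.comp measurable_prodMk_left)).symm.trans ?_
    refine lintegral_congr fun x => ?_
    rw [Finset.prod_range_succ _ (t + 1), mul_assoc]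
    congr 1
    -- Earlier weights depend only on increments before the attached block.
    refine Finset.prod_congr rfl fun s hs => hloc s fun j hj => ?_
    have hs' := Finset.mem_range.1 hs
    have : j < (t + 1) * 2 ^ l :=
      lt_of_lt_of_le (Set.mem_Iio.1 hj) (Nat.mul_le_mul_right _ (by omega))
    simp [append, this]

end Unbiased

end Model

/-! ### Detailed balance and reversibility -/

/-- A Metropolis–Hastings kernel is reversible as soon as its accepted moves satisfy detailed
balance. -/
lemma isReversible_of_detailed_balance {S : Type*} [MeasurableSpace S] {κ : Kernel S S}
    {ref : Measure S} [SFinite ref] {τ : S → ℝ≥0∞} {d : S → S → ℝ≥0∞} {r : S → ℝ≥0∞}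
    (hτ : Measurable τ) (hd : Measurable (Function.uncurry d))
    (hκ : ∀ x, κ x = ref.withDensity (d x) + r x • Measure.dirac x)
    (hbal : ∀ x y, τ x * d x y = τ y * d y x) :
    κ.IsReversible (ref.withDensity τ) := by
  have hdx : ∀ x, Measurable (d x) := fun x => hd.comp measurable_prodMk_left
  set χ : Set S → S → ℝ≥0∞ := fun A => A.indicator 1
  have hχ : ∀ {A}, MeasurableSet A → Measurable (χ A) := fun hA => measurable_one.indicator hA
  -- The flow from A to B splits into accepted moves, symmetric by detailed balance, and the holding
  -- part, which lives on A ∩ B and is symmetric for any holding mass r.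
  have key : ∀ A B, MeasurableSet A → MeasurableSet B →
      ∫⁻ x in A, κ x B ∂ref.withDensity τ =
        (∫⁻ x, ∫⁻ y, χ A x * χ B y * (τ x * d x y) ∂ref ∂ref) +
          ∫⁻ x, τ x * r x * (χ A x * χ B x) ∂ref := by
    intro A B hA hB
    have hκB : Measurable fun x => κ x B := κ.measurable_coe hB
    have hm : Measurable fun p : S × S => χ A p.1 * χ B p.2 * (τ p.1 * d p.1 p.2) :=
      (((hχ hA).comp measurable_fst).mul ((hχ hB).comp measurable_snd)).mul
        ((hτ.comp measurable_fst).mul hd)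
    have hI : Measurable fun x => ∫⁻ y, χ A x * χ B y * (τ x * d x y) ∂ref :=
      hm.lintegral_prod_right'
    rw [setLIntegral_withDensity_eq_setLIntegral_mul _ hτ hκB hA, ← lintegral_indicator hA,
      ← lintegral_add_left hI]
    refine lintegral_congr fun x => ?_
    have h1 : κ x B = (∫⁻ y, χ B y * d x y ∂ref) + r x * χ B x := by
      rw [hκ, Measure.add_apply, withDensity_apply _ hB, Measure.smul_apply, smul_eq_mul,
        Measure.dirac_apply' _ hB, ← lintegral_indicator hB]
      congr 1
      refine lintegral_congr fun y => ?_
      by_cases hy : y ∈ B <;> simp [χ, hy]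
    have h2 : ∫⁻ y, χ A x * χ B y * (τ x * d x y) ∂ref =
        χ A x * τ x * ∫⁻ y, χ B y * d x y ∂ref := by
      have hm : Measurable fun y => χ B y * d x y := (hχ hB).mul (hdx x)
      rw [← lintegral_const_mul _ hm]
      exact lintegral_congr fun y => by ring
    have h3 : A.indicator (τ * fun x => κ x B) x = χ A x * (τ x * κ x B) := by
      by_cases hx : x ∈ A <;> simp [χ, hx]
    rw [h2, h3, h1]
    ring
  intro A B hA hB
  rw [key A B hA hB, key B A hB hA]
  congr 1
  · have hm : Measurable (Function.uncurry fun x y => χ A x * χ B y * (τ x * d x y)) :=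
      (((hχ hA).comp measurable_fst).mul ((hχ hB).comp measurable_snd)).mul
        ((hτ.comp measurable_fst).mul hd)
    rw [lintegral_lintegral_swap hm.aemeasurable]
    refine lintegral_congr fun y => lintegral_congr fun x => ?_
    rw [hbal x y, mul_comm (χ A x)]
  · exact lintegral_congr fun x => by ring

namespace Model

variable {Θ Y : Type*} [MeasurableSpace Θ] {M : Model Θ Y} {l : ℕ}

/-! ### Likelihoods and weights -/

lemma lik_pos (h : M.LikelihoodRegular) (l : ℕ) (θ : Θ) (w : ℕ → ℝ) (t : ℕ) :
    0 < M.lik l θ w t := by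
  obtain ⟨c, C, hc, -, hb⟩ := h.g_bdd (M.y (t + 1)) (M.y t)
  exact hc.trans_le (hb _ _).1

lemma maxLik_pos (h : M.LikelihoodRegular) (l : ℕ) (θ : Θ) (w : ℕ → ℝ) (t : ℕ) :
    0 < M.maxLik l θ w t := lt_max_of_lt_left (lik_pos h l θ w t)

lemma measurable_maxLik {H : ℝ} (hM : M.Standing H) (h : M.LikelihoodRegular) (l t : ℕ) :
    Measurable fun p : Θ × (ℕ → ℝ) => M.maxLik l p.1 p.2 t :=
  (measurable_lik hM h l t).max ((measurable_lik hM h (l - 1) t).comp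
    (measurable_fst.prodMk (measurable_coarsen.comp measurable_snd)))

lemma dependsOn_lik_coarsen (l : ℕ) (θ : Θ) (t : ℕ) :
    DependsOn (fun w => M.lik l θ (coarsen w) t) (Set.Iio ((t + 1) * 2 ^ (l + 1))) := by
  intro x y hxy
  refine dependsOn_lik l θ t fun i hi => ?_
  have hi' := Set.mem_Iio.1 hi
  have e : (t + 1) * 2 ^ (l + 1) = 2 * ((t + 1) * 2 ^ l) := by ring
  simp only [coarsen]
  rw [hxy (2 * i) (Set.mem_Iio.2 (by omega)), hxy (2 * i + 1) (Set.mem_Iio.2 (by omega))]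

lemma dependsOn_maxLik (l : ℕ) (θ : Θ) (t : ℕ) :
    DependsOn (fun w => M.maxLik (l + 1) θ w t) (Set.Iio ((t + 1) * 2 ^ (l + 1))) := by
  intro x y hxy
  have h1 := dependsOn_lik (M := M) (l + 1) θ t hxy
  have h2 := dependsOn_lik_coarsen (M := M) l θ t hxy
  simp only at h1 h2
  simp only [maxLik, Nat.add_sub_cancel, h1, h2]

lemma weight_pos (h : M.LikelihoodRegular) (l : ℕ) (θ : Θ) (u : M.Innovations l)
    (a : M.Ancestors) (t : ℕ) (i : Fin M.N) : 0 < M.weight l θ u a t i := maxLik_pos h _ _ _ _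

lemma sum_weight_pos (h : M.LikelihoodRegular) (hN : 1 ≤ M.N) (l : ℕ) (θ : Θ)
    (u : M.Innovations l) (a : M.Ancestors) (t : ℕ) : 0 < ∑ i, M.weight l θ u a t i :=
  Finset.sum_pos (fun i _ => weight_pos h l θ u a t i) ⟨⟨0, hN⟩, Finset.mem_univ _⟩

lemma sum_normWeight (h : M.LikelihoodRegular) (hN : 1 ≤ M.N) (l : ℕ) (θ : Θ)
    (u : M.Innovations l) (a : M.Ancestors) (t : ℕ) : ∑ i, M.normWeight l θ u a t i = 1 := by
  simp only [normWeight]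
  rw [← Finset.sum_div, div_self (sum_weight_pos h hN l θ u a t).ne']

lemma normWeight_nonneg (h : M.LikelihoodRegular) (hN : 1 ≤ M.N) (l : ℕ) (θ : Θ)
    (u : M.Innovations l) (a : M.Ancestors) (t : ℕ) (i : Fin M.N) :
    0 ≤ M.normWeight l θ u a t i :=
  div_nonneg (weight_pos h l θ u a t i).le (sum_weight_pos h hN l θ u a t).le

lemma normConst_nonneg (h : M.LikelihoodRegular) (hN : 1 ≤ M.N) (l : ℕ) (θ : Θ)
    (u : M.Innovations l) (a : M.Ancestors) : 0 ≤ M.normConst l θ u a :=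
  Finset.prod_nonneg fun t _ =>
    mul_nonneg (by positivity) (sum_weight_pos h hN l θ u a t).le

lemma selectionProb_nonneg (h : M.LikelihoodRegular) (hN : 1 ≤ M.N) (l : ℕ) (θ : Θ)
    (u : M.Innovations l) (a : M.Ancestors) (k : Fin M.N) : 0 ≤ M.selectionProb l θ u a k :=
  mul_nonneg (Finset.prod_nonneg fun _ _ => Finset.prod_nonneg fun _ _ =>
    normWeight_nonneg h hN l θ u a _ _) (normWeight_nonneg h hN l θ u a _ _)

lemma prod_ancestors_eq (l : ℕ) (θ : Θ) (u : M.Innovations l) (a : M.Ancestors) :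
    ∏ t : Fin (M.T - 1), ∏ i, M.normWeight l θ u a t (a t i) =
      ∏ t ∈ Finset.range (M.T - 1), ∏ i, M.normWeight l θ u a t (parent a t i) := by
  rw [← Fin.prod_univ_eq_prod_range (fun t => ∏ i, M.normWeight l θ u a t (parent a t i))]
  refine Finset.prod_congr rfl fun t _ => Finset.prod_congr rfl fun i _ => ?_
  simp [parent, t.2]

/-- The selection probabilities sum to one. -/
lemma sum_selectionProb (h : M.LikelihoodRegular) (hN : 1 ≤ M.N) (l : ℕ) (θ : Θ)
    (u : M.Innovations l) : ∑ a, ∑ k, M.selectionProb l θ u a k = 1 := by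
  simp only [selectionProb, prod_ancestors_eq]
  simp_rw [← Finset.mul_sum, sum_normWeight h hN, mul_one]
  set c : ℝ := (Fintype.card (Fin M.N → Fin M.N) : ℝ)
  have hc : c ≠ 0 := by
    have : Nonempty (Fin M.N) := ⟨⟨0, hN⟩⟩
    simp only [c]
    exact_mod_cast Fintype.card_ne_zero
  -- As in the filter recursion, c^t compensates for the ancestor maps not yet involved; each step
  -- sums out the one drawn last.
  have key : ∀ t ≤ M.T - 1, c ^ t * ∑ a : M.Ancestors, ∏ s ∈ Finset.range t,
      ∏ i, M.normWeight l θ u a s (parent a s i) = c ^ (M.T - 1) := by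
    intro t
    induction t with
    | zero => simp [c]
    | succ t ih =>
      intro ht
      have ht1 : t < M.T - 1 := ht
      have ht2 : t + 1 < M.T := by omega
      rw [← ih (by omega), pow_succ, mul_assoc]
      congr 1
      rw [← sum_update (⟨t, ht1⟩ : Fin (M.T - 1))]
      refine Finset.sum_congr rfl fun a _ => ?_
      have hp : ∀ b, ∀ s ≤ t, particle u (Function.update a ⟨t, ht1⟩ b) s = particle u a s := by
        intro b s hs
        have := particle_update u a ht2 (u ⟨t + 1, ht2⟩) b hs
        rwa [Function.update_eq_self] at this
      have hw : ∀ b, ∀ s ≤ t, ∀ j, M.normWeight l θ u (Function.update a ⟨t, ht1⟩ b) s j =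
          M.normWeight l θ u a s j := fun b s hs j => by
        simp only [normWeight, weight, hp b s hs]
      have h1 : ∀ b : Fin M.N → Fin M.N, ∏ s ∈ Finset.range (t + 1),
          ∏ i, M.normWeight l θ u (Function.update a ⟨t, ht1⟩ b) s
            (parent (Function.update a ⟨t, ht1⟩ b) s i) =
          (∏ s ∈ Finset.range t, ∏ i, M.normWeight l θ u a s (parent a s i)) *
            ∏ i, M.normWeight l θ u a t (b i) := by
        intro b
        rw [Finset.prod_range_succ]
        congr 1
        · refine Finset.prod_congr rfl fun s hs => ?_
          have hs' := Finset.mem_range.1 hs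
          simp only [hw b s hs'.le, parent_update_of_lt a ht1 b hs']
        · refine Finset.prod_congr rfl fun i _ => ?_
          have : parent (Function.update a ⟨t, ht1⟩ b) t i = b i := by
            simp only [parent]; rw [dif_pos ht1, Function.update_self]
          rw [this, hw b t le_rfl]
      simp_rw [h1]
      rw [← Finset.mul_sum]
      have h2 := sum_prod_mul_eval (sum_normWeight h hN l θ u a t) (fun _ => (1 : ℝ)) (⟨0, hN⟩ : Fin M.N)
      simp only [mul_one, sum_normWeight h hN] at h2
      rw [h2, mul_one]
  have := key (M.T - 1) le_rfl
  exact mul_left_cancel₀ (pow_ne_zero _ hc) (this.trans (mul_one _).symm)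

/-! ### The law of the selected particle -/

/-- The weights of the filter as extended nonnegative reals. -/
noncomputable def maxLikENN (M : Model Θ Y) (l : ℕ) (θ : Θ) (t : ℕ) (w : ℕ → ℝ) : ℝ≥0∞ :=
  ENNReal.ofReal (M.maxLik l θ w t)

lemma totalWeight_maxLikENN (h : M.LikelihoodRegular) (l : ℕ) (θ : Θ) (u : M.Innovations l)
    (a : M.Ancestors) (t : ℕ) : totalWeight (M.maxLikENN l θ) u a t =
      ENNReal.ofReal (∑ i, M.weight l θ u a t i) := by
  rw [ENNReal.ofReal_sum_of_nonneg fun i _ => (weight_pos h l θ u a t i).le]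
  rfl

/-- The total weight at the final time cancels the denominator of the final selection, leaving the
unnormalised weighted empirical measure that the recursion handles. -/
lemma sum_normConst_mul_selectionProb (h : M.LikelihoodRegular) {H : ℝ} (hM : M.Standing H)
    (l : ℕ) (θ : Θ) (u : M.Innovations l) (a : M.Ancestors) (Φ : (ℕ → ℝ) → ℝ≥0∞) :
    ∑ k, ENNReal.ofReal (M.normConst l θ u a * M.selectionProb l θ u a k) *
        Φ (particle u a (M.T - 1) k) =
      filterFunctional (M.maxLikENN l θ) (M.T - 1) Φ u a := by
  have hN := hM.N_pos
  have hnw : ∀ t i, ENNReal.ofReal (M.normWeight l θ u a t i) =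
      M.maxLikENN l θ t (particle u a t i) / totalWeight (M.maxLikENN l θ) u a t := fun t i => by
    rw [totalWeight_maxLikENN h, normWeight,
      ENNReal.ofReal_div_of_pos (sum_weight_pos h hN l θ u a t)]
    rfl
  have hav : ∀ t, ENNReal.ofReal ((M.N : ℝ)⁻¹ * ∑ i, M.weight l θ u a t i) =
      (M.N : ℝ≥0∞)⁻¹ * totalWeight (M.maxLikENN l θ) u a t := fun t => by
    rw [totalWeight_maxLikENN h, ENNReal.ofReal_mul (by positivity),
      ENNReal.ofReal_inv_of_pos (by exact_mod_cast hN), ENNReal.ofReal_natCast]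
  have hS0 : ∀ t, totalWeight (M.maxLikENN l θ) u a t ≠ 0 := fun t => by
    rw [totalWeight_maxLikENN h]
    exact (ENNReal.ofReal_pos.2 (sum_weight_pos h hN l θ u a t)).ne'
  have hS1 : ∀ t, totalWeight (M.maxLikENN l θ) u a t ≠ ∞ := fun t => by
    rw [totalWeight_maxLikENN h]; exact ENNReal.ofReal_ne_top
  have hnc : ENNReal.ofReal (M.normConst l θ u a) = (∏ t ∈ Finset.range (M.T - 1),
      ((M.N : ℝ≥0∞)⁻¹ * totalWeight (M.maxLikENN l θ) u a t)) *
        ((M.N : ℝ≥0∞)⁻¹ * totalWeight (M.maxLikENN l θ) u a (M.T - 1)) := by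
    rw [normConst, ENNReal.ofReal_prod_of_nonneg fun t _ => mul_nonneg (by positivity)
      (sum_weight_pos h hN l θ u a t).le]
    simp_rw [hav]
    rw [← Finset.prod_range_succ, Nat.sub_add_cancel hM.T_pos]
  have hsp : ∀ k, ENNReal.ofReal (M.selectionProb l θ u a k) =
      (∏ t ∈ Finset.range (M.T - 1), ∏ i, (M.maxLikENN l θ t (particle u a t (parent a t i)) /
        totalWeight (M.maxLikENN l θ) u a t)) *
      (M.maxLikENN l θ (M.T - 1) (particle u a (M.T - 1) k) /
        totalWeight (M.maxLikENN l θ) u a (M.T - 1)) := fun k => by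
    rw [selectionProb, prod_ancestors_eq, ENNReal.ofReal_mul (Finset.prod_nonneg fun t _ =>
      Finset.prod_nonneg fun i _ => normWeight_nonneg h hN l θ u a _ _), hnw,
      ENNReal.ofReal_prod_of_nonneg fun t _ => Finset.prod_nonneg fun i _ =>
        normWeight_nonneg h hN l θ u a _ _]
    congr 1
    refine Finset.prod_congr rfl fun t _ => ?_
    rw [ENNReal.ofReal_prod_of_nonneg fun i _ => normWeight_nonneg h hN l θ u a _ _]
    exact Finset.prod_congr rfl fun i _ => hnw t _
  simp only [filterFunctional, stepFactor, Finset.prod_mul_distrib]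
  simp_rw [ENNReal.ofReal_mul (normConst_nonneg h hN l θ u a), hnc, hsp]
  set S := totalWeight (M.maxLikENN l θ) u a (M.T - 1)
  rw [Finset.mul_sum, Finset.mul_sum]
  refine Finset.sum_congr rfl fun k _ => ?_
  have e : S * (M.maxLikENN l θ (M.T - 1) (particle u a (M.T - 1) k) / S) =
      M.maxLikENN l θ (M.T - 1) (particle u a (M.T - 1) k) :=
    ENNReal.mul_div_cancel (hS0 _) (hS1 _)
  simp only [Finset.prod_mul_distrib] at *
  conv_rhs => rw [← e]
  ring

/-- Unbiasedness of the delta particle filter. -/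
lemma lintegral_normConst_mul_selectionProb (h : M.LikelihoodRegular) {H : ℝ} (hM : M.Standing H)
    (l : ℕ) (θ : Θ) {Φ : (ℕ → ℝ) → ℝ≥0∞} (hΦ : Measurable Φ) :
    ∫⁻ u, ∑ a, ∑ k, ENNReal.ofReal (M.normConst (l + 1) θ u a * M.selectionProb (l + 1) θ u a k) *
        Φ (particle u a (M.T - 1) k) ∂M.innovMeasure (l + 1) =
      ∫⁻ w, (∏ t ∈ Finset.range M.T, M.maxLikENN (l + 1) θ t w) *
        Φ (trunc (M.T * 2 ^ (l + 1)) w) ∂noise (l + 1) := by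
  simp_rw [sum_normConst_mul_selectionProb h hM (l + 1) θ _ _ Φ]
  have hT := hM.T_pos
  have hloc : ∀ t, DependsOn (M.maxLikENN (l + 1) θ t) (Set.Iio ((t + 1) * 2 ^ (l + 1))) := by
    intro t x y hxy
    have := dependsOn_maxLik (M := M) l θ t hxy
    simp only at this
    simp only [maxLikENN, this]
  have key := lintegral_sum_filterFunctional (M := M) (l := l + 1) (g := M.maxLikENN (l + 1) θ)
    hM.N_pos (fun t => ((measurable_maxLik hM h (l + 1) t).comp measurable_prodMk_left).ennreal_ofReal)
    (fun t w => (ENNReal.ofReal_pos.2 (maxLik_pos h _ _ _ _)).ne')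
    (fun t w => ENNReal.ofReal_ne_top) hloc (t := M.T - 1) (by omega) hΦ
  rw [Nat.sub_add_cancel hT] at key
  have hc0 : (Fintype.card (Fin M.N → Fin M.N) : ℝ≥0∞) ^ (M.T - 1) ≠ 0 := by
    have : Nonempty (Fin M.N) := ⟨⟨0, hM.N_pos⟩⟩
    exact pow_ne_zero _ (by exact_mod_cast Fintype.card_ne_zero)
  have hc1 : (Fintype.card (Fin M.N → Fin M.N) : ℝ≥0∞) ^ (M.T - 1) ≠ ∞ :=
    ENNReal.pow_ne_top (ENNReal.natCast_ne_top _)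
  rw [(ENNReal.mul_right_inj hc0 hc1).1 key]
  refine lintegral_congr fun w => ?_
  congr 1
  refine Finset.prod_congr rfl fun t ht => hloc t fun j hj => ?_
  have ht' := Finset.mem_range.1 ht
  have : j < M.T * 2 ^ (l + 1) :=
    lt_of_lt_of_le (Set.mem_Iio.1 hj) (Nat.mul_le_mul_right _ (by omega))
  simp [trunc, this]

end Model

namespace Model

variable {Θ Y : Type*} [MeasurableSpace Θ] {M : Model Θ Y} {l : ℕ}

/-! ### Measurability on the state space -/

/-- Ancestors and selected index range over finite discrete spaces, so measurability can be checked
with both frozen. -/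
lemma measurable_of_sections {B : Type*} [MeasurableSpace B] {F : M.State Θ l → B}
    (hF : ∀ a k, Measurable fun p : Θ × M.Innovations l => F (p.1, p.2, a, k)) :
    Measurable F := by
  have h1 : Measurable fun p : (M.Ancestors × Fin M.N) × (Θ × M.Innovations l) =>
      F (p.2.1, p.2.2, p.1.1, p.1.2) :=
    measurable_from_prod_countable_right fun x => hF x.1 x.2
  have h2 : Measurable fun x : M.State Θ l => ((x.2.2.1, x.2.2.2), (x.1, x.2.1)) :=
    ((measurable_snd.comp measurable_snd).prodMk
      (measurable_fst.prodMk (measurable_fst.comp measurable_snd)))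
  exact h1.comp h2

lemma measurable_weight {H : ℝ} (hM : M.Standing H) (h : M.LikelihoodRegular) (a : M.Ancestors)
    {t : ℕ} (ht : t < M.T) (i : Fin M.N) :
    Measurable fun p : Θ × M.Innovations l => M.weight l p.1 p.2 a t i :=
  (measurable_maxLik hM h l t).comp
    (measurable_fst.prodMk ((measurable_particle a ht i).comp measurable_snd))

lemma measurable_normWeight {H : ℝ} (hM : M.Standing H) (h : M.LikelihoodRegular)
    (a : M.Ancestors) {t : ℕ} (ht : t < M.T) (i : Fin M.N) :
    Measurable fun p : Θ × M.Innovations l => M.normWeight l p.1 p.2 a t i :=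
  (measurable_weight hM h a ht i).div
    (Finset.measurable_fun_sum _ fun j _ => measurable_weight hM h a ht j)

lemma measurable_normConst {H : ℝ} (hM : M.Standing H) (h : M.LikelihoodRegular) :
    Measurable fun x : M.State Θ l => M.normConst l x.1 x.2.1 x.2.2.1 :=
  measurable_of_sections fun a _ => Finset.measurable_fun_prod _ fun _ ht =>
    (Finset.measurable_fun_sum _ fun j _ =>
      measurable_weight hM h a (Finset.mem_range.1 ht) j).const_mul _

lemma measurable_selectionProb {H : ℝ} (hM : M.Standing H) (h : M.LikelihoodRegular) :
    Measurable fun x : M.State Θ l => M.selectionProb l x.1 x.2.1 x.2.2.1 x.2.2.2 := by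
  have hT := hM.T_pos
  refine measurable_of_sections fun a k => Measurable.mul
    (Finset.measurable_fun_prod _ fun t _ => Finset.measurable_fun_prod _ fun i _ =>
      measurable_normWeight hM h a (by have := t.2; omega) _)
    (measurable_normWeight hM h a (by omega) _)

lemma measurable_path {H : ℝ} (hM : M.Standing H) :
    Measurable fun x : M.State Θ l => (x.1, path x) := by
  have hT := hM.T_pos
  exact measurable_of_sections fun a k =>
    measurable_fst.prodMk ((measurable_particle a (by omega) k).comp measurable_snd)

lemma measurable_proposalDensity {H : ℝ} (hM : M.Standing H) (h : M.LikelihoodRegular) :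
    Measurable (Function.uncurry (M.proposalDensity l)) :=
  ((hM.q_measurable l).comp ((measurable_fst.comp measurable_fst).prodMk
    (measurable_fst.comp measurable_snd))).mul
      ((measurable_selectionProb hM h).comp measurable_snd)

/-- The numerator and the denominator of the acceptance ratio. -/
noncomputable def acceptFlux (M : Model Θ Y) (l : ℕ) (x x' : M.State Θ l) : ℝ :=
  M.normConst l x.1 x.2.1 x.2.2.1 * M.prior x.1 * M.q l x.1 x'.1

lemma measurable_acceptFlux {H : ℝ} (hM : M.Standing H) (h : M.LikelihoodRegular) :
    Measurable (Function.uncurry (M.acceptFlux l)) :=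
  (((measurable_normConst hM h).comp measurable_fst).mul
    (hM.prior_density.1.comp (measurable_fst.comp measurable_fst))).mul
    ((hM.q_measurable l).comp ((measurable_fst.comp measurable_fst).prodMk
      (measurable_fst.comp measurable_snd)))

lemma acceptFlux_nonneg {H : ℝ} (hM : M.Standing H) (h : M.LikelihoodRegular)
    (x x' : M.State Θ l) : 0 ≤ M.acceptFlux l x x' :=
  mul_nonneg (mul_nonneg (normConst_nonneg h hM.N_pos _ _ _ _) (hM.prior_density.2.1 _))
    ((hM.q_density _ _).2.1 _)

lemma acceptProb_eq (x x' : M.State Θ l) : M.acceptProb l x x' =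
    if M.acceptFlux l x x' = 0 then 1 else min 1 (M.acceptFlux l x' x / M.acceptFlux l x x') :=
  rfl

/-- The minimum is symmetric in the two states, which is detailed balance in embryo. The convention
for a vanishing denominator is harmless because it is multiplied by zero. -/
lemma acceptFlux_mul_acceptProb {H : ℝ} (hM : M.Standing H) (h : M.LikelihoodRegular)
    (x x' : M.State Θ l) : M.acceptFlux l x x' * M.acceptProb l x x' =
      min (M.acceptFlux l x x') (M.acceptFlux l x' x) := by
  have h0 := acceptFlux_nonneg hM h x x'
  have h1 := acceptFlux_nonneg hM h x' x
  rw [acceptProb_eq]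
  split_ifs with hz
  · rw [hz, zero_mul, min_eq_left h1]
  · rw [mul_min_of_nonneg _ _ h0, mul_one, mul_div_cancel₀ _ hz]

lemma acceptProb_le_one (x x' : M.State Θ l) : M.acceptProb l x x' ≤ 1 := by
  rw [acceptProb_eq]
  split_ifs
  · exact le_rfl
  · exact min_le_left _ _

lemma measurable_moveDensity {H : ℝ} (hM : M.Standing H) (h : M.LikelihoodRegular) :
    Measurable (Function.uncurry (M.moveDensity l)) := by
  have hf := measurable_acceptFlux (l := l) hM h
  have ha : Measurable fun p : M.State Θ l × M.State Θ l => M.acceptProb l p.1 p.2 := by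
    simp only [acceptProb_eq]
    exact Measurable.ite (hf (measurableSet_singleton 0)) measurable_const
      (measurable_const.min ((hf.comp measurable_swap).div hf))
  exact ((measurable_proposalDensity hM h).mul ha).ennreal_ofReal

/-! ### The kernel -/

lemma lintegral_refMeasure {F : M.State Θ l → ℝ≥0∞} (hF : Measurable F) :
    ∫⁻ x, F x ∂M.refMeasure l =
      ∫⁻ θ, ∫⁻ u, ∑ a, ∑ k, F (θ, u, a, k) ∂M.innovMeasure l ∂M.dom := by
  rw [refMeasure, lintegral_prod _ hF.aemeasurable]
  refine lintegral_congr fun θ => ?_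
  have h1 : Measurable fun y => F (θ, y) := hF.comp measurable_prodMk_left
  rw [lintegral_prod _ h1.aemeasurable]
  refine lintegral_congr fun u => ?_
  have h2 : Measurable fun y => F (θ, u, y) := h1.comp measurable_prodMk_left
  rw [lintegral_prod _ h2.aemeasurable, lintegral_count, tsum_fintype]
  refine Finset.sum_congr rfl fun a _ => ?_
  rw [lintegral_count, tsum_fintype]

lemma lintegral_proposalDensity {H : ℝ} (hM : M.Standing H) (h : M.LikelihoodRegular)
    (x : M.State Θ l) :
    ∫⁻ x', ENNReal.ofReal (M.proposalDensity l x x') ∂M.refMeasure l = 1 := by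
  have hm : Measurable fun x' => ENNReal.ofReal (M.proposalDensity l x x') :=
    ((measurable_proposalDensity hM h).comp measurable_prodMk_left).ennreal_ofReal
  rw [lintegral_refMeasure hm, ← (hM.q_density l x.1).2.2]
  refine lintegral_congr fun θ => ?_
  have h1 : ∀ u : M.Innovations l, ∑ a, ∑ k,
      ENNReal.ofReal (M.proposalDensity l x (θ, u, a, k)) = ENNReal.ofReal (M.q l x.1 θ) := by
    intro u
    have hs : ∀ a k, 0 ≤ M.selectionProb l θ u a k := selectionProb_nonneg h hM.N_pos l θ u
    simp only [proposalDensity, ENNReal.ofReal_mul ((hM.q_density l x.1).2.1 θ)]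
    simp_rw [← Finset.mul_sum]
    simp_rw [← ENNReal.ofReal_sum_of_nonneg fun k _ => hs _ k]
    rw [← ENNReal.ofReal_sum_of_nonneg fun a _ => Finset.sum_nonneg fun k _ => hs a k,
      sum_selectionProb h hM.N_pos, ENNReal.ofReal_one, mul_one]
  simp_rw [h1]
  simp

lemma lintegral_moveDensity_le {H : ℝ} (hM : M.Standing H) (h : M.LikelihoodRegular)
    (x : M.State Θ l) : ∫⁻ x', M.moveDensity l x x' ∂M.refMeasure l ≤ 1 := by
  rw [← lintegral_proposalDensity hM h x]
  refine lintegral_mono fun x' => ENNReal.ofReal_le_ofReal ?_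
  exact mul_le_of_le_one_right (mul_nonneg ((hM.q_density _ _).2.1 _)
    (selectionProb_nonneg h hM.N_pos _ _ _ _ _)) (acceptProb_le_one x x')

lemma mcmcKernel_apply {H : ℝ} (hM : M.Standing H) (h : M.LikelihoodRegular) (x : M.State Θ l) :
    M.mcmcKernel l x = (M.refMeasure l).withDensity (M.moveDensity l x) +
      (1 - ∫⁻ x', M.moveDensity l x x' ∂M.refMeasure l) • Measure.dirac x := by
  have hm := measurable_moveDensity (l := l) hM h
  have hI : Measurable fun x => ∫⁻ x', M.moveDensity l x x' ∂M.refMeasure l :=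
    hm.lintegral_prod_right'
  have hr : Measurable (Function.uncurry fun (x _ : M.State Θ l) =>
      1 - ∫⁻ x', M.moveDensity l x x' ∂M.refMeasure l) := (hI.const_sub 1).comp measurable_fst
  rw [mcmcKernel, add_apply, Kernel.withDensity_apply _ hm, Kernel.const_apply,
    Kernel.withDensity_apply _ hr, Kernel.id_apply,
    withDensity_const]

lemma isMarkovKernel_mcmcKernel {H : ℝ} (hM : M.Standing H) (h : M.LikelihoodRegular) :
    IsMarkovKernel (M.mcmcKernel l) := by
  refine ⟨fun x => ⟨?_⟩⟩
  rw [mcmcKernel_apply hM h, Measure.add_apply, withDensity_apply _ MeasurableSet.univ,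
    Measure.restrict_univ, Measure.smul_apply, measure_univ, smul_eq_mul, mul_one]
  -- The holding mass is a truncated subtraction in ℝ≥0∞; it is a genuine one because the accepted
  -- mass is at most one.
  exact add_tsub_cancel_of_le (lintegral_moveDensity_le hM h x)

/-- The density of the law of the states targeted by the algorithm, up to normalization. -/
noncomputable def targetDensity (M : Model Θ Y) (l : ℕ) (x : M.State Θ l) : ℝ≥0∞ :=
  ENNReal.ofReal (M.prior x.1 * (M.normConst l x.1 x.2.1 x.2.2.1 *
    M.selectionProb l x.1 x.2.1 x.2.2.1 x.2.2.2))

lemma measurable_targetDensity {H : ℝ} (hM : M.Standing H) (h : M.LikelihoodRegular) :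
    Measurable (M.targetDensity l) :=
  ((hM.prior_density.1.comp measurable_fst).mul
    ((measurable_normConst hM h).mul (measurable_selectionProb hM h))).ennreal_ofReal

/-- Target times proposal contains the selection probabilities of both states, a symmetric factor,
and the flux, which acceptance turns into a symmetric minimum. Hence the acceptance ratio needs only
the normalizing constant estimates. -/
lemma targetDensity_mul_moveDensity {H : ℝ} (hM : M.Standing H) (h : M.LikelihoodRegular)
    (x x' : M.State Θ l) : M.targetDensity l x * M.moveDensity l x x' =
      M.targetDensity l x' * M.moveDensity l x' x := by
  have hs : ∀ x : M.State Θ l, 0 ≤ M.prior x.1 * (M.normConst l x.1 x.2.1 x.2.2.1 *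
      M.selectionProb l x.1 x.2.1 x.2.2.1 x.2.2.2) := fun x =>
    mul_nonneg (hM.prior_density.2.1 _) (mul_nonneg (normConst_nonneg h hM.N_pos _ _ _ _)
      (selectionProb_nonneg h hM.N_pos _ _ _ _ _))
  have key : ∀ x x' : M.State Θ l, M.prior x.1 * (M.normConst l x.1 x.2.1 x.2.2.1 *
      M.selectionProb l x.1 x.2.1 x.2.2.1 x.2.2.2) *
        (M.proposalDensity l x x' * M.acceptProb l x x') =
      M.selectionProb l x.1 x.2.1 x.2.2.1 x.2.2.2 *
        M.selectionProb l x'.1 x'.2.1 x'.2.2.1 x'.2.2.2 *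
        min (M.acceptFlux l x x') (M.acceptFlux l x' x) := by
    intro x x'
    rw [← acceptFlux_mul_acceptProb hM h, proposalDensity, acceptFlux]
    ring
  simp only [targetDensity, moveDensity]
  rw [← ENNReal.ofReal_mul (hs x), ← ENNReal.ofReal_mul (hs x'), key, key, min_comm]
  congr 1
  ring

lemma isReversible_target {H : ℝ} (hM : M.Standing H) (h : M.LikelihoodRegular) (z : ℝ≥0∞) :
    (M.mcmcKernel l).IsReversible
      ((M.refMeasure l).withDensity fun x => z * M.targetDensity l x) := by
  refine isReversible_of_detailed_balance ((measurable_targetDensity hM h).const_mul z)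
    (measurable_moveDensity hM h) (mcmcKernel_apply hM h) fun x y => ?_
  rw [mul_assoc, mul_assoc, targetDensity_mul_moveDensity hM h]

/-! ### The invariant law -/

/-- The joint law of the parameter and the noise under the prior. -/
noncomputable def priorNoise (M : Model Θ Y) (l : ℕ) : Measure (Θ × (ℕ → ℝ)) :=
  (M.dom.withDensity fun θ => ENNReal.ofReal (M.prior θ)).prod (noise l)

lemma isProbabilityMeasure_prior {H : ℝ} (hM : M.Standing H) :
    IsProbabilityMeasure (M.dom.withDensity fun θ => ENNReal.ofReal (M.prior θ)) :=
  ⟨by rw [withDensity_apply _ MeasurableSet.univ, Measure.restrict_univ, hM.prior_density.2.2]⟩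

lemma isProbabilityMeasure_priorNoise {H : ℝ} (hM : M.Standing H) :
    IsProbabilityMeasure (M.priorNoise l) := by
  have := isProbabilityMeasure_prior hM
  unfold priorNoise
  infer_instance

/-- The product of the weights along a path. -/
noncomputable def prodMaxLik (M : Model Θ Y) (l : ℕ) (p : Θ × (ℕ → ℝ)) : ℝ :=
  ∏ t ∈ Finset.range M.T, M.maxLik l p.1 p.2 t

lemma measurable_prodMaxLik {H : ℝ} (hM : M.Standing H) (h : M.LikelihoodRegular) :
    Measurable (M.prodMaxLik l) :=
  Finset.measurable_fun_prod _ fun t _ => measurable_maxLik hM h l t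

/-- Unbiasedness integrated against the prior: the auxiliary variables of the filter disappear and
only parameter and selected path remain. -/
lemma lintegral_targetDensity {H : ℝ} (hM : M.Standing H) (h : M.LikelihoodRegular)
    {Φ : Θ × (ℕ → ℝ) → ℝ≥0∞} (hΦ : Measurable Φ) :
    ∫⁻ x, M.targetDensity (l + 1) x * Φ (x.1, path x) ∂M.refMeasure (l + 1) =
      ∫⁻ p, ENNReal.ofReal (M.prodMaxLik (l + 1) p) *
        Φ (p.1, trunc (M.T * 2 ^ (l + 1)) p.2) ∂M.priorNoise (l + 1) := by
  have hπ := isProbabilityMeasure_prior hM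
  have ht : Measurable fun p : Θ × (ℕ → ℝ) => (p.1, trunc (M.T * 2 ^ (l + 1)) p.2) :=
    measurable_fst.prodMk ((measurable_trunc _).comp measurable_snd)
  have hG : Measurable fun p => ENNReal.ofReal (M.prodMaxLik (l + 1) p) *
      Φ (p.1, trunc (M.T * 2 ^ (l + 1)) p.2) :=
    (measurable_prodMaxLik hM h).ennreal_ofReal.mul (hΦ.comp ht)
  have hG' : Measurable fun θ => ∫⁻ w, ENNReal.ofReal (M.prodMaxLik (l + 1) (θ, w)) *
      Φ (θ, trunc (M.T * 2 ^ (l + 1)) w) ∂noise (l + 1) := hG.lintegral_prod_right'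
  have hL : Measurable fun x : M.State Θ (l + 1) =>
      M.targetDensity (l + 1) x * Φ (x.1, path x) :=
    (measurable_targetDensity hM h).mul (hΦ.comp (measurable_path hM))
  rw [lintegral_refMeasure hL, priorNoise, lintegral_prod _ hG.aemeasurable,
    lintegral_withDensity_eq_lintegral_mul _ hM.prior_density.1.ennreal_ofReal hG']
  refine lintegral_congr fun θ => ?_
  have hΦθ : Measurable fun w => Φ (θ, w) := hΦ.comp measurable_prodMk_left
  have key := lintegral_normConst_mul_selectionProb h hM l θ hΦθ
  have e1 : ∀ w, ENNReal.ofReal (M.prodMaxLik (l + 1) (θ, w)) =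
      ∏ t ∈ Finset.range M.T, M.maxLikENN (l + 1) θ t w := fun w => by
    rw [prodMaxLik, ENNReal.ofReal_prod_of_nonneg fun t _ => (maxLik_pos h _ _ _ _).le]
    rfl
  simp only [Pi.mul_apply, e1]
  rw [← key]
  have hms : Measurable fun u : M.Innovations (l + 1) => ∑ a, ∑ k,
      ENNReal.ofReal (M.normConst (l + 1) θ u a * M.selectionProb (l + 1) θ u a k) *
        Φ (θ, particle u a (M.T - 1) k) := by
    refine Finset.measurable_fun_sum _ fun a _ => Finset.measurable_fun_sum _ fun k _ => ?_
    have hx : Measurable fun u : M.Innovations (l + 1) => ((θ, u, a, k) : M.State Θ (l + 1)) :=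
      measurable_const.prodMk (measurable_id.prodMk measurable_const)
    exact (((measurable_normConst hM h).comp hx).mul
      ((measurable_selectionProb hM h).comp hx)).ennreal_ofReal.mul
        (hΦ.comp ((measurable_path hM).comp hx))
  rw [← lintegral_const_mul _ hms]
  refine lintegral_congr fun u => ?_
  simp_rw [Finset.mul_sum]
  refine Finset.sum_congr rfl fun a _ => Finset.sum_congr rfl fun k _ => ?_
  simp only [targetDensity, path]
  rw [ENNReal.ofReal_mul (hM.prior_density.2.1 θ), mul_assoc]

/-- Under the invariant law of the coupled MCMC kernel, the parameter and the selected path have a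
density proportional to the product of the weights. -/
lemma KernelRegular.exists_integral_eq {η : ∀ l, Measure (M.State Θ l)} (h₃ : M.KernelRegular η)
    {H : ℝ} (hM : M.Standing H) (h : M.LikelihoodRegular) {c C : ℝ} (hc : 0 < c)
    (hcC : ∀ θ w, c ≤ M.prodMaxLik (l + 1) (θ, w) ∧ M.prodMaxLik (l + 1) (θ, w) ≤ C) :
    ∃ z : ℝ, 0 < z ∧ z ≤ c⁻¹ ∧ ∀ F : Θ × (ℕ → ℝ) → ℝ, Measurable F →
      (∀ θ, DependsOn (fun w => F (θ, w)) (Set.Iio (M.T * 2 ^ (l + 1)))) →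
      ∫ x, F (x.1, path x) ∂η (l + 1) =
        z * ∫ p, M.prodMaxLik (l + 1) p * F p ∂M.priorNoise (l + 1) := by
  have hpn := isProbabilityMeasure_priorNoise (l := l + 1) hM
  have hmk := isMarkovKernel_mcmcKernel (l := l + 1) hM h
  have hη := h₃.isProbability (l + 1) (by omega)
  have hPm := measurable_prodMaxLik (l := l + 1) hM h
  set Z : ℝ≥0∞ := ∫⁻ p, ENNReal.ofReal (M.prodMaxLik (l + 1) p) ∂M.priorNoise (l + 1) with hZ
  have hZc : ENNReal.ofReal c ≤ Z := by
    have : ENNReal.ofReal c = ∫⁻ _, ENNReal.ofReal c ∂M.priorNoise (l + 1) := by simp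
    rw [this]
    exact lintegral_mono fun p => ENNReal.ofReal_le_ofReal (hcC p.1 p.2).1
  have hZC : Z ≤ ENNReal.ofReal C := by
    have : ENNReal.ofReal C = ∫⁻ _, ENNReal.ofReal C ∂M.priorNoise (l + 1) := by simp
    rw [this]
    exact lintegral_mono fun p => ENNReal.ofReal_le_ofReal (hcC p.1 p.2).2
  have hZ0 : Z ≠ 0 := ((ENNReal.ofReal_pos.2 hc).trans_le hZc).ne'
  have hZt : Z ≠ ∞ := (hZC.trans_lt ENNReal.ofReal_lt_top).ne
  set η' := (M.refMeasure (l + 1)).withDensity fun x => Z⁻¹ * M.targetDensity (l + 1) x with hη'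
  have hmt := measurable_targetDensity (l := l + 1) hM h
  have hlin : ∀ Φ : Θ × (ℕ → ℝ) → ℝ≥0∞, Measurable Φ → ∫⁻ x, Φ (x.1, path x) ∂η' =
      Z⁻¹ * ∫⁻ p, ENNReal.ofReal (M.prodMaxLik (l + 1) p) *
        Φ (p.1, trunc (M.T * 2 ^ (l + 1)) p.2) ∂M.priorNoise (l + 1) := by
    intro Φ hΦ
    have hm : Measurable fun x : M.State Θ (l + 1) => M.targetDensity (l + 1) x * Φ (x.1, path x) :=
      hmt.mul (hΦ.comp (measurable_path hM))
    have hm' : Measurable fun x : M.State Θ (l + 1) => Φ (x.1, path x) :=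
      hΦ.comp (measurable_path hM)
    rw [← lintegral_targetDensity hM h hΦ, ← lintegral_const_mul _ hm, hη',
      lintegral_withDensity_eq_lintegral_mul _ (hmt.const_mul _) hm']
    exact lintegral_congr fun x => mul_assoc _ _ _
  have hη'p : IsProbabilityMeasure η' := ⟨by
    have := hlin (fun _ => 1) measurable_const
    simp only [lintegral_const, one_mul, mul_one] at this
    rw [this]
    exact ENNReal.inv_mul_cancel hZ0 hZt⟩
  obtain ⟨ξ, hξ₀, hξ₁, hmin⟩ := h₃.minorization
  obtain ⟨ν, hν, hνκ⟩ := hmin (l + 1) (by omega)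
  -- Reversibility is used only through invariance; the minorization then leaves no choice but the
  -- explicit target.
  have heq : η (l + 1) = η' := invariant_unique hξ₀ hξ₁ hνκ
    (h₃.reversible (l + 1) (by omega)).invariant (isReversible_target hM h Z⁻¹).invariant
  have ht : Measurable fun p : Θ × (ℕ → ℝ) => (p.1, trunc (M.T * 2 ^ (l + 1)) p.2) :=
    measurable_fst.prodMk ((measurable_trunc _).comp measurable_snd)
  have hmap : η'.map (fun x : M.State Θ (l + 1) => (x.1, path x)) =
      Z⁻¹ • ((M.priorNoise (l + 1)).withDensity
        fun p => ENNReal.ofReal (M.prodMaxLik (l + 1) p)).map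
          fun p => (p.1, trunc (M.T * 2 ^ (l + 1)) p.2) := by
    refine Measure.ext_of_lintegral _ fun Φ hΦ => ?_
    have hΦt : Measurable fun p : Θ × (ℕ → ℝ) => Φ (p.1, trunc (M.T * 2 ^ (l + 1)) p.2) :=
      hΦ.comp ht
    rw [lintegral_map hΦ (measurable_path hM), hlin Φ hΦ, lintegral_smul_measure,
      lintegral_map hΦ ht, lintegral_withDensity_eq_lintegral_mul _ hPm.ennreal_ofReal hΦt]
    rfl
  refine ⟨(Z⁻¹).toReal, ENNReal.toReal_pos (ENNReal.inv_ne_zero.2 hZt) (ENNReal.inv_ne_top.2 hZ0),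
    ?_, fun F hF hloc => ?_⟩
  · rw [ENNReal.toReal_inv]
    refine inv_anti₀ hc ?_
    exact (ENNReal.ofReal_le_iff_le_toReal hZt).1 hZc
  · have h1 : ∫ x, F (x.1, path x) ∂η (l + 1) =
        ∫ p, F p ∂(η'.map fun x : M.State Θ (l + 1) => (x.1, path x)) := by
      rw [integral_map (measurable_path hM).aemeasurable hF.aestronglyMeasurable, heq]
    rw [h1, hmap, integral_smul_measure, integral_map ht.aemeasurable hF.aestronglyMeasurable,
      integral_withDensity_eq_integral_toReal_smul hPm.ennreal_ofReal
        (ae_of_all _ fun _ => ENNReal.ofReal_lt_top), smul_eq_mul]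
    congr 1
    refine integral_congr_ae (ae_of_all _ fun p => ?_)
    have hp : F (p.1, trunc (M.T * 2 ^ (l + 1)) p.2) = F p := by
      refine hloc p.1 fun j hj => ?_
      simp [trunc, Set.mem_Iio.1 hj]
    simp only [hp, smul_eq_mul]
    rw [ENNReal.toReal_ofReal (hc.le.trans (hcC p.1 p.2).1)]

end Model

/-- Factors are exchanged one at a time; the remaining ones, bounded by one, do no harm. -/
lemma abs_prod_sub_prod_le {ι : Type*} (s : Finset ι) {a b : ι → ℝ} (ha : ∀ i ∈ s, |a i| ≤ 1)
    (hb : ∀ i ∈ s, |b i| ≤ 1) : |∏ i ∈ s, a i - ∏ i ∈ s, b i| ≤ ∑ i ∈ s, |a i - b i| := by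
  classical
  induction s using Finset.induction_on with
  | empty => simp
  | insert j s hj ih =>
    have ih' := ih (fun i hi => ha i (Finset.mem_insert_of_mem hi))
      fun i hi => hb i (Finset.mem_insert_of_mem hi)
    have hp : |∏ i ∈ s, b i| ≤ 1 := by
      rw [Finset.abs_prod]
      exact Finset.prod_le_one (fun _ _ => abs_nonneg _)
        fun i hi => hb i (Finset.mem_insert_of_mem hi)
    rw [Finset.prod_insert hj, Finset.prod_insert hj, Finset.sum_insert hj,
      show a j * ∏ i ∈ s, a i - b j * ∏ i ∈ s, b i =
        (a j - b j) * ∏ i ∈ s, b i + a j * (∏ i ∈ s, a i - ∏ i ∈ s, b i) by ring]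
    refine (abs_add_le _ _).trans (add_le_add ?_ ?_)
    · rw [abs_mul]
      exact mul_le_of_le_one_right (abs_nonneg _) hp
    · rw [abs_mul]
      exact (mul_le_of_le_one_left (abs_nonneg _) (ha j (Finset.mem_insert_self _ _))).trans ih'

namespace Model

variable {Θ Y : Type*} [MeasurableSpace Θ] {M : Model Θ Y} {l : ℕ}

/-! ### The posterior expectations -/

/-- The likelihood of level `l`. -/
noncomputable def likelihood (M : Model Θ Y) (l : ℕ) (p : Θ × (ℕ → ℝ)) : ℝ :=
  ∏ t ∈ Finset.range M.T, M.lik l p.1 p.2 t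

/-- A function of the parameter and of the Euler path at the observation times. -/
noncomputable def testValue (M : Model Θ Y) (l : ℕ) (φ : Θ × (Fin M.T → ℝ) → ℝ) (p : Θ × (ℕ → ℝ)) : ℝ :=
  φ (p.1, M.skeleton l p.1 p.2)

lemma measurable_likelihood {H : ℝ} (hM : M.Standing H) (h : M.LikelihoodRegular) (l : ℕ) :
    Measurable (M.likelihood l) :=
  Finset.measurable_fun_prod _ fun t _ => measurable_lik hM h l t

lemma likelihood_nonneg (h : M.LikelihoodRegular) (l : ℕ) (p : Θ × (ℕ → ℝ)) :
    0 ≤ M.likelihood l p := Finset.prod_nonneg fun _ _ => (lik_pos h _ _ _ _).le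

lemma measurable_testValue {H : ℝ} (hM : M.Standing H) {φ : Θ × (Fin M.T → ℝ) → ℝ}
    (hφ : Measurable φ) (l : ℕ) : Measurable (M.testValue l φ) :=
  hφ.comp (measurable_fst.prodMk (measurable_pi_iff.2 fun _ =>
    measurable_euler hM.b_measurable hM.σ_measurable l _))

lemma dependsOn_likelihood (l : ℕ) (θ : Θ) :
    DependsOn (fun w => M.likelihood l (θ, w)) (Set.Iio (M.T * 2 ^ l)) := by
  intro x y hxy
  refine Finset.prod_congr rfl fun t ht => dependsOn_lik l θ t fun i hi => hxy i ?_
  have ht' := Finset.mem_range.1 ht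
  exact lt_of_lt_of_le (Set.mem_Iio.1 hi) (Nat.mul_le_mul_right _ ht')

lemma dependsOn_testValue (φ : Θ × (Fin M.T → ℝ) → ℝ) (l : ℕ) (θ : Θ) :
    DependsOn (fun w => M.testValue l φ (θ, w)) (Set.Iio (M.T * 2 ^ l)) := by
  intro x y hxy
  simp only [testValue]
  congr 2
  funext t
  refine M.dependsOn_euler l θ _ fun i hi => hxy i ?_
  exact lt_of_lt_of_le (Set.mem_Iio.1 hi) (Nat.mul_le_mul_right _ t.2)

/-- The posterior is defined on finite vectors, the filter is analysed on sequences. Extension by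
zero and truncation have the same law, and F does not see the indices where truncation acts. -/
lemma integral_prior_pi {H : ℝ} (hM : M.Standing H) {F : Θ × (ℕ → ℝ) → ℝ} (hF : Measurable F)
    (hloc : ∀ θ, DependsOn (fun w => F (θ, w)) (Set.Iio (M.T * 2 ^ l))) :
    ∫ p, F (p.1, extend p.2) ∂((M.dom.withDensity fun θ => ENNReal.ofReal (M.prior θ)).prod
      (Measure.pi fun _ : Fin (M.T * 2 ^ l) => gaussianReal 0 (stepSize l))) =
    ∫ p, F p ∂M.priorNoise l := by
  have hπ := isProbabilityMeasure_prior hM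
  set π := M.dom.withDensity fun θ => ENNReal.ofReal (M.prior θ)
  set n := M.T * 2 ^ l
  set γ : Measure (Fin n → ℝ) := Measure.pi fun _ => gaussianReal 0 (stepSize l)
  have hγ : γ.map extend = (noise l).map (trunc n) := by
    refine Measure.ext_of_lintegral _ fun Φ hΦ => ?_
    rw [lintegral_map hΦ measurable_extend, lintegral_map hΦ (measurable_trunc n),
      ← lintegral_pi_extend l n hΦ]
  have hmap : (π.prod γ).map (Prod.map id extend) =
      (M.priorNoise l).map (Prod.map id (trunc n)) := by
    rw [← Measure.map_prod_map _ _ measurable_id measurable_extend, priorNoise,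
      ← Measure.map_prod_map _ _ measurable_id (measurable_trunc n), hγ]
  have h1 := integral_map (μ := π.prod γ)
    (measurable_id.prodMap (measurable_extend (n := n))).aemeasurable hF.aestronglyMeasurable
  have h2 := integral_map (μ := M.priorNoise l)
    (measurable_id.prodMap (measurable_trunc n)).aemeasurable hF.aestronglyMeasurable
  refine h1.symm.trans ((congrArg (fun μ => ∫ p, F p ∂μ) hmap).trans (h2.trans ?_))
  refine integral_congr_ae (ae_of_all _ fun p => hloc p.1 fun j hj => ?_)
  simp only [trunc]
  rw [if_pos (Set.mem_Iio.1 hj)]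

lemma posteriorExp_eq {H : ℝ} (hM : M.Standing H) (h : M.LikelihoodRegular)
    {φ : Θ × (Fin M.T → ℝ) → ℝ} (hφ : Measurable φ) (l : ℕ) :
    M.posteriorExp l φ = (∫ p, M.likelihood l p * M.testValue l φ p ∂M.priorNoise l) /
      ∫ p, M.likelihood l p ∂M.priorNoise l := by
  have hL := measurable_likelihood hM h l
  have hT := measurable_testValue hM hφ l
  set n := M.T * 2 ^ l with hn
  set μ := (M.dom.withDensity fun θ => ENNReal.ofReal (M.prior θ)).prod
    (Measure.pi fun _ : Fin n => gaussianReal 0 (stepSize l)) with hμ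
  have he : Measurable fun p : Θ × (Fin n → ℝ) => (p.1, extend p.2) :=
    measurable_fst.prodMk (measurable_extend.comp measurable_snd)
  have hLe : Measurable fun p : Θ × (Fin n → ℝ) => M.likelihood l (p.1, extend p.2) := hL.comp he
  have hU : M.unnormalizedPosterior l =
      μ.withDensity fun p => ENNReal.ofReal (M.likelihood l (p.1, extend p.2)) := rfl
  have hmass : (M.unnormalizedPosterior l Set.univ).toReal =
      ∫ p, M.likelihood l p ∂M.priorNoise l := by
    rw [hU, withDensity_apply _ MeasurableSet.univ, Measure.restrict_univ,
      ← integral_prior_pi hM hL fun θ => dependsOn_likelihood l θ,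
      integral_eq_lintegral_of_nonneg_ae (ae_of_all _ fun p => likelihood_nonneg h l _)
        hLe.aestronglyMeasurable]
  have hnum : ∫ p, φ (p.1, M.skeleton l p.1 (extend p.2)) ∂M.unnormalizedPosterior l =
      ∫ p, M.likelihood l p * M.testValue l φ p ∂M.priorNoise l := by
    have hLT : Measurable fun p => M.likelihood l p * M.testValue l φ p := hL.mul hT
    rw [hU, integral_withDensity_eq_integral_toReal_smul hLe.ennreal_ofReal
        (ae_of_all _ fun _ => ENNReal.ofReal_lt_top),
      ← integral_prior_pi hM hLT fun θ x y hxy => by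
        have h1 := dependsOn_likelihood (M := M) l θ hxy
        have h2 := dependsOn_testValue φ l θ hxy
        simp only at h1 h2
        simp only [h1, h2]]
    refine integral_congr_ae (ae_of_all _ fun p => ?_)
    simp only [smul_eq_mul]
    rw [ENNReal.toReal_ofReal (likelihood_nonneg h l _)]
    rfl
  rw [posteriorExp, posterior, integral_smul_measure, hnum, ENNReal.toReal_inv, hmass, smul_eq_mul,
    div_eq_inv_mul]

/-- Places the coarse level on the space of the fine one, where the two can be compared path by
path. -/
lemma integral_priorNoise_coarsen {H : ℝ} (hM : M.Standing H) {Ω : Type*} [MeasurableSpace Ω]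
    {P : Measure Ω} {W : ℝ≥0 → Ω → ℝ} (hW : IsPreBrownianReal W P) (l : ℕ)
    {F : Θ × (ℕ → ℝ) → ℝ} (hF : Measurable F) :
    ∫ p, F p ∂M.priorNoise l = ∫ p, F (p.1, coarsen p.2) ∂M.priorNoise (l + 1) := by
  have hπ := isProbabilityMeasure_prior hM
  have hmap : M.priorNoise l = (M.priorNoise (l + 1)).map (Prod.map id coarsen) := by
    rw [priorNoise, priorNoise, ← Measure.map_prod_map _ _ measurable_id measurable_coarsen,
      map_coarsen_noise hW, Measure.map_id]
  rw [hmap, integral_map (measurable_id.prodMap measurable_coarsen).aemeasurable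
    hF.aestronglyMeasurable]
  rfl

/-- Uniformity in θ is what allows integration against an arbitrary prior. -/
lemma integral_sq_priorNoise_le {H : ℝ} (hM : M.Standing H) {F : Θ × (ℕ → ℝ) → ℝ}
    (hF : Measurable F) {e : ℝ} (he : 0 ≤ e)
    (hFe : ∀ θ, msq l (fun w => F (θ, w)) ≤ ENNReal.ofReal e) :
    ∫ p, F p ^ 2 ∂M.priorNoise l ≤ e := by
  have hπ := isProbabilityMeasure_prior hM
  have hF2 : Measurable fun p => F p ^ 2 := hF.pow_const 2
  rw [integral_eq_lintegral_of_nonneg_ae (ae_of_all _ fun p => sq_nonneg _)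
    hF2.aestronglyMeasurable]
  refine ENNReal.toReal_le_of_le_ofReal he ?_
  rw [priorNoise, lintegral_prod _ hF2.ennreal_ofReal.aemeasurable]
  refine (lintegral_mono hFe).trans ?_
  simp

/-! ### The importance weights -/

/-- The importance weight of the fine path. -/
noncomputable def fineRatio (M : Model Θ Y) (l : ℕ) (p : Θ × (ℕ → ℝ)) : ℝ :=
  ∏ t ∈ Finset.range M.T, M.lik (l + 1) p.1 p.2 t / M.maxLik (l + 1) p.1 p.2 t

/-- The importance weight of the coarse path. -/
noncomputable def coarseRatio (M : Model Θ Y) (l : ℕ) (p : Θ × (ℕ → ℝ)) : ℝ :=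
  ∏ t ∈ Finset.range M.T, M.lik l p.1 (coarsen p.2) t / M.maxLik (l + 1) p.1 p.2 t

/-- The change of measure behind H₁: the weight undoes the maximum, which is positive. -/
lemma prodMaxLik_mul_fineRatio (h : M.LikelihoodRegular) (p : Θ × (ℕ → ℝ)) :
    M.prodMaxLik (l + 1) p * M.fineRatio l p = M.likelihood (l + 1) p := by
  rw [prodMaxLik, fineRatio, ← Finset.prod_mul_distrib]
  exact Finset.prod_congr rfl fun t _ => mul_div_cancel₀ _ (maxLik_pos h _ _ _ _).ne'

lemma prodMaxLik_mul_coarseRatio (h : M.LikelihoodRegular) (p : Θ × (ℕ → ℝ)) :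
    M.prodMaxLik (l + 1) p * M.coarseRatio l p = M.likelihood l (p.1, coarsen p.2) := by
  rw [prodMaxLik, coarseRatio, ← Finset.prod_mul_distrib]
  exact Finset.prod_congr rfl fun t _ => mul_div_cancel₀ _ (maxLik_pos h _ _ _ _).ne'

lemma measurable_coarsen_right : Measurable fun p : Θ × (ℕ → ℝ) => (p.1, coarsen p.2) :=
  measurable_fst.prodMk (measurable_coarsen.comp measurable_snd)

lemma measurable_fineRatio {H : ℝ} (hM : M.Standing H) (h : M.LikelihoodRegular) :
    Measurable (M.fineRatio l) :=
  Finset.measurable_fun_prod _ fun t _ =>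
    (measurable_lik hM h (l + 1) t).div (measurable_maxLik hM h (l + 1) t)

lemma measurable_coarseRatio {H : ℝ} (hM : M.Standing H) (h : M.LikelihoodRegular) :
    Measurable (M.coarseRatio l) :=
  Finset.measurable_fun_prod _ fun t _ =>
    ((measurable_lik hM h l t).comp measurable_coarsen_right).div
      (measurable_maxLik hM h (l + 1) t)

lemma Iio_subset_of_lt {t : ℕ} (ht : t ∈ Finset.range M.T) (l : ℕ) {i : ℕ}
    (hi : i ∈ Set.Iio ((t + 1) * 2 ^ l)) : i ∈ Set.Iio (M.T * 2 ^ l) :=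
  lt_of_lt_of_le (Set.mem_Iio.1 hi) (Nat.mul_le_mul_right _ (Finset.mem_range.1 ht))

lemma dependsOn_fineRatio (l : ℕ) (θ : Θ) :
    DependsOn (fun w => M.fineRatio l (θ, w)) (Set.Iio (M.T * 2 ^ (l + 1))) := by
  intro x y hxy
  refine Finset.prod_congr rfl fun t ht => ?_
  have h1 := dependsOn_lik (M := M) (l + 1) θ t fun i hi => hxy i (Iio_subset_of_lt ht _ hi)
  have h2 := dependsOn_maxLik (M := M) l θ t fun i hi => hxy i (Iio_subset_of_lt ht _ hi)
  simp only at h1 h2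
  simp only [h1, h2]

lemma dependsOn_coarseRatio (l : ℕ) (θ : Θ) :
    DependsOn (fun w => M.coarseRatio l (θ, w)) (Set.Iio (M.T * 2 ^ (l + 1))) := by
  intro x y hxy
  refine Finset.prod_congr rfl fun t ht => ?_
  have h1 := dependsOn_lik_coarsen (M := M) l θ t fun i hi => hxy i (Iio_subset_of_lt ht _ hi)
  have h2 := dependsOn_maxLik (M := M) l θ t fun i hi => hxy i (Iio_subset_of_lt ht _ hi)
  simp only at h1 h2
  simp only [h1, h2]

lemma dependsOn_testValue_coarsen (φ : Θ × (Fin M.T → ℝ) → ℝ) (l : ℕ) (θ : Θ) :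
    DependsOn (fun w => M.testValue l φ (θ, coarsen w)) (Set.Iio (M.T * 2 ^ (l + 1))) := by
  intro x y hxy
  refine dependsOn_testValue φ l θ fun i hi => ?_
  have hi' := Set.mem_Iio.1 hi
  have e : M.T * 2 ^ (l + 1) = 2 * (M.T * 2 ^ l) := by ring
  simp only [coarsen]
  rw [hxy (2 * i) (Set.mem_Iio.2 (by omega)), hxy (2 * i + 1) (Set.mem_Iio.2 (by omega))]

/-- Uniform bounds on the likelihood factors of all levels. -/
def LikBounds (M : Model Θ Y) (c C : ℝ) : Prop :=
  0 < c ∧ c ≤ C ∧ ∀ l θ w, ∀ t ∈ Finset.range M.T, c ≤ M.lik l θ w t ∧ M.lik l θ w t ≤ C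

lemma LikelihoodRegular.exists_likBounds (h : M.LikelihoodRegular) : ∃ c C, M.LikBounds c C := by
  obtain ⟨c, C, L, hc, hcC, -, hb⟩ := h.exists_bounds M.T
  exact ⟨c, C, hc, hcC, fun l θ w t ht => (hb t (Finset.mem_range.1 ht)).1 _ _⟩

namespace LikBounds

variable {c C : ℝ}

lemma maxLik (hb : M.LikBounds c C) (l : ℕ) (θ : Θ) (w : ℕ → ℝ) {t : ℕ}
    (ht : t ∈ Finset.range M.T) : c ≤ M.maxLik l θ w t ∧ M.maxLik l θ w t ≤ C :=
  ⟨(hb.2.2 l θ w t ht).1.trans (le_max_left _ _),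
    max_le (hb.2.2 l θ w t ht).2 (hb.2.2 (l - 1) θ (coarsen w) t ht).2⟩

lemma prodMaxLik (hb : M.LikBounds c C) (l : ℕ) (p : Θ × (ℕ → ℝ)) :
    c ^ M.T ≤ M.prodMaxLik l p ∧ M.prodMaxLik l p ≤ C ^ M.T := by
  constructor
  · calc c ^ M.T = ∏ _t ∈ Finset.range M.T, c := by simp
      _ ≤ _ := Finset.prod_le_prod (fun _ _ => hb.1.le) fun t ht => (hb.maxLik l p.1 p.2 ht).1
  · calc M.prodMaxLik l p ≤ ∏ _t ∈ Finset.range M.T, C :=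
        Finset.prod_le_prod (fun t ht => hb.1.le.trans (hb.maxLik l p.1 p.2 ht).1)
          fun t ht => (hb.maxLik l p.1 p.2 ht).2
      _ = _ := by simp

lemma factor (hb : M.LikBounds c C) {x m : ℝ} (hx : c ≤ x) (hxm : x ≤ m) (hm : m ≤ C) :
    c / C ≤ x / m ∧ 0 ≤ x / m ∧ x / m ≤ 1 := by
  have hx0 : 0 < x := hb.1.trans_le hx
  have hm0 : 0 < m := hx0.trans_le hxm
  exact ⟨div_le_div₀ hx0.le hx hm0 hm, by positivity, (div_le_one hm0).2 hxm⟩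

lemma fine_factor (hb : M.LikBounds c C) (l : ℕ) (p : Θ × (ℕ → ℝ)) {t : ℕ}
    (ht : t ∈ Finset.range M.T) :
    c / C ≤ M.lik (l + 1) p.1 p.2 t / M.maxLik (l + 1) p.1 p.2 t ∧
      0 ≤ M.lik (l + 1) p.1 p.2 t / M.maxLik (l + 1) p.1 p.2 t ∧
      M.lik (l + 1) p.1 p.2 t / M.maxLik (l + 1) p.1 p.2 t ≤ 1 :=
  hb.factor (hb.2.2 _ _ _ t ht).1 (le_max_left _ _) (hb.maxLik _ _ _ ht).2

lemma coarse_factor (hb : M.LikBounds c C) (l : ℕ) (p : Θ × (ℕ → ℝ)) {t : ℕ}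
    (ht : t ∈ Finset.range M.T) :
    c / C ≤ M.lik l p.1 (coarsen p.2) t / M.maxLik (l + 1) p.1 p.2 t ∧
      0 ≤ M.lik l p.1 (coarsen p.2) t / M.maxLik (l + 1) p.1 p.2 t ∧
      M.lik l p.1 (coarsen p.2) t / M.maxLik (l + 1) p.1 p.2 t ≤ 1 :=
  hb.factor (hb.2.2 _ _ _ t ht).1 (le_max_right _ _) (hb.maxLik _ _ _ ht).2

lemma div_pos (hb : M.LikBounds c C) : 0 < c / C :=
  _root_.div_pos hb.1 (hb.1.trans_le hb.2.1)

lemma fineRatio (hb : M.LikBounds c C) (l : ℕ) (p : Θ × (ℕ → ℝ)) :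
    (c / C) ^ M.T ≤ M.fineRatio l p ∧ M.fineRatio l p ≤ 1 := by
  constructor
  · calc (c / C) ^ M.T = ∏ _t ∈ Finset.range M.T, c / C := by
          rw [Finset.prod_const, Finset.card_range]
      _ ≤ _ := Finset.prod_le_prod (fun _ _ => hb.div_pos.le) fun t ht => (hb.fine_factor l p ht).1
  · exact Finset.prod_le_one (fun t ht => (hb.fine_factor l p ht).2.1)
      fun t ht => (hb.fine_factor l p ht).2.2

lemma coarseRatio (hb : M.LikBounds c C) (l : ℕ) (p : Θ × (ℕ → ℝ)) :
    (c / C) ^ M.T ≤ M.coarseRatio l p ∧ M.coarseRatio l p ≤ 1 := by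
  constructor
  · calc (c / C) ^ M.T = ∏ _t ∈ Finset.range M.T, c / C := by
          rw [Finset.prod_const, Finset.card_range]
      _ ≤ _ := Finset.prod_le_prod (fun _ _ => hb.div_pos.le)
        fun t ht => (hb.coarse_factor l p ht).1
  · exact Finset.prod_le_one (fun t ht => (hb.coarse_factor l p ht).2.1)
      fun t ht => (hb.coarse_factor l p ht).2.2

/-- Both products have factors in [0, 1] and common denominators at least c, so telescoping leaves
only differences of likelihood factors. -/
lemma abs_fineRatio_sub_coarseRatio_le (hb : M.LikBounds c C) (l : ℕ) (p : Θ × (ℕ → ℝ)) :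
    |M.fineRatio l p - M.coarseRatio l p| ≤
      c⁻¹ * ∑ t ∈ Finset.range M.T, |M.lik (l + 1) p.1 p.2 t - M.lik l p.1 (coarsen p.2) t| := by
  refine (abs_prod_sub_prod_le _ (fun t ht => ?_) fun t ht => ?_).trans ?_
  · rw [abs_of_nonneg (hb.fine_factor l p ht).2.1]
    exact (hb.fine_factor l p ht).2.2
  · rw [abs_of_nonneg (hb.coarse_factor l p ht).2.1]
    exact (hb.coarse_factor l p ht).2.2
  · rw [Finset.mul_sum]
    refine Finset.sum_le_sum fun t ht => ?_
    have hm := (hb.maxLik (l + 1) p.1 p.2 ht).1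
    rw [← sub_div, abs_div, abs_of_pos (hb.1.trans_le hm), div_eq_inv_mul]
    exact mul_le_mul_of_nonneg_right (inv_anti₀ hb.1 hm) (abs_nonneg _)

end LikBounds

/-! ### The distance of the coupled levels -/

/-- The distance between the two levels along a coupled path. -/
noncomputable def levelGap (M : Model Θ Y) (l : ℕ) (p : Θ × (ℕ → ℝ)) : ℝ :=
  (∑ t ∈ Finset.range M.T, |M.lik (l + 1) p.1 p.2 t - M.lik l p.1 (coarsen p.2) t|) +
    ∑ t, |M.skeleton (l + 1) p.1 p.2 t - M.skeleton l p.1 (coarsen p.2) t|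

lemma exists_msq_levelGap_le {Ω : Type*} [MeasurableSpace Ω] {P : Measure Ω} {W : ℝ≥0 → Ω → ℝ}
    {V : Θ → ℝ≥0 → Ω → ℝ} {H β : ℝ} (h₂ : M.StrongError P W V β) (hW : IsPreBrownianReal W P)
    (hV : ∀ θ t, AEMeasurable (V θ t) P) (hM : M.Standing H) (hH₀ : 0 ≤ H) (hH₁ : H < 1 / 2)
    (hβ : β ≤ H + 1 / 2) (h : M.LikelihoodRegular) :
    ∃ C : ℝ≥0, ∀ l θ, msq (l + 1) (fun w => M.levelGap l (θ, w)) ≤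
      C * ENNReal.ofReal ((stepSize (l + 1) : ℝ) ^ (2 * β)) := by
  obtain ⟨C₀, hC₀⟩ := h₂.exists_msq_coupled_le hW hV hM
  obtain ⟨C₁, hC₁⟩ := h₂.exists_msq_euler_half_le hW hV hM hH₀ hH₁ hβ
  obtain ⟨C₂, hC₂⟩ := exists_msq_lik_sub_le hM h hC₁
  refine ⟨2 * (M.T * (M.T * C₂) + M.T * (M.T * C₀)), fun l θ => ?_⟩
  set ε := ENNReal.ofReal ((stepSize (l + 1) : ℝ) ^ (2 * β))
  have hme : ∀ l k, Measurable fun w : ℕ → ℝ => M.euler l θ w k := fun l k =>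
    measurable_euler_right hM.b_measurable hM.σ_measurable l k θ
  have hml : ∀ l t, Measurable fun w : ℕ → ℝ => M.lik l θ w t := fun l t =>
    (measurable_lik hM h l t).comp measurable_prodMk_left
  have habs : ∀ f : (ℕ → ℝ) → ℝ, msq (l + 1) (fun w => |f w|) = msq (l + 1) f := fun f => by
    simp only [msq, sq_abs]
  have m1 : ∀ t, Measurable fun w : ℕ → ℝ =>
      |M.lik (l + 1) θ w t - M.lik l θ (coarsen w) t| := fun t =>
    ((hml _ t).sub ((hml _ t).comp measurable_coarsen)).abs
  have m2 : ∀ t : Fin M.T, Measurable fun w : ℕ → ℝ =>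
      |M.skeleton (l + 1) θ w t - M.skeleton l θ (coarsen w) t| := fun t =>
    ((hme _ _).sub ((hme _ _).comp measurable_coarsen)).abs
  have b1 : msq (l + 1) (fun w => ∑ t ∈ Finset.range M.T,
      |M.lik (l + 1) θ w t - M.lik l θ (coarsen w) t|) ≤ M.T * (M.T * (C₂ * ε)) := by
    refine (msq_sum_le _ _ m1).trans ?_
    rw [Finset.card_range]
    refine mul_le_mul' le_rfl ?_
    refine (Finset.sum_le_card_nsmul _ _ (C₂ * ε) fun t ht => ?_).trans ?_
    · rw [habs]
      exact hC₂ l θ t (Finset.mem_range.1 ht)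
    · rw [Finset.card_range, nsmul_eq_mul]
  have b2 : msq (l + 1) (fun w => ∑ t,
      |M.skeleton (l + 1) θ w t - M.skeleton l θ (coarsen w) t|) ≤ M.T * (M.T * (C₀ * ε)) := by
    refine (msq_sum_le _ _ m2).trans ?_
    rw [Finset.card_univ, Fintype.card_fin]
    refine mul_le_mul' le_rfl ?_
    refine (Finset.sum_le_card_nsmul _ _ (C₀ * ε) fun t _ => ?_).trans ?_
    · rw [habs]
      have := hC₀ l θ ((t + 1) * 2 ^ l) (Nat.mul_le_mul_right _ t.2)
      rwa [show 2 * (((t : ℕ) + 1) * 2 ^ l) = (t + 1) * 2 ^ (l + 1) by ring] at this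
    · rw [Finset.card_univ, Fintype.card_fin, nsmul_eq_mul]
  refine (msq_add_le (l + 1) (Finset.measurable_fun_sum _ fun t _ => m1 t)).trans ?_
  refine (mul_le_mul' le_rfl (add_le_add b1 b2)).trans (le_of_eq ?_)
  push_cast
  ring

end Model

/-! ### Stationary averages and the two posteriors -/

namespace Model

variable {Θ Y : Type*} [MeasurableSpace Θ] {M : Model Θ Y} {l : ℕ}

/-- The two ratios of stationary averages are the posterior expectations of the two levels. -/
lemma posteriorExp_eq_ratio {H : ℝ} (hM : M.Standing H) (h : M.LikelihoodRegular)
    {Ω : Type*} [MeasurableSpace Ω] {P : Measure Ω} {W : ℝ≥0 → Ω → ℝ}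
    (hW : IsPreBrownianReal W P) {φ : Θ × (Fin M.T → ℝ) → ℝ} (hφ : Measurable φ) {z : ℝ}
    (hz : 0 < z) {η : Measure (M.State Θ (l + 1))}
    (hη : ∀ F : Θ × (ℕ → ℝ) → ℝ, Measurable F →
      (∀ θ, DependsOn (fun w => F (θ, w)) (Set.Iio (M.T * 2 ^ (l + 1)))) →
      ∫ x, F (x.1, path x) ∂η =
        z * ∫ p, M.prodMaxLik (l + 1) p * F p ∂M.priorNoise (l + 1)) :
    (∫ x : M.State Θ (l + 1), M.testValue (l + 1) φ (x.1, path x) *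
        M.fineRatio l (x.1, path x) ∂η) /
      (∫ x : M.State Θ (l + 1), M.fineRatio l (x.1, path x) ∂η) = M.posteriorExp (l + 1) φ ∧
    (∫ x : M.State Θ (l + 1), M.testValue l φ (x.1, coarsen (path x)) *
        M.coarseRatio l (x.1, path x) ∂η) /
      (∫ x : M.State Θ (l + 1), M.coarseRatio l (x.1, path x) ∂η) = M.posteriorExp l φ := by
  have mT := measurable_testValue hM hφ (l + 1)
  have mT' : Measurable fun p : Θ × (ℕ → ℝ) => M.testValue l φ (p.1, coarsen p.2) :=
    (measurable_testValue hM hφ l).comp measurable_coarsen_right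
  have mF := measurable_fineRatio (l := l) hM h
  have mC := measurable_coarseRatio (l := l) hM h
  have mL := measurable_likelihood hM h l
  have mLT : Measurable fun p => M.likelihood l p * M.testValue l φ p :=
    mL.mul (measurable_testValue hM hφ l)
  constructor
  · rw [hη (fun p => M.testValue (l + 1) φ p * M.fineRatio l p) (mT.mul mF) fun θ x y hxy => by
        have h1 := dependsOn_testValue φ (l + 1) θ hxy
        have h2 := dependsOn_fineRatio (M := M) l θ hxy
        simp only at h1 h2
        simp only [h1, h2],
      -- The unknown normalizing constant z cancels in the ratio.
      hη (M.fineRatio l) mF (dependsOn_fineRatio l), mul_div_mul_left _ _ hz.ne',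
      posteriorExp_eq hM h hφ]
    simp_rw [← prodMaxLik_mul_fineRatio h]
    congr 2
    funext p
    ring
  · rw [hη (fun p => M.testValue l φ (p.1, coarsen p.2) * M.coarseRatio l p) (mT'.mul mC)
        fun θ x y hxy => by
          have h1 := dependsOn_testValue_coarsen φ l θ hxy
          have h2 := dependsOn_coarseRatio (M := M) l θ hxy
          simp only at h1 h2
          simp only [h1, h2],
      hη (M.coarseRatio l) mC (dependsOn_coarseRatio l), mul_div_mul_left _ _ hz.ne',
      posteriorExp_eq hM h hφ, integral_priorNoise_coarsen hM hW l mLT,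
      integral_priorNoise_coarsen hM hW l mL]
    simp_rw [← prodMaxLik_mul_coarseRatio h]
    congr 2
    funext p
    ring

/-- Bounds in stationary mean square follow from bounds under the prior. -/
lemma integral_sq_path_le {H : ℝ} (hM : M.Standing H) {c C z : ℝ} (hc : 0 < c)
    (hzc : z ≤ c⁻¹)
    (hcC : ∀ θ w, c ≤ M.prodMaxLik (l + 1) (θ, w) ∧ M.prodMaxLik (l + 1) (θ, w) ≤ C)
    {η : Measure (M.State Θ (l + 1))}
    (hη : ∀ F : Θ × (ℕ → ℝ) → ℝ, Measurable F →
      (∀ θ, DependsOn (fun w => F (θ, w)) (Set.Iio (M.T * 2 ^ (l + 1)))) →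
      ∫ x, F (x.1, path x) ∂η =
        z * ∫ p, M.prodMaxLik (l + 1) p * F p ∂M.priorNoise (l + 1))
    {F : Θ × (ℕ → ℝ) → ℝ} (hF : BddMeasurable F)
    (hloc : ∀ θ, DependsOn (fun w => F (θ, w)) (Set.Iio (M.T * 2 ^ (l + 1)))) {k e : ℝ}
    (he : 0 ≤ e) (hFk : ∀ p, |F p| ≤ k * |M.levelGap l p|)
    (hgap : ∀ θ, msq (l + 1) (fun w => M.levelGap l (θ, w)) ≤ ENNReal.ofReal e) :
    ∫ x : M.State Θ (l + 1), F (x.1, path x) ^ 2 ∂η ≤ c⁻¹ * C * k ^ 2 * e := by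
  have hpn := isProbabilityMeasure_priorNoise (l := l + 1) hM
  have h1 : ∫ p, F p ^ 2 ∂M.priorNoise (l + 1) ≤ k ^ 2 * e := by
    refine integral_sq_priorNoise_le hM hF.measurable (by positivity) fun θ => ?_
    rw [ENNReal.ofReal_mul (sq_nonneg k)]
    refine (msq_mono fun w => ?_).trans ((msq_const_mul (l + 1) k _).le.trans
      (mul_le_mul' le_rfl (hgap θ)))
    rw [abs_mul]
    exact (hFk _).trans (mul_le_mul_of_nonneg_right (le_abs_self k) (abs_nonneg _))
  rw [hη (fun p => F p ^ 2) (hF.measurable.pow_const 2) fun θ x y hxy => by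
    have := hloc θ hxy
    simp only at this
    simp only [this]]
  have hF2 : Integrable (fun p => F p ^ 2) (M.priorNoise (l + 1)) := hF.sq.integrable _
  have h0 : 0 ≤ ∫ p, F p ^ 2 ∂M.priorNoise (l + 1) := integral_nonneg fun _ => sq_nonneg _
  have h2 : ∫ p, M.prodMaxLik (l + 1) p * F p ^ 2 ∂M.priorNoise (l + 1) ≤
      C * ∫ p, F p ^ 2 ∂M.priorNoise (l + 1) := by
    rw [← integral_const_mul]
    refine integral_mono_of_nonneg (ae_of_all _ fun p => ?_) (hF2.const_mul C)
      (ae_of_all _ fun p => ?_)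
    · exact mul_nonneg (hc.le.trans (hcC p.1 p.2).1) (sq_nonneg _)
    · exact mul_le_mul_of_nonneg_right (hcC p.1 p.2).2 (sq_nonneg _)
  have h3 : 0 ≤ ∫ p, M.prodMaxLik (l + 1) p * F p ^ 2 ∂M.priorNoise (l + 1) :=
    integral_nonneg fun p => mul_nonneg (hc.le.trans (hcC p.1 p.2).1) (sq_nonneg _)
  have hpne : Nonempty (Θ × (ℕ → ℝ)) := nonempty_of_isProbabilityMeasure (M.priorNoise (l + 1))
  obtain ⟨p₀⟩ := hpne
  have hC : 0 ≤ C := hc.le.trans ((hcC p₀.1 p₀.2).1.trans (hcC p₀.1 p₀.2).2)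
  calc _ ≤ c⁻¹ * (C * (k ^ 2 * e)) := mul_le_mul hzc
        (h2.trans (mul_le_mul_of_nonneg_left h1 hC)) h3 (by positivity)
    _ = _ := by ring

end Model

end SVE

/-! ### The mean square error bound -/

theorem proposition1 {Θ : Type*} [MetricSpace Θ] [MeasurableSpace Θ] [BorelSpace Θ] {Y : Type*}
    (M : SVE.Model Θ Y)
    -- the Volterra processes, driven by a common Brownian motion
    {Ω : Type*} [MeasurableSpace Ω] (P : Measure Ω) [IsProbabilityMeasure P]
    (ℱ : Filtration ℝ≥0 (inferInstance : MeasurableSpace Ω))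
    (W : ℝ≥0 → Ω → ℝ) (hW : SVE.IsBrownianFor ℱ P W)
    (V : Θ → ℝ≥0 → Ω → ℝ)
    (hV : ∀ θ, SVE.IsVolterraSolution ℱ P W M.T M.K (M.b θ) (M.σ θ) M.v₀ (V θ))
    -- standing conditions and the range of the strong rate
    (H β : ℝ) (hH₀ : 0 ≤ H) (hH₁ : H < 1 / 2) (hM : M.Standing H)
    (hβ₀ : 0 < β) (hβ₁ : β ≤ H + 1 / 2)
    -- the three assumptions
    (h₁ : M.LikelihoodRegular) (h₂ : M.StrongError P W V β)
    (η : ∀ l, Measure (SVE.Model.State Θ M l)) (h₃ : M.KernelRegular η)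
    -- the test function
    (φ : Θ × (Fin M.T → ℝ) → ℝ) (hφ_meas : Measurable φ) (hφ_bdd : ∃ C : ℝ, ∀ z, |φ z| ≤ C)
    (hφ_lip : ∃ L : ℝ, ∀ θ θ' v v',
      |φ (θ, v) - φ (θ', v')| ≤ L * (dist θ θ' + ∑ t, |v t - v' t|)) :
    ∃ C : ℝ, ∀ l m : ℕ, 1 ≤ l → 1 ≤ m →
      -- every chain at level `l` started in stationarity
      ∀ {Ω' : Type*} [MeasurableSpace Ω'] (P' : Measure Ω') [IsProbabilityMeasure P']
        (X : ℕ → Ω' → SVE.Model.State Θ M l),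
        SVE.Model.IsMarkovChain (M.mcmcKernel l) (η l) P' X →
        Integrable (fun ω => (M.estimator l φ m (fun k => X k ω) -
          (M.posteriorExp l φ - M.posteriorExp (l - 1) φ)) ^ 2) P' ∧
        ∫ ω, (M.estimator l φ m (fun k => X k ω) -
          (M.posteriorExp l φ - M.posteriorExp (l - 1) φ)) ^ 2 ∂P'
          ≤ C * (SVE.stepSize l : ℝ) ^ (2 * β) / m := by
  open SVE SVE.Model in
  have hWp := hW.isBrownian.toIsPreBrownianReal
  have hVm : ∀ θ t, AEMeasurable (V θ t) P := fun θ t =>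
    (((hV θ).adapted t).mono (ℱ.le t)).measurable.aemeasurable
  obtain ⟨Cg, hCg⟩ := exists_msq_levelGap_le h₂ hWp hVm hM hH₀ hH₁ hβ₁ h₁
  obtain ⟨c, C, hb⟩ := h₁.exists_likBounds
  obtain ⟨K, hK⟩ := hφ_bdd
  obtain ⟨L, hL⟩ := hφ_lip
  obtain ⟨ξ, hξ₀, hξ₁, hmin⟩ := h₃.minorization
  have hcT : 0 < c ^ M.T := pow_pos hb.1 _
  have hci : 0 < c⁻¹ := inv_pos.2 hb.1
  -- The first two terms serve the difference of the numerators, the last one that of the weights;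
  -- one constant covers both.
  set k := |K| * c⁻¹ + |L| + c⁻¹
  set E := (c ^ M.T)⁻¹ * C ^ M.T * k ^ 2
  refine ⟨ratioConst ξ ((c / C) ^ M.T) |K| * (E * Cg), ?_⟩
  intro l m hl hm Ω' _ P' _ X hX
  -- Writing the level as l + 1 turns the coarse level l - 1 into l.
  obtain ⟨l, rfl⟩ : ∃ l', l = l' + 1 := ⟨l - 1, by omega⟩
  obtain ⟨ν, hν, hνκ⟩ := hmin (l + 1) hl
  have hηp := h₃.isProbability (l + 1) hl
  have hmk := isMarkovKernel_mcmcKernel (l := l + 1) hM h₁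
  have hinv := (h₃.reversible (l + 1) hl).invariant
  have hG : ∀ θ w, c ^ M.T ≤ M.prodMaxLik (l + 1) (θ, w) ∧
      M.prodMaxLik (l + 1) (θ, w) ≤ C ^ M.T := fun θ w => hb.prodMaxLik _ _
  obtain ⟨z, hz, hzc, hη⟩ := h₃.exists_integral_eq (l := l) hM h₁ hcT hG
  set ε : ℝ := (stepSize (l + 1) : ℝ) ^ (2 * β)
  have hε : 0 ≤ ε := Real.rpow_nonneg (NNReal.coe_nonneg _) _
  have hgap : ∀ θ, msq (l + 1) (fun w => M.levelGap l (θ, w)) ≤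
      ENNReal.ofReal (Cg * ε) := fun θ => by
    rw [ENNReal.ofReal_mul Cg.coe_nonneg, ENNReal.ofReal_coe_nnreal]
    exact hCg l θ
  have hgap0 : ∀ p, 0 ≤ M.levelGap l p := fun p =>
    add_nonneg (Finset.sum_nonneg fun _ _ => abs_nonneg _)
      (Finset.sum_nonneg fun _ _ => abs_nonneg _)
  have hc0 : 0 < (c / C) ^ M.T := pow_pos hb.div_pos _
  have hfn : ∀ p, 0 ≤ M.fineRatio l p := fun p => hc0.le.trans (hb.fineRatio l p).1
  have hcn : ∀ p, 0 ≤ M.coarseRatio l p := fun p => hc0.le.trans (hb.coarseRatio l p).1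
  have hK' : ∀ l p, |M.testValue l φ p| ≤ |K| := fun l p => (hK _).trans (le_abs_self K)
  have bT : BddMeasurable (M.testValue (l + 1) φ) :=
    ⟨measurable_testValue hM hφ_meas _, |K|, hK' _⟩
  have bT' : BddMeasurable fun p : Θ × (ℕ → ℝ) => M.testValue l φ (p.1, coarsen p.2) :=
    ⟨(measurable_testValue hM hφ_meas l).comp measurable_coarsen_right, |K|, fun p => hK' _ _⟩
  have bF : BddMeasurable (M.fineRatio l) := ⟨measurable_fineRatio hM h₁, 1, fun p => by
    rw [abs_of_nonneg (hfn p)]; exact (hb.fineRatio l p).2⟩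
  have bC : BddMeasurable (M.coarseRatio l) := ⟨measurable_coarseRatio hM h₁, 1, fun p => by
    rw [abs_of_nonneg (hcn p)]; exact (hb.coarseRatio l p).2⟩
  have hFC : ∀ p, |M.fineRatio l p - M.coarseRatio l p| ≤ c⁻¹ * M.levelGap l p := fun p =>
    (hb.abs_fineRatio_sub_coarseRatio_le l p).trans (mul_le_mul_of_nonneg_left
      (le_add_of_nonneg_right (Finset.sum_nonneg fun _ _ => abs_nonneg _)) hci.le)
  have hTT : ∀ p, |M.testValue (l + 1) φ p - M.testValue l φ (p.1, coarsen p.2)| ≤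
      |L| * M.levelGap l p := fun p => by
    refine (hL _ _ _ _).trans ?_
    rw [dist_self, zero_add]
    -- The coupled paths share the parameter, so only the path part of the Lipschitz bound remains.
    have hs : 0 ≤ ∑ t, |M.skeleton (l + 1) p.1 p.2 t - M.skeleton l p.1 (coarsen p.2) t| :=
      Finset.sum_nonneg fun _ _ => abs_nonneg _
    exact (mul_le_mul_of_nonneg_right (le_abs_self L) hs).trans (mul_le_mul_of_nonneg_left
      (le_add_of_nonneg_left (Finset.sum_nonneg fun _ _ => abs_nonneg _)) (abs_nonneg L))
  have hBD : ∀ p, |M.coarseRatio l p - M.fineRatio l p| ≤ k * |M.levelGap l p| := fun p => by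
    rw [abs_sub_comm, abs_of_nonneg (hgap0 p)]
    exact (hFC p).trans (mul_le_mul_of_nonneg_right
      (le_add_of_nonneg_left (by positivity)) (hgap0 p))
  have hAC : ∀ p : Θ × (ℕ → ℝ), |M.testValue (l + 1) φ p * M.fineRatio l p -
      M.testValue l φ (p.1, coarsen p.2) * M.coarseRatio l p| ≤ k * |M.levelGap l p| := fun p => by
    rw [abs_of_nonneg (hgap0 p), show M.testValue (l + 1) φ p * M.fineRatio l p -
      M.testValue l φ (p.1, coarsen p.2) * M.coarseRatio l p =
        M.testValue (l + 1) φ p * (M.fineRatio l p - M.coarseRatio l p) +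
        (M.testValue (l + 1) φ p - M.testValue l φ (p.1, coarsen p.2)) * M.coarseRatio l p by ring]
    refine (abs_add_le _ _).trans ?_
    rw [abs_mul, abs_mul, abs_of_nonneg (hcn p)]
    have e1 := mul_le_mul (hK' (l + 1) p) (hFC p) (abs_nonneg _) (abs_nonneg K)
    have e2 := (mul_le_of_le_one_right (abs_nonneg
      (M.testValue (l + 1) φ p - M.testValue l φ (p.1, coarsen p.2)))
        (hb.coarseRatio l p).2).trans (hTT p)
    have e3 := mul_nonneg hci.le (hgap0 p)
    calc _ ≤ |K| * (c⁻¹ * M.levelGap l p) + |L| * M.levelGap l p := add_le_add e1 e2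
      _ ≤ |K| * (c⁻¹ * M.levelGap l p) + |L| * M.levelGap l p + c⁻¹ * M.levelGap l p :=
        le_add_of_nonneg_right e3
      _ = _ := by simp only [k]; ring
  have locF := dependsOn_fineRatio (M := M) l
  have locC := dependsOn_coarseRatio (M := M) l
  have iAC := integral_sq_path_le hM hcT hzc hG hη ((bT.mul bF).sub (bT'.mul bC))
    (fun θ x y hxy => by
      have g1 := dependsOn_testValue φ (l + 1) θ hxy
      have g2 := dependsOn_testValue_coarsen φ l θ hxy
      have g3 := locF θ hxy
      have g4 := locC θ hxy
      simp only at g1 g2 g3 g4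
      simp only [g1, g2, g3, g4]) (mul_nonneg Cg.coe_nonneg hε) hAC hgap
  have iBD := integral_sq_path_le hM hcT hzc hG hη (bC.sub bF)
    (fun θ x y hxy => by
      have g3 := locF θ hxy
      have g4 := locC θ hxy
      simp only at g3 g4
      simp only [g3, g4]) (mul_nonneg Cg.coe_nonneg hε) hBD hgap
  obtain ⟨q1, q2⟩ := posteriorExp_eq_ratio hM h₁ hWp hφ_meas hz hη
  have mP := measurable_path (l := l + 1) hM
  have hmain := hX.ratio_difference hξ₀ hξ₁ hνκ hinv ((bT.mul bF).comp mP) (bF.comp mP)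
    ((bT'.mul bC).comp mP) (bC.comp mP) (k := |K|) hc0
    (fun x => by
      rw [abs_mul, abs_of_nonneg (hfn _)]
      exact (mul_le_of_le_one_right (abs_nonneg _) (hb.fineRatio l _).2).trans (hK' _ _))
    (fun x => by
      rw [abs_mul, abs_of_nonneg (hcn _)]
      exact (mul_le_of_le_one_right (abs_nonneg _) (hb.coarseRatio l _).2).trans (hK' _ _))
    (fun x => (hb.fineRatio l _).1) (fun x => (hb.coarseRatio l _).1)
    (fun x => (hb.coarseRatio l _).2) iAC iBD m
    (err := fun ω => M.estimator (l + 1) φ m (fun k => X k ω) -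
      (M.posteriorExp (l + 1) φ - M.posteriorExp l φ))
    (by
      funext ω
      rw [q1, q2]
      rfl)
  refine ⟨hmain.1, hmain.2.trans ?_⟩
  have hm0 : (0 : ℝ) < m := by exact_mod_cast hm
  -- The sign of the constant is read off from the bound just proved on a nonnegative integral; it
  -- is needed to replace 1/(m + 1) by 1/m.
  have hpos : 0 ≤ ratioConst ξ ((c / C) ^ M.T) |K| * (E * (Cg * ε)) := by
    have h0 : 0 ≤ ((m : ℝ) + 1)⁻¹ * (ratioConst ξ ((c / C) ^ M.T) |K| * (E * (Cg * ε))) :=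
      (integral_nonneg fun _ => sq_nonneg _).trans hmain.2
    exact nonneg_of_mul_nonneg_right h0 (by positivity)
  calc _ ≤ (m : ℝ)⁻¹ * (ratioConst ξ ((c / C) ^ M.T) |K| * (E * (Cg * ε))) :=
        mul_le_mul_of_nonneg_right (inv_anti₀ hm0 (by linarith)) hpos
    _ = _ := by ring
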